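/- Let $\mathbb D=\{z\in\mathbb C:|z|<1\}$. A convex harmonic mapping is a complex-valued harmonic function $f$ on $\mathbb D$ that is univalent (injective) in $\mathbb D$ and whose image $f(\mathbb D)$ is convex. Write $f=h+\overline g$ with $h,g$ analytic in $\mathbb D$, let $J_f=|h'|^2-|g'|^2$ be the Jacobian of $f$, and let $P_f=\frac{\partial}{\partial z}\log|J_f|$, where $\frac{\partial}{\partial z}=\frac12\left(\frac{\partial}{\partial x}-i\frac{\partial}{\partial y}\right)$, be the pre-Schwarzian derivative of $f$. Then, for every convex harmonic mapping $f$, the Jacobian $J_f$ does not vanish in $\mathbb D$ (so that $P_f$ is well defined in $\mathbb D$), and $$\|P_f\|=\sup_{z\in\mathbb D}|P_f(z)|\,(1-|z|^2)\le 5 .$$ The constant $5$ is sharp: the half-plane harmonic mapping $$L(z)=\frac{2z-z^2}{2(1-z)^2}+\overline{\left(\frac{-z^2}{2(1-z)^2}\right)},\qquad z\in\mathbb D,$$ is a convex harmonic mapping with $\|P_L\|=5$. -/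

import Mathlib

namespace HarmonicMapping

/-- The open unit disk in the complex plane. -/
abbrev disk : Set ℂ := Metric.ball (0 : ℂ) 1

/-- The Wirtinger derivative `∂u/∂z = (1/2) (∂u/∂x - i ∂u/∂y)`. -/
noncomputable def wirtinger (u : ℂ → ℂ) (z : ℂ) : ℂ :=
  (1 / 2 : ℂ) * (fderiv ℝ u z 1 - Complex.I * fderiv ℝ u z Complex.I)

/-- The Jacobian determinant of a planar map (for `f = h + conj g` it is `|h'|² - |g'|²`). -/
noncomputable def jacobian (f : ℂ → ℂ) (z : ℂ) : ℝ :=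
  (fderiv ℝ f z).det

/-- The pre-Schwarzian derivative `P_f = (log |J_f|)_z` of a locally univalent harmonic mapping.
The absolute value covers the sense-preserving case (`J_f > 0`) and the sense-reversing case
(`J_f < 0`), where `P_f` is the pre-Schwarzian derivative of the conjugate mapping. -/
noncomputable def preSchwarzian (f : ℂ → ℂ) (z : ℂ) : ℂ :=
  wirtinger (fun w => ((Real.log |jacobian f w| : ℝ) : ℂ)) z

/-- The pre-Schwarzian norm `sup_{|z| < 1} |P_f(z)| (1 - |z|²)`, as an extended nonnegative
real number. -/
noncomputable def preSchwarzianNorm (f : ℂ → ℂ) : ENNReal :=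
  ⨆ z ∈ disk, ENNReal.ofReal (‖preSchwarzian f z‖ * (1 - ‖z‖ ^ 2))

/-- A convex harmonic mapping of the unit disk: harmonic and univalent in the disk, with
convex image. -/
structure IsConvexHarmonic (f : ℂ → ℂ) : Prop where
  harmonic : InnerProductSpace.HarmonicOnNhd f disk
  univalent : Set.InjOn f disk
  convex_image : Convex ℝ (f '' disk)

/-- The half-plane harmonic mapping `L = h + conj g`, with
`h(z) = (2z - z²) / (2(1 - z)²)` and `g(z) = -z² / (2(1 - z)²)`. -/
noncomputable def halfPlaneMap (z : ℂ) : ℂ :=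
  (2 * z - z ^ 2) / (2 * (1 - z) ^ 2) +
    (starRingEnd ℂ) (-z ^ 2 / (2 * (1 - z) ^ 2))

end HarmonicMapping

namespace HarmonicMapping
open Complex Set Metric Filter Topology

/-! ### Paths in the closed disk with interlaced end points -/

/-! Write f = h + conj g. Lewy's theorem (`norm_deriv_ne_of_injOn`) gives |h'| ≠ |g'|, so the
Jacobian does not vanish. The norm bound reduces to a coefficient bound: |h''(0)| ≤ 3|h'(0)| for
convex f with g'(0) = 0 (`norm_deriv_deriv_le_three_mul`). For sense-preserving f, precompose with
the disk automorphism taking 0 to z₀ and postcompose with a real-linear map v ↦ v - c conj v that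
kills the derivative of the co-analytic part. Convexity and injectivity survive, and the coefficient
bound becomes |(1 - |z₀|²) P_f(z₀) - 2 conj z₀| ≤ 3, whence 3 + 2|z₀| ≤ 5. Conjugation handles the
sense-reversing case. The half-plane map attains 3 + 2r at radius r.

The coefficient bound is the sum of |g''(0)| ≤ |h'(0)|, which is the Schwarz lemma for g'/h', and
|h''(0)| - |g''(0)| ≤ 2|h'(0)|. For the second, one seeks a unimodular l such that F = l h + conj(l)
g satisfies |F''(0)| ≤ 2|F'(0)|; here Re F = Re(l f). Suppose that f extends continuously to the
circle and has a bounded strictly convex image. Each direction then has a unique maximum point on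
the circle, depending continuously on the direction, and an intermediate value argument yields a
direction whose maximum and minimum points are antipodal (`exists_antipodal`), say 1 and -1 after a
rotation. Half-plane sections of a convex domain are connected, so boundary values of Re F cannot
interlace about a level (`IsConvexParam.not_interlaced`). They therefore increase under hyperbolic
translations towards 1, and by the minimum principle so does Re F inside. Differentiating gives
Re((1 - z²) F') ≥ 0, and Carathéodory's inequality gives the bound.

A general f is reached by exhausting f(D) by strictly convex domains Ω. With φ a Riemann map onto
f⁻¹(Ω), the map f ∘ φ extends to the circle by the length-area principle and convexity, while
|φ'(0)| → 1 and φ''(0) → 0 as Ω grows. -/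

lemma one_sub_exp_mul_I (τ : ℝ) :
    1 - exp (τ * I) = ((2 * Real.sin (τ / 2) : ℝ) : ℂ) * exp (((τ - Real.pi) / 2 : ℝ) * I) := by
  have h1 : exp (τ * I) = exp ((τ / 2 : ℝ) * I) * exp ((τ / 2 : ℝ) * I) := by
    rw [← exp_add]; congr 1; push_cast; ring
  have h2 : exp (((τ - Real.pi) / 2 : ℝ) * I) = exp ((τ / 2 : ℝ) * I) * (-I) := by
    have h : (-I : ℂ) = exp (-(Real.pi / 2 * I)) := by
      rw [← neg_mul, ← neg_div, exp_neg_pi_div_two_mul_I]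
    rw [h, ← exp_add]; congr 1; push_cast; ring
  rw [h1, h2, exp_mul_I, ← ofReal_cos, ← ofReal_sin]
  have h3 := Real.sin_sq_add_cos_sq (τ / 2)
  generalize Real.sin (τ / 2) = s at *
  generalize Real.cos (τ / 2) = c at *
  apply Complex.ext
  · simp
    linear_combination -h3
  · simp
    ring

/-- The half-angle formula makes directions of chords explicit, which is what the winding count for
interlaced paths needs. -/
lemma arg_one_sub_exp_mul_I {τ : ℝ} (h0 : 0 < τ) (h1 : τ < 2 * Real.pi) :
    arg (1 - exp (τ * I)) = (τ - Real.pi) / 2 := by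
  rw [one_sub_exp_mul_I, arg_real_mul, arg_exp_mul_I, toIocMod_eq_self]
  · constructor <;> linarith [Real.pi_pos]
  · have := Real.sin_pos_of_pos_of_lt_pi (x := τ / 2) (by linarith) (by linarith)
    positivity

lemma mem_slitPlane_of_re_nonneg {w : ℂ} (h : 0 ≤ w.re) (h0 : w ≠ 0) : w ∈ slitPlane := by
  rw [mem_slitPlane_iff]
  by_contra! hc
  exact h0 (Complex.ext (le_antisymm hc.1 h) hc.2)

/-- Along a path in the closed right half-plane that avoids `0`, the increment of a continuous
logarithm is that of the principal one. -/
lemma log_increment_eq {w Λ : ℝ → ℂ} {c : ℂ} (hΛ : ContinuousOn Λ (Icc 0 1))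
    (hw : ContinuousOn w (Icc 0 1)) (hexp : ∀ t ∈ Icc (0 : ℝ) 1, exp (Λ t) = c * w t)
    (hre : ∀ t ∈ Icc (0 : ℝ) 1, 0 ≤ (w t).re) (h0 : ∀ t ∈ Icc (0 : ℝ) 1, w t ≠ 0) :
    Λ 1 - Λ 0 = log (w 1) - log (w 0) := by
  have hslit : ∀ t ∈ Icc (0 : ℝ) 1, w t ∈ slitPlane := fun t ht =>
    mem_slitPlane_of_re_nonneg (hre t ht) (h0 t ht)
  have hcont : ContinuousOn (fun t => Λ t - log (w t)) (Icc 0 1) := by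
    intro t ht
    exact (hΛ t ht).sub ((hw t ht).clog (hslit t ht))
  have hval : ∀ t ∈ Icc (0 : ℝ) 1, exp (Λ t - log (w t)) = c := by
    intro t ht
    rw [exp_sub, exp_log (h0 t ht), hexp t ht, mul_div_assoc, div_self (h0 t ht), mul_one]
  have hc : c ≠ 0 := by
    rw [← hval 0 (by simp)]; exact exp_ne_zero _
  -- the difference takes values in the discrete fibre of `exp` over `c`
  have hconst : ∀ t ∈ Icc (0 : ℝ) 1,
      Λ t - log (w t) = Λ 0 - log (w 0) := by
    -- The number of turns by which the two logarithms have drifted apart: continuous and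
    -- integer-valued, it cannot leave 0 without passing through 1/2 or -1/2.
    set d : ℝ → ℝ := fun t => ((Λ t - log (w t)).im - (Λ 0 - log (w 0)).im) / (2 * Real.pi)
    have hd : ContinuousOn d (Icc 0 1) := by
      refine ContinuousOn.div_const (ContinuousOn.sub ?_ continuousOn_const) _
      exact continuous_im.comp_continuousOn hcont
    have hbranch : ∀ t ∈ Icc (0 : ℝ) 1, ∃ n : ℤ, Λ t - log (w t) = Λ 0 - log (w 0) + n * (2 * Real.pi * I)
        ∧ d t = n := by
      intro t ht
      obtain ⟨n, hn⟩ := exp_eq_exp_iff_exists_int.1 ((hval t ht).trans (hval 0 (by simp)).symm)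
      refine ⟨n, hn, ?_⟩
      have := Real.pi_pos.ne'
      simp only [d]
      rw [hn]
      simp
    intro t ht
    obtain ⟨n, hn, hdn⟩ := hbranch t ht
    have hz : d 0 = 0 := by simp [d]
    have hn0 : n = 0 := by
      by_contra hne
      have hpre : IsPreconnected (d '' Icc 0 1) := isPreconnected_Icc.image _ hd
      have hmem : (0 : ℝ) ∈ d '' Icc 0 1 := ⟨0, by simp, hz⟩
      have hmem' : (n : ℝ) ∈ d '' Icc 0 1 := ⟨t, ht, hdn⟩
      have hhalf : ∃ y ∈ d '' Icc 0 1, ∀ m : ℤ, y ≠ m := by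
        rcases lt_or_gt_of_ne hne with h | h
        · refine ⟨-1/2, hpre.ordConnected.out hmem' hmem ⟨?_, by norm_num⟩, ?_⟩
          · have : (n : ℝ) ≤ -1 := by exact_mod_cast Int.le_sub_one_of_lt h
            linarith
          · intro m hm
            have : (-1 : ℤ) = 2 * m := by
              have : (-1 : ℝ) = 2 * m := by rw [← hm]; norm_num
              exact_mod_cast this
            omega
        · refine ⟨1/2, hpre.ordConnected.out hmem hmem' ⟨by norm_num, ?_⟩, ?_⟩
          · have : (1 : ℝ) ≤ n := by exact_mod_cast h
            linarith
          · intro m hm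
            have : (1 : ℤ) = 2 * m := by
              have : (1 : ℝ) = 2 * m := by rw [← hm]; norm_num
              exact_mod_cast this
            omega
      obtain ⟨y, ⟨t', ht', rfl⟩, hy⟩ := hhalf
      obtain ⟨m, -, hm⟩ := hbranch t' ht'
      exact hy m hm
    rw [hn, hn0]; simp
  have := hconst 1 (by simp)
  linear_combination this

lemma re_one_sub_div_nonneg {a v : ℂ} (ha : ‖a‖ = 1) (hv : ‖v‖ ≤ 1) : 0 ≤ (1 - v / a).re := by
  have : (v / a).re ≤ 1 := (re_le_norm _).trans (by rw [norm_div, ha]; simpa using hv)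
  simp only [sub_re, one_re]; linarith

/-- Two sets in the closed unit disk that join interlaced pairs of points of the circle meet. -/
theorem not_joinedIn_of_interlaced {A B : Set ℂ} (hA : A ⊆ closedBall 0 1)
    (hB : B ⊆ closedBall 0 1) (hAB : Disjoint A B) {α β γ δ : ℝ} (hαβ : α < β) (hβγ : β < γ)
    (hγδ : γ < δ) (hδα : δ < α + 2 * Real.pi)
    (hjA : JoinedIn A (exp (α * I)) (exp (γ * I))) (hjB : JoinedIn B (exp (β * I)) (exp (δ * I))) :
    False := by
  obtain ⟨p, hp⟩ := hjA
  obtain ⟨q, hq⟩ := hjB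
  have hne : ∀ s t, p s - q t ≠ 0 := fun s t h =>
    disjoint_left.1 hAB (hp s) (by rw [sub_eq_zero.1 h]; exact hq t)
  have hsc : IsSimplyConnected (univ : Set (ℝ × ℝ)) :=
    haveI : ContractibleSpace (univ : Set (ℝ × ℝ)) :=
      (convex_univ (𝕜 := ℝ)).contractibleSpace univ_nonempty
    inferInstanceAs (SimplyConnectedSpace (univ : Set (ℝ × ℝ)))
  -- Disjoint paths make p(s) - q(t) zero-free, so it has a continuous logarithm on the whole plane.
  -- On each side of the unit square one of the two points is fixed on the circle, and the increment
  -- is then a principal one.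
  have hext : Continuous (fun x : ℝ × ℝ => p.extend x.1 - q.extend x.2) := by fun_prop
  obtain ⟨Λ, hΛ, hΛe⟩ := exists_continuousOn_eqOn_exp_comp hsc isOpen_univ
    (g := fun x : ℝ × ℝ => p.extend x.1 - q.extend x.2) hext.continuousOn (by
      rintro ⟨x, -, hx⟩
      exact hne _ _ hx)
  have hΛc : Continuous Λ := continuousOn_univ.1 hΛ
  have hΛe' : ∀ s t, exp (Λ (s, t)) = p.extend s - q.extend t := fun s t => hΛe (mem_univ (s, t))
  have hp1 : ∀ s, ‖p.extend s‖ ≤ 1 := fun s => mem_closedBall_zero_iff.1 (hA (hp _))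
  have hq1 : ∀ s, ‖q.extend s‖ ≤ 1 := fun s => mem_closedBall_zero_iff.1 (hB (hq _))
  have hne' : ∀ s t, p.extend s - q.extend t ≠ 0 := fun s t => hne _ _
  have hu : ∀ x : ℝ, ‖exp (x * I)‖ = 1 := fun x => norm_exp_ofReal_mul_I x
  have hu0 : ∀ x : ℝ, exp (x * I) ≠ 0 := fun x => exp_ne_zero _
  have key1 : ∀ (s x : ℝ), p.extend s = exp (x * I) →
      Λ (s, 1) - Λ (s, 0) = log (1 - exp (δ * I) / exp (x * I)) -
        log (1 - exp (β * I) / exp (x * I)) := by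
    intro s x hs
    have := log_increment_eq (w := fun t => 1 - q.extend t / exp (x * I)) (Λ := fun t => Λ (s, t))
      (c := exp (x * I)) (by fun_prop) (by fun_prop)
      (fun t _ => by rw [hΛe', hs]; field_simp [hu0 x])
      (fun t _ => re_one_sub_div_nonneg (hu x) (hq1 t))
      (fun t _ h => hne' s t (by rw [hs]; field_simp [hu0 x] at h; simpa using h))
    simpa using this
  have key2 : ∀ (t x : ℝ), q.extend t = exp (x * I) →
      Λ (1, t) - Λ (0, t) = log (1 - exp (γ * I) / exp (x * I)) -
        log (1 - exp (α * I) / exp (x * I)) := by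
    intro t x ht
    have := log_increment_eq (w := fun s => 1 - p.extend s / exp (x * I)) (Λ := fun s => Λ (s, t))
      (c := -exp (x * I)) (by fun_prop) (by fun_prop)
      (fun s _ => by rw [hΛe', ht]; field_simp [hu0 x]; ring)
      (fun s _ => re_one_sub_div_nonneg (hu x) (hp1 s))
      (fun s _ h => hne' s t (by rw [ht]; field_simp [hu0 x] at h; linear_combination -h))
    simpa using this
  have harg : ∀ x y : ℝ, y < x → x < y + 2 * Real.pi →
      (log (1 - exp (x * I) / exp (y * I))).im = (x - y - Real.pi) / 2 := by
    intro x y h1 h2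
    rw [log_im, ← exp_sub, show (x * I - y * I : ℂ) = ((x - y : ℝ) : ℂ) * I by push_cast; ring,
      arg_one_sub_exp_mul_I (by linarith) (by linarith)]
  have harg' : ∀ x y : ℝ, x < y → y < x + 2 * Real.pi →
      (log (1 - exp (x * I) / exp (y * I))).im = (x - y + Real.pi) / 2 := by
    intro x y h1 h2
    have : exp (x * I) = exp ((x + 2 * Real.pi : ℝ) * I) := by
      push_cast; rw [add_mul, exp_add, exp_two_pi_mul_I, mul_one]
    rw [this, harg _ _ (by linarith) (by linarith)]; ring
  have e1 := congrArg im (key1 0 α (by simp))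
  have e2 := congrArg im (key1 1 γ (by simp))
  have e3 := congrArg im (key2 0 β (by simp))
  have e4 := congrArg im (key2 1 δ (by simp))
  simp only [sub_im] at e1 e2 e3 e4
  rw [harg _ _ (by linarith) (by linarith), harg _ _ (by linarith) (by linarith)] at e1
  rw [harg _ _ (by linarith) (by linarith), harg' _ _ (by linarith) (by linarith)] at e2
  rw [harg _ _ (by linarith) (by linarith), harg' _ _ (by linarith) (by linarith)] at e3
  rw [harg' _ _ (by linarith) (by linarith), harg' _ _ (by linarith) (by linarith)] at e4
  -- The two ways round the square from (0,0) to (1,1) give imaginary increments that differ by 2π.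
  linarith [Real.pi_pos]

end HarmonicMapping


namespace HarmonicMapping
open Complex Set Metric Filter Topology

/-! ### Lewy's theorem -/

/-- A real-valued continuous function cannot be injective on the union of three arcs that share
only their initial point. -/
lemma not_injective_on_three_arms {z₀ : ℂ} {γ : Fin 3 → ℝ → ℂ} {v : ℂ → ℝ}
    (hstart : ∀ i, γ i 0 = z₀)
    (hne : ∀ i, ∀ t ∈ Ioc (0 : ℝ) 1, γ i t ≠ z₀)
    (hdisj : ∀ i j, i ≠ j → ∀ s ∈ Ioc (0 : ℝ) 1, ∀ t ∈ Ioc (0 : ℝ) 1, γ i s ≠ γ j t)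
    (hcont : ∀ i, ContinuousOn (fun t => v (γ i t)) (Icc 0 1))
    (hinj : ∀ i j, ∀ s ∈ Icc (0 : ℝ) 1, ∀ t ∈ Icc (0 : ℝ) 1,
      v (γ i s) = v (γ j t) → γ i s = γ j t) : False := by
  have h1 : (1 : ℝ) ∈ Icc (0 : ℝ) 1 := by simp
  have h0 : (0 : ℝ) ∈ Icc (0 : ℝ) 1 := by simp
  have hv1 : ∀ i, v (γ i 1) ≠ v z₀ := by
    intro i h
    rw [← hstart i] at h
    exact hne i 1 (by simp) ((hinj i i 1 h1 0 h0 h).trans (hstart i))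
  -- two arms end on the same side
  have hside : ∀ i j, i ≠ j → ¬ (0 < (v (γ i 1) - v z₀) * (v (γ j 1) - v z₀)) := by
    intro i j hij hpos
    wlog hle : |v (γ i 1) - v z₀| ≤ |v (γ j 1) - v z₀| generalizing i j
    · exact this j i hij.symm (by rwa [mul_comm]) (le_of_not_ge hle)
    have hmem : v (γ i 1) ∈ (fun t => v (γ j t)) '' Icc (0 : ℝ) 1 := by
      have hoc := (isPreconnected_Icc.image _ (hcont j)).ordConnected
      have m0 : v z₀ ∈ (fun t => v (γ j t)) '' Icc (0 : ℝ) 1 := ⟨0, h0, by simp [hstart]⟩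
      have m1 : v (γ j 1) ∈ (fun t => v (γ j t)) '' Icc (0 : ℝ) 1 := ⟨1, h1, rfl⟩
      rcases mul_pos_iff.1 hpos with ⟨ha, hb⟩ | ⟨ha, hb⟩
      · rw [abs_of_pos ha, abs_of_pos hb] at hle
        exact hoc.out m0 m1 ⟨by linarith, by linarith⟩
      · rw [abs_of_neg ha, abs_of_neg hb] at hle
        exact hoc.out m1 m0 ⟨by linarith, by linarith⟩
    obtain ⟨t, ht, hvt⟩ := hmem
    have heq := hinj i j 1 h1 t ht hvt.symm
    rcases eq_or_lt_of_le ht.1 with h | h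
    · rw [← h, hstart] at heq
      exact hne i 1 (by simp) heq
    · exact hdisj i j hij 1 (by simp) t ⟨h, ht.2⟩ heq
  have a0 := sub_ne_zero.2 (hv1 0)
  have a1 := sub_ne_zero.2 (hv1 1)
  have a2 := sub_ne_zero.2 (hv1 2)
  have b01 := hside 0 1 (by decide)
  have b02 := hside 0 2 (by decide)
  have b12 := hside 1 2 (by decide)
  rcases lt_or_gt_of_ne a0 with c0 | c0 <;> rcases lt_or_gt_of_ne a1 with c1 | c1 <;>
    rcases lt_or_gt_of_ne a2 with c2 | c2 <;>
    first
    | exact b01 (mul_pos c0 c1) | exact b02 (mul_pos c0 c2) | exact b12 (mul_pos c1 c2)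
    | exact b01 (mul_pos_of_neg_of_neg c0 c1) | exact b02 (mul_pos_of_neg_of_neg c0 c2)
    | exact b12 (mul_pos_of_neg_of_neg c1 c2)

/-- Near a critical point, an analytic function is a power of a local coordinate, or constant. -/
lemma eventually_eq_or_eq_pow_of_deriv_eq_zero {F : ℂ → ℂ} {z₀ : ℂ} (hF : AnalyticAt ℂ F z₀)
    (hd : deriv F z₀ = 0) :
    (∀ᶠ z in 𝓝 z₀, F z = F z₀) ∨ ∃ (k : ℕ) (ψ : ℂ → ℂ) (c : ℂ), 2 ≤ k ∧ ψ z₀ = 0 ∧ c ≠ 0 ∧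
      HasStrictDerivAt ψ c z₀ ∧ ∀ᶠ z in 𝓝 z₀, F z - F z₀ = ψ z ^ k := by
  have hF' : AnalyticAt ℂ (fun z => F z - F z₀) z₀ := hF.sub analyticAt_const
  by_cases htop : ∀ᶠ z in 𝓝 z₀, F z - F z₀ = 0
  · left
    filter_upwards [htop] with z hz using sub_eq_zero.1 hz
  right
  obtain ⟨k, g, hg, hg0, hk⟩ := hF'.exists_eventuallyEq_pow_smul_nonzero_iff.2 htop
  simp only [smul_eq_mul] at hk
  have hk0 : k ≠ 0 := by
    rintro rfl
    have := hk.self_of_nhds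
    simp at this
    exact hg0 this.symm
  have hder : HasDerivAt (fun z => F z - F z₀) 0 z₀ := by
    have := hF.differentiableAt.hasDerivAt.sub_const (F z₀)
    rwa [hd] at this
  have hk1 : k ≠ 1 := by
    rintro rfl
    have h1 : HasDerivAt (fun z => (z - z₀) ^ 1 * g z) (g z₀) z₀ := by
      have := (((hasDerivAt_id' z₀).sub_const z₀).fun_pow 1).fun_mul hg.differentiableAt.hasDerivAt
      simpa using this
    exact hg0 ((h1.congr_of_eventuallyEq hk).unique hder)
  have hkC : (k : ℂ) ≠ 0 := by exact_mod_cast hk0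
  -- A holomorphic k-th root of g: division by g z₀ puts the argument of `log` near 1, away from the
  -- cut.
  set ρ : ℂ → ℂ := fun z => g z₀ ^ (1 / k : ℂ) * exp (log (g z / g z₀) / k)
  have hρ : AnalyticAt ℂ ρ z₀ := by
    have hslit : g z₀ / g z₀ ∈ slitPlane := by rw [div_self hg0]; exact one_mem_slitPlane
    exact analyticAt_const.mul (((hg.div_const (c := g z₀)).clog hslit).div_const (c := (k : ℂ))).cexp
  have hρ0 : ρ z₀ ≠ 0 := by
    simp only [ρ]
    refine mul_ne_zero ?_ (exp_ne_zero _)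
    rw [cpow_def_of_ne_zero hg0]
    exact exp_ne_zero _
  have hρk : ∀ᶠ z in 𝓝 z₀, ρ z ^ k = g z := by
    filter_upwards [hg.continuousAt.eventually_ne hg0] with z hz
    simp only [ρ]
    rw [mul_pow, ← exp_nat_mul, mul_div_cancel₀ _ hkC, exp_log (div_ne_zero hz hg0), ← cpow_mul_nat,
      one_div, inv_mul_cancel₀ hkC, cpow_one, mul_div_cancel₀ _ hg0]
  refine ⟨k, fun z => (z - z₀) * ρ z, ρ z₀, by omega, by simp, hρ0, ?_, ?_⟩
  · have h1 : HasStrictDerivAt (fun z : ℂ => z - z₀) 1 z₀ := (hasStrictDerivAt_id z₀).sub_const z₀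
    simpa using h1.fun_mul hρ.hasStrictDerivAt
  · filter_upwards [hk, hρk] with z h1 h2
    rw [h1, mul_pow, h2]

/-- Along the rays of angles π/(2k), 3π/(2k), 5π/(2k) the k-th power is purely imaginary; they
supply three branches of the level set of a real part at a critical point. -/
lemma exp_arm_pow (k : ℕ) (hk : k ≠ 0) (j : Fin 3) (x : ℝ) :
    (((x : ℂ) * exp (((Real.pi * (2 * (j : ℕ) + 1) / (2 * k) : ℝ) : ℂ) * I)) ^ k).re = 0 := by
  have hkC : (k : ℂ) ≠ 0 := by exact_mod_cast hk
  rw [mul_pow, ← exp_nat_mul]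
  have : (k : ℂ) * (((Real.pi * (2 * (j : ℕ) + 1) / (2 * k) : ℝ) : ℂ) * I)
      = ((Real.pi * (2 * (j : ℕ) + 1) / 2 : ℝ) : ℂ) * I := by
    push_cast
    field_simp
  rw [this, exp_mul_I, ← ofReal_cos, ← ofReal_sin, ← ofReal_pow, re_ofReal_mul]
  have hc : Real.cos (Real.pi * (2 * (j : ℕ) + 1) / 2) = 0 := by
    rw [Real.cos_eq_zero_iff]
    exact ⟨(j : ℕ), by push_cast; ring⟩
  simp only [hc, add_re, ofReal_re, mul_re, I_re, I_im, ofReal_im]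
  ring

/-- The angles differ by at most 2π/k, which is below 2π precisely because k ≥ 2. -/
lemma exp_arm_ne {k : ℕ} (hk : 2 ≤ k) {i j : Fin 3} (hij : i ≠ j) {x y : ℝ} (hx : 0 < x)
    (hy : 0 < y) :
    (x : ℂ) * exp (((Real.pi * (2 * (i : ℕ) + 1) / (2 * k) : ℝ) : ℂ) * I) ≠
      (y : ℂ) * exp (((Real.pi * (2 * (j : ℕ) + 1) / (2 * k) : ℝ) : ℂ) * I) := by
  intro h
  have hkR : (2 : ℝ) ≤ k := by exact_mod_cast hk
  have hn := congrArg norm h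
  rw [norm_mul, norm_mul, norm_exp_ofReal_mul_I, norm_exp_ofReal_mul_I, norm_real, norm_real,
    Real.norm_of_nonneg hx.le, Real.norm_of_nonneg hy.le, mul_one, mul_one] at hn
  subst hn
  have h' := mul_left_cancel₀ (by exact_mod_cast hx.ne') h
  obtain ⟨n, hn⟩ := exp_eq_exp_iff_exists_int.1 h'
  have h2 := congrArg im hn
  simp only [mul_im, ofReal_re, I_im, ofReal_im, I_re, add_im, intCast_re, intCast_im,
    re_ofNat, im_ofNat, mul_re] at h2
  have h3 : (2 * (i : ℕ) + 1 : ℝ) = 2 * (j : ℕ) + 1 + 4 * n * k := by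
    have hp := Real.pi_pos
    have : Real.pi * (2 * (i : ℕ) + 1) / (2 * k) = Real.pi * (2 * (j : ℕ) + 1) / (2 * k)
      + n * (2 * Real.pi) := by linarith
    field_simp at this
    linarith
  have h4 : (2 * (i : ℕ) + 1 : ℤ) = 2 * (j : ℕ) + 1 + 4 * (n * k) := by
    have : (2 * (i : ℕ) + 1 : ℝ) = 2 * (j : ℕ) + 1 + 4 * (n * k) := by rw [h3]; ring
    exact_mod_cast this
  have hi := i.2
  have hj := j.2
  have hkZ : (2 : ℤ) ≤ k := by exact_mod_cast hk
  have hnk : n * k = 0 := by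
    rcases lt_trichotomy n 0 with hneg | h0 | hpos
    · nlinarith
    · simp [h0]
    · nlinarith
  rw [hnk] at h4
  exact hij (Fin.ext (by omega))

/-- **Lewy's theorem**: the Jacobian of an injective harmonic mapping does not vanish. -/
theorem norm_deriv_ne_of_injOn {h g : ℂ → ℂ} {z₀ : ℂ} {s : Set ℂ} (hs : s ∈ 𝓝 z₀)
    (hh : AnalyticAt ℂ h z₀) (hg : AnalyticAt ℂ g z₀)
    (hinj : InjOn (fun z => h z + (starRingEnd ℂ) (g z)) s) : ‖deriv h z₀‖ ≠ ‖deriv g z₀‖ := by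
  intro hnorm
  -- Equal moduli allow l to be chosen so that l f has the real part of a holomorphic F with F'(z₀)
  -- = 0. On a level set of Re F, injectivity of f passes to the real function Im(l f), which three
  -- arms contradict.
  obtain ⟨l, hl, hl0⟩ : ∃ l : ℂ, ‖l‖ = 1 ∧ l * deriv h z₀ + (starRingEnd ℂ) l * deriv g z₀ = 0 := by
    by_cases hz : deriv h z₀ = 0
    · refine ⟨1, by simp, ?_⟩
      have : deriv g z₀ = 0 := by rw [← norm_eq_zero, ← hnorm, hz, norm_zero]
      simp [hz, this]
    · obtain ⟨l, hl⟩ := IsAlgClosed.exists_pow_nat_eq (-(deriv g z₀ / deriv h z₀)) two_pos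
      have hl1 : ‖l‖ = 1 := by
        have := congrArg norm hl.symm
        rw [norm_neg, norm_div, ← hnorm, div_self (norm_ne_zero_iff.2 hz), norm_pow] at this
        exact (pow_eq_one_iff_of_nonneg (norm_nonneg _) two_ne_zero).1 this.symm
      refine ⟨l, hl1, ?_⟩
      have hc : l * (starRingEnd ℂ) l = 1 := by rw [mul_conj, normSq_eq_norm_sq, hl1]; simp
      have h2 : l ^ 2 * deriv h z₀ = - deriv g z₀ := by rw [hl]; field_simp
      linear_combination (starRingEnd ℂ l) * h2 - l * deriv h z₀ * hc
  have hlne : l ≠ 0 := by rw [← norm_ne_zero_iff, hl]; exact one_ne_zero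
  set F : ℂ → ℂ := fun z => l * h z + (starRingEnd ℂ) l * g z
  set f : ℂ → ℂ := fun z => h z + (starRingEnd ℂ) (g z)
  have hFre : ∀ z, (F z).re = (l * f z).re := by
    intro z; simp [F, f]; ring
  have hF : AnalyticAt ℂ F z₀ := (analyticAt_const.mul hh).add (analyticAt_const.mul hg)
  have hd : deriv F z₀ = 0 := by
    have := (hh.differentiableAt.hasDerivAt.const_mul l).add
      (hg.differentiableAt.hasDerivAt.const_mul ((starRingEnd ℂ) l))
    rw [show F = (fun z => l * h z) + (fun z => (starRingEnd ℂ) l * g z) from rfl, this.deriv, hl0]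
  have hcontf : ∀ᶠ z in 𝓝 z₀, ContinuousAt f z := by
    filter_upwards [hh.eventually_analyticAt, hg.eventually_analyticAt] with z h1 h2
    exact h1.continuousAt.add (continuous_conj.continuousAt.comp h2.continuousAt)
  -- three arms on the level set of `re F`
  suffices harms : ∃ γ : Fin 3 → ℝ → ℂ, (∀ i, γ i 0 = z₀) ∧
      (∀ i, ∀ t ∈ Ioc (0 : ℝ) 1, γ i t ≠ z₀) ∧
      (∀ i j, i ≠ j → ∀ s ∈ Ioc (0 : ℝ) 1, ∀ t ∈ Ioc (0 : ℝ) 1, γ i s ≠ γ j t) ∧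
      (∀ i, ContinuousOn (γ i) (Icc 0 1)) ∧
      (∀ i, ∀ t ∈ Icc (0 : ℝ) 1, γ i t ∈ s ∧ ContinuousAt f (γ i t) ∧
        (F (γ i t)).re = (F z₀).re) by
    obtain ⟨γ, h1, h2, h3, h4, h5⟩ := harms
    refine not_injective_on_three_arms (v := fun z => (l * f z).im) h1 h2 h3 ?_ ?_
    · intro i t ht
      refine continuous_im.continuousAt.comp_continuousWithinAt
        (continuousWithinAt_const.mul ?_)
      exact ContinuousAt.comp_continuousWithinAt (h5 i t ht).2.1 (h4 i t ht)
    · intro i j a ha b hb hv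
      refine hinj (h5 i a ha).1 (h5 j b hb).1 (mul_left_cancel₀ hlne (Complex.ext ?_ hv))
      rw [← hFre, ← hFre, (h5 i a ha).2.2, (h5 j b hb).2.2]
  rcases eventually_eq_or_eq_pow_of_deriv_eq_zero hF hd with hconst | ⟨k, ψ, c, hk, hψ0, hc, hψ, hpow⟩
  -- If F is locally constant the level set is a full neighbourhood and any three rays serve; those
  -- with k = 2 are used.
  · obtain ⟨r, hr, hball⟩ := Metric.eventually_nhds_iff_ball.1 (hconst.and (hcontf.and hs))
    have hnorm : ∀ (i : Fin 3) (t : ℝ), 0 ≤ t → ‖((t * (r / 2) : ℝ) : ℂ) *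
        exp (((Real.pi * (2 * (i : ℕ) + 1) / (2 * (2 : ℕ)) : ℝ) : ℂ) * I)‖ = t * (r / 2) := by
      intro i t ht
      rw [norm_mul, norm_exp_ofReal_mul_I, norm_real, Real.norm_of_nonneg (by positivity), mul_one]
    refine ⟨fun i t => z₀ + ((t * (r / 2) : ℝ) : ℂ) *
      exp (((Real.pi * (2 * (i : ℕ) + 1) / (2 * (2 : ℕ)) : ℝ) : ℂ) * I), by simp, ?_, ?_, ?_, ?_⟩
    · intro i t ht heq
      have := hnorm i t ht.1.le
      rw [add_eq_left.1 heq, norm_zero] at this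
      have := mul_pos ht.1 (half_pos hr)
      linarith
    · intro i j hij a ha b hb heq
      exact exp_arm_ne le_rfl hij (mul_pos ha.1 (half_pos hr)) (mul_pos hb.1 (half_pos hr))
        (add_left_cancel heq)
    · intro i; fun_prop
    · intro i t ht
      have hmem : z₀ + ((t * (r / 2) : ℝ) : ℂ) *
          exp (((Real.pi * (2 * (i : ℕ) + 1) / (2 * (2 : ℕ)) : ℝ) : ℂ) * I) ∈ ball z₀ r := by
        rw [mem_ball, dist_eq_norm, add_sub_cancel_left, hnorm i t ht.1]
        nlinarith [ht.2]
      obtain ⟨e1, e2, e3⟩ := hball _ hmem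
      exact ⟨e3, e2, by rw [e1]⟩
  · have hψf : HasStrictFDerivAt ψ
        ((ContinuousLinearEquiv.unitsEquivAut ℂ (Units.mk0 c hc) : ℂ ≃L[ℂ] ℂ) : ℂ →L[ℂ] ℂ) z₀ :=
      hψ.hasStrictFDerivAt_equiv hc
    set e := hψf.toOpenPartialHomeomorph ψ
    have hemem : z₀ ∈ e.source := hψf.mem_toOpenPartialHomeomorph_source
    have he : ∀ z, e z = ψ z := fun z => rfl
    have h0t : (0 : ℂ) ∈ e.target := by rw [← hψ0, ← he]; exact e.map_source hemem
    have hsymm0 : e.symm 0 = z₀ := by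
      have := e.left_inv hemem
      rwa [he, hψ0] at this
    have hev : ∀ᶠ w in 𝓝 (0 : ℂ), w ∈ e.target ∧ (F (e.symm w) - F z₀ = ψ (e.symm w) ^ k ∧
        ContinuousAt f (e.symm w) ∧ e.symm w ∈ s) := by
      refine Filter.Eventually.and (e.open_target.mem_nhds h0t) ?_
      have hct : Tendsto e.symm (𝓝 0) (𝓝 z₀) := by
        have := e.continuousAt_symm h0t
        rwa [ContinuousAt, hsymm0] at this
      exact hct.eventually (hpow.and (hcontf.and hs))
    obtain ⟨r, hr, hball⟩ := Metric.eventually_nhds_iff_ball.1 hev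
    set a : Fin 3 → ℝ → ℂ := fun i t => ((t * (r / 2) : ℝ) : ℂ) *
        exp (((Real.pi * (2 * (i : ℕ) + 1) / (2 * k) : ℝ) : ℂ) * I)
    have hnorm : ∀ (i : Fin 3) (t : ℝ), 0 ≤ t → ‖a i t‖ = t * (r / 2) := by
      intro i t ht
      simp only [a]
      rw [norm_mul, norm_exp_ofReal_mul_I, norm_real, Real.norm_of_nonneg (by positivity), mul_one]
    have hmem : ∀ i, ∀ t ∈ Icc (0 : ℝ) 1, a i t ∈ ball (0 : ℂ) r := by
      intro i t ht
      rw [mem_ball_zero_iff, hnorm i t ht.1]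
      nlinarith [ht.2]
    have hIoc : ∀ {t : ℝ}, t ∈ Ioc (0 : ℝ) 1 → t ∈ Icc (0 : ℝ) 1 := fun ht => ⟨ht.1.le, ht.2⟩
    refine ⟨fun i t => e.symm (a i t), ?_, ?_, ?_, ?_, ?_⟩
    · intro i
      simp [a, hsymm0]
    · intro i t ht heq
      have h1 := e.right_inv (hball _ (hmem i t (hIoc ht))).1
      have heq' : e.symm (a i t) = z₀ := heq
      rw [heq', he, hψ0] at h1
      have h2 := hnorm i t ht.1.le
      rw [← h1, norm_zero] at h2
      have := mul_pos ht.1 (half_pos hr)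
      linarith
    · intro i j hij x hx y hy heq
      have h1 := e.right_inv (hball _ (hmem i x (hIoc hx))).1
      have h2 := e.right_inv (hball _ (hmem j y (hIoc hy))).1
      have heq' : e.symm (a i x) = e.symm (a j y) := heq
      rw [heq', h2] at h1
      exact exp_arm_ne hk hij (mul_pos hx.1 (half_pos hr)) (mul_pos hy.1 (half_pos hr)) h1.symm
    · intro i
      refine e.continuousOn_symm.comp (by fun_prop) (fun t ht => (hball _ (hmem i t ht)).1)
    · intro i t ht
      obtain ⟨e1, e2, e3, e4⟩ := hball _ (hmem i t ht)
      refine ⟨e4, e3, ?_⟩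
      have h1 := e.right_inv e1
      rw [he] at h1
      rw [h1] at e2
      have := congrArg re e2
      rw [exp_arm_pow k (by omega) i] at this
      rw [sub_re] at this
      linarith

end HarmonicMapping


namespace HarmonicMapping
open Complex Set Metric Filter Topology

/-! ### Disk automorphisms -/

/-- The automorphism `z ↦ (z - c) / (1 - conj c * z)` of the unit disk. -/
noncomputable def mob (c z : ℂ) : ℂ := (z - c) / (1 - (starRingEnd ℂ) c * z)

lemma mob_denom_ne_zero {c z : ℂ} (hc : ‖c‖ < 1) (hz : ‖z‖ ≤ 1) :
    1 - (starRingEnd ℂ) c * z ≠ 0 := by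
  intro h
  have h1 : ‖(starRingEnd ℂ) c * z‖ = 1 := by rw [← sub_eq_zero.1 h, norm_one]
  rw [norm_mul, norm_conj] at h1
  nlinarith [norm_nonneg c, norm_nonneg z]

lemma normSq_mob_identity (c z : ℂ) :
    normSq (1 - (starRingEnd ℂ) c * z) - normSq (z - c) = (1 - normSq c) * (1 - normSq z) := by
  simp only [normSq_apply, sub_re, sub_im, mul_re, mul_im, conj_re, conj_im, one_re, one_im]
  ring

lemma norm_mob_lt_one {c z : ℂ} (hc : ‖c‖ < 1) (hz : ‖z‖ < 1) : ‖mob c z‖ < 1 := by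
  have h := normSq_mob_identity c z
  rw [mob, norm_div, div_lt_one (norm_pos_iff.2 (mob_denom_ne_zero hc hz.le))]
  simp only [normSq_eq_norm_sq] at h
  have h2 : 0 < (1 - ‖c‖ ^ 2) * (1 - ‖z‖ ^ 2) := by
    apply mul_pos <;> nlinarith [norm_nonneg c, norm_nonneg z]
  exact lt_of_pow_lt_pow_left₀ 2 (norm_nonneg _) (by linarith)

lemma norm_mob_eq_one {c z : ℂ} (hc : ‖c‖ < 1) (hz : ‖z‖ = 1) : ‖mob c z‖ = 1 := by
  have h := normSq_mob_identity c z
  rw [mob, norm_div, div_eq_one_iff_eq (norm_ne_zero_iff.2 (mob_denom_ne_zero hc hz.le))]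
  simp only [normSq_eq_norm_sq, hz] at h
  exact (pow_left_inj₀ (norm_nonneg _) (norm_nonneg _) two_ne_zero).1 (by linarith)

lemma mob_neg_mob {c z : ℂ} (hc : ‖c‖ < 1) (hz : ‖z‖ < 1) : mob (-c) (mob c z) = z := by
  have h1 := mob_denom_ne_zero hc hz.le
  have h2 := mob_denom_ne_zero (c := -c) (by simpa using hc) (norm_mob_lt_one hc hz).le
  have h3 : 1 - (starRingEnd ℂ) c * c ≠ 0 := mob_denom_ne_zero hc hc.le
  have h4 : 1 - (starRingEnd ℂ) (-c) * mob c z =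
      (1 - (starRingEnd ℂ) c * c) / (1 - (starRingEnd ℂ) c * z) := by
    rw [mob]; simp only [map_neg]; field_simp; ring
  have h5 : mob c z - -c = z * (1 - (starRingEnd ℂ) c * c) / (1 - (starRingEnd ℂ) c * z) := by
    rw [mob, sub_neg_eq_add, div_add' _ _ _ h1]; congr 1; ring
  rw [mob, h4, h5, div_div_div_cancel_right₀ h1, mul_div_assoc, div_self h3, mul_one]

lemma mob_mob_neg {c z : ℂ} (hc : ‖c‖ < 1) (hz : ‖z‖ < 1) : mob c (mob (-c) z) = z := by
  simpa using mob_neg_mob (c := -c) (by simpa using hc) hz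

lemma hasDerivAt_mob {c z : ℂ} (hc : ‖c‖ < 1) (hz : ‖z‖ ≤ 1) :
    HasDerivAt (mob c) ((1 - (starRingEnd ℂ) c * c) / (1 - (starRingEnd ℂ) c * z) ^ 2) z := by
  have h1 := mob_denom_ne_zero hc hz
  have := ((hasDerivAt_id' z).sub_const c).fun_div
    (((hasDerivAt_id' z).const_mul ((starRingEnd ℂ) c)).const_sub 1) h1
  refine this.congr_deriv ?_
  field_simp
  ring

lemma differentiableOn_mob {c : ℂ} (hc : ‖c‖ < 1) : DifferentiableOn ℂ (mob c) (ball 0 1) :=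
  fun _ hz => (hasDerivAt_mob hc (mem_ball_zero_iff.1 hz).le).differentiableAt.differentiableWithinAt

lemma mapsTo_mob {c : ℂ} (hc : ‖c‖ < 1) : MapsTo (mob c) (ball 0 1) (ball 0 1) := fun _ hz =>
  mem_ball_zero_iff.2 (norm_mob_lt_one hc (mem_ball_zero_iff.1 hz))

/-! ### The Riemann mapping theorem for subdomains of the disk -/

/-- Pointwise limits of holomorphic functions bounded by `1` are locally uniform limits. -/
lemma tendstoLocallyUniformlyOn_of_bounded {U : Set ℂ} (hU : IsOpen U) {l : Filter (ℂ → ℂ)}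
    [l.NeBot] {ψ : ℂ → ℂ} (hl : Tendsto id l (𝓝 ψ))
    (hd : ∀ᶠ F in l, DifferentiableOn ℂ F U ∧ ∀ z, ‖F z‖ ≤ 1) :
    TendstoLocallyUniformlyOn (fun F : ℂ → ℂ => F) ψ l U := by
  rw [Metric.tendstoLocallyUniformlyOn_iff]
  intro ε hε x hx
  obtain ⟨r, hr, hball⟩ := Metric.isOpen_iff.1 hU x hx
  have hpt : ∀ z, Tendsto (fun F : ℂ → ℂ => F z) l (𝓝 (ψ z)) := fun z =>
    tendsto_pi_nhds.1 hl z
  -- The Schwarz lemma gives all the F a common Lipschitz constant near x, which upgrades pointwise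
  -- to local uniform convergence.
  have hlip : ∀ᶠ F in l, ∀ y ∈ ball x r, dist (F y) (F x) ≤ 2 / r * dist y x := by
    filter_upwards [hd] with F hF y hy
    refine dist_le_div_mul_dist_of_mapsTo_ball (hF.1.mono hball) (fun w _ => ?_) hy
    rw [mem_closedBall, dist_eq_norm]
    linarith [norm_sub_le (F w) (F x), hF.2 w, hF.2 x]
  have hlim : ∀ y ∈ ball x r, dist (ψ y) (ψ x) ≤ 2 / r * dist y x := by
    intro y hy
    refine le_of_tendsto ((hpt y).dist (hpt x)) ?_
    filter_upwards [hlip] with F hF using hF y hy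
  refine ⟨ball x (min r (ε * r / 8)), mem_nhdsWithin_of_mem_nhds (ball_mem_nhds _ (by positivity)), ?_⟩
  filter_upwards [hlip, Metric.tendsto_nhds.1 (hpt x) (ε / 4) (by positivity)] with F h1 h2 y hy
  rw [mem_ball, lt_min_iff] at hy
  have h3 : 2 / r * dist y x ≤ ε / 4 := by
    rw [div_mul_eq_mul_div, div_le_iff₀ hr]; linarith
  have h4 := h1 y hy.1
  have h5 := hlim y hy.1
  have h6 := dist_triangle4 (ψ y) (ψ x) (F x) (F y)
  rw [dist_comm (ψ x) (F x), dist_comm (F x) (F y)] at h6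
  linarith

/-- **Hurwitz's theorem** for injective functions. -/
lemma injOn_of_tendstoLocallyUniformlyOn {U : Set ℂ} (hU : IsOpen U) (hUc : IsPreconnected U)
    {l : Filter (ℂ → ℂ)} [l.NeBot] {ψ : ℂ → ℂ}
    (hl : TendstoLocallyUniformlyOn (fun F : ℂ → ℂ => F) ψ l U)
    (hF : ∀ᶠ F in l, DifferentiableOn ℂ F U ∧ InjOn F U)
    {a b : ℂ} (ha : a ∈ U) (hb : b ∈ U) (hab : ψ a ≠ ψ b) : InjOn ψ U := by
  have hd : DifferentiableOn ℂ ψ U := hl.differentiableOn (hF.mono fun _ h => h.1) hU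
  intro x hx y hy hxy
  by_contra hne
  have han : AnalyticOnNhd ℂ ψ U := hd.analyticOnNhd hU
  have hiso : ∀ᶠ z in 𝓝[≠] y, ψ z ≠ ψ y := by
    rcases (han y hy).eventually_eq_or_eventually_ne analyticAt_const (g := fun _ => ψ y) with h | h
    · have := han.eqOn_of_preconnected_of_eventuallyEq analyticOnNhd_const hUc hy h
      exact absurd ((this ha).trans (this hb).symm) hab
    · exact h
  rw [eventually_nhdsWithin_iff] at hiso
  obtain ⟨r₀, hr₀, hball⟩ := Metric.eventually_nhds_iff_ball.1 (hiso.and (hU.mem_nhds hy))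
  have hxy' : 0 < dist x y := dist_pos.2 hne
  set r := min (r₀ / 2) (dist x y / 2)
  have hr : 0 < r := by positivity
  have hcb : closedBall y r ⊆ ball y r₀ :=
    closedBall_subset_ball (lt_of_le_of_lt (min_le_left _ _) (by linarith))
  have hcU : closedBall y r ⊆ U := fun z hz => (hball z (hcb hz)).2
  have hxr : x ∉ closedBall y r := by
    rw [mem_closedBall, not_le]
    exact lt_of_le_of_lt (min_le_right _ _) (by linarith)
  obtain ⟨z₁, hz₁, hmin⟩ := (isCompact_sphere y r).exists_isMinOn
    (NormedSpace.sphere_nonempty.2 hr.le) (f := fun z => ‖ψ z - ψ y‖)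
    ((hd.continuousOn.mono (sphere_subset_closedBall.trans hcU)).sub continuousOn_const).norm
  set η := ‖ψ z₁ - ψ y‖
  have hη : 0 < η := by
    rw [norm_pos_iff, sub_ne_zero]
    exact (hball z₁ (hcb (sphere_subset_closedBall hz₁))).1 (ne_of_mem_sphere hz₁ hr.ne')
  have hunif := (tendstoLocallyUniformlyOn_iff_forall_isCompact hU).1 hl (closedBall y r) hcU
    (isCompact_closedBall y r)
  have hunifx := (tendstoLocallyUniformlyOn_iff_forall_isCompact hU).1 hl {x} (by simpa using hx)
    isCompact_singleton
  rw [Metric.tendstoUniformlyOn_iff] at hunif hunifx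
  obtain ⟨F, ⟨h1, h2⟩, hFd, hFi⟩ := (((hunif (η / 16) (by positivity)).and
    (hunifx (η / 16) (by positivity))).and hF).exists
  have hyc : y ∈ closedBall y r := mem_closedBall_self hr.le
  have hsph : ∀ z ∈ sphere y r, η / 2 ≤ ‖F z - F y‖ := by
    intro z hz
    have e1 := h1 z (sphere_subset_closedBall hz)
    have e2 := h1 y hyc
    have e3 : η ≤ ‖ψ z - ψ y‖ := hmin hz
    rw [← dist_eq_norm] at e3 ⊢
    have := dist_triangle4 (ψ z) (F z) (F y) (ψ y)
    rw [dist_comm (F y)] at this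
    linarith
  -- A quantitative open mapping theorem: the image of the closed disk about y covers the disk of
  -- radius η/4 about F y, hence F x, although x lies outside that closed disk.
  have hsub := DiffContOnCl.ball_subset_image_closedBall (f := F) (z₀ := y) (r := r) (ε := η / 2)
    ((hFd.mono hcU).diffContOnCl_ball subset_rfl) hr hsph (by
      have : ∀ᶠ z in 𝓝[≠] y, F z ≠ F y := by
        filter_upwards [mem_nhdsWithin_of_mem_nhds (hU.mem_nhds hy), self_mem_nhdsWithin] with z h3 h4
        exact fun h => h4 (hFi h3 hy h)
      exact this.frequently.filter_mono nhdsWithin_le_nhds)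
  have hFx : F x ∈ ball (F y) (η / 2 / 2) := by
    have e1 := h2 x rfl
    have e2 := h1 y hyc
    have := dist_triangle4 (F x) (ψ x) (ψ y) (F y)
    rw [dist_comm (F x) (ψ x), hxy, dist_self] at this
    rw [hxy] at e1
    rw [mem_ball]
    linarith
  obtain ⟨z, hz, hzx⟩ := hsub hFx
  exact hxr (hFi (hcU hz) hx hzx ▸ hz)

/-- A continuous square root of a holomorphic nonvanishing function is holomorphic. -/
lemma differentiableOn_of_sq_eq {U : Set ℂ} (hU : IsOpen U) {s G : ℂ → ℂ} (hs : ContinuousOn s U)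
    (hG : DifferentiableOn ℂ G U) (h : ∀ z ∈ U, s z ^ 2 = G z) (h0 : ∀ z ∈ U, G z ≠ 0) :
    DifferentiableOn ℂ s U := by
  intro z hz
  have hs0 : s z ≠ 0 := fun h' => h0 z hz (by rw [← h z hz, h']; simp)
  have hpow : HasStrictDerivAt (fun w : ℂ => w ^ 2) (2 * s z) (s z) := by
    simpa using hasStrictDerivAt_pow 2 (s z)
  have hne : 2 * s z ≠ 0 := mul_ne_zero two_ne_zero hs0
  have hinv := hpow.to_localInverse hne
  -- Continuity of s selects one local branch of the square root.
  have hloc : ∀ᶠ x in 𝓝 z, hpow.localInverse _ _ _ hne (G x) = s x := by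
    have hc : ContinuousAt s z := hs.continuousAt (hU.mem_nhds hz)
    have hev := (hpow.hasStrictFDerivAt_equiv hne).eventually_left_inverse
    filter_upwards [hc.eventually hev, hU.mem_nhds hz] with x h1 h2
    rw [← h x h2]
    exact h1
  have hd : DifferentiableAt ℂ (fun x => hpow.localInverse _ _ _ hne (G x)) z := by
    have h2 : DifferentiableAt ℂ (hpow.localInverse _ _ _ hne) (G z) := by
      rw [← h z hz]; exact hinv.hasDerivAt.differentiableAt
    exact h2.comp z (hG.differentiableAt (hU.mem_nhds hz))
  exact (hd.congr_of_eventuallyEq (hloc.mono fun _ hx => hx.symm)).differentiableWithinAt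

/-- The holomorphic self-map of the disk behind Koebe's square root trick strictly decreases
moduli. -/
lemma norm_koebe_lt {w c ζ : ℂ} (hw : ‖w‖ < 1) (hc : ‖c‖ < 1) (hcw : c ^ 2 = -w) (hw0 : w ≠ 0)
    (hζ : ‖ζ‖ < 1) (hζ0 : ζ ≠ 0) : ‖mob (-w) (mob (-c) ζ ^ 2)‖ < ‖ζ‖ := by
  have hw' : ‖-w‖ < 1 := by simpa using hw
  have hc' : ‖-c‖ < 1 := by simpa using hc
  have hc0 : c ≠ 0 := by rintro rfl; exact hw0 (by simpa using hcw.symm)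
  set B : ℂ → ℂ := fun ζ => mob (-w) (mob (-c) ζ ^ 2)
  have hsq : ∀ {u : ℂ}, ‖u‖ < 1 → ‖u ^ 2‖ < 1 := fun hu => by
    rw [norm_pow]; exact pow_lt_one₀ (norm_nonneg _) hu two_ne_zero
  have hBmaps : MapsTo B (ball 0 1) (ball 0 1) := fun z hz => mem_ball_zero_iff.2
    (norm_mob_lt_one hw' (hsq (norm_mob_lt_one hc' (mem_ball_zero_iff.1 hz))))
  have hB0 : B 0 = 0 := by
    have : mob (-c) 0 = c := by simp [mob]
    simp only [B, this, hcw]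
    simp [mob]
  have hBd : DifferentiableOn ℂ B (ball 0 1) := by
    refine (differentiableOn_mob hw').comp ((differentiableOn_mob hc').pow 2) fun z hz => ?_
    exact mem_ball_zero_iff.2 (hsq (norm_mob_lt_one hc' (mem_ball_zero_iff.1 hz)))
  have hle : ‖B ζ‖ ≤ ‖ζ‖ := Complex.norm_le_norm_of_mapsTo_ball hBd
    (fun z hz => ball_subset_closedBall (hBmaps hz)) hB0 hζ
  -- Equality in the Schwarz lemma would make B linear with unimodular slope, but B has a second
  -- zero, at `mob c (-c)`.
  refine lt_of_le_of_ne hle fun heq => ?_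
  have hslope : ‖dslope B 0 ζ‖ = 1 / 1 := by
    rw [dslope_of_ne _ hζ0, slope_def_field, hB0, sub_zero, sub_zero, norm_div]
    change ‖B ζ‖ / ‖ζ‖ = _
    rw [show ‖B ζ‖ = ‖ζ‖ from heq, div_self (norm_ne_zero_iff.2 hζ0), div_one]
  have haff := affine_of_mapsTo_ball_of_norm_dslope_eq_div hBd
    (fun z hz => by rw [hB0]; exact ball_subset_closedBall (hBmaps hz))
    (mem_ball_zero_iff.2 hζ) hslope
  -- `mob c c` and `mob c (-c)` have the same image
  have h1 : mob c (-c) ∈ ball (0 : ℂ) 1 := mem_ball_zero_iff.2 (norm_mob_lt_one hc hc')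
  have e1 : B (mob c (-c)) = 0 := by
    simp only [B]
    rw [mob_neg_mob hc hc', neg_sq, hcw]
    simp [mob]
  have e2 := haff h1
  rw [e1, hB0] at e2
  simp only [sub_zero, zero_add, smul_eq_mul] at e2
  rcases mul_eq_zero.1 e2.symm with h | h
  · have := mob_denom_ne_zero hc hc'.le
    rw [mob, div_eq_zero_iff] at h
    rcases h with h | h
    · apply hc0
      linear_combination -h / 2
    · exact this h
  · rw [h] at hslope; simp at hslope

/-- **Riemann mapping theorem** for simply connected subdomains of the disk. -/
theorem exists_bijOn_ball {U : Set ℂ} (hU : IsOpen U) (hsc : IsSimplyConnected U)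
    (hsub : U ⊆ ball 0 1) (h0 : (0 : ℂ) ∈ U) :
    ∃ ψ : ℂ → ℂ, DifferentiableOn ℂ ψ U ∧ BijOn ψ U (ball 0 1) ∧ ψ 0 = 0 := by
  classical
  have hUc : IsPreconnected U := hsc.isPathConnected.isConnected.isPreconnected
  obtain ⟨r, hr, hball⟩ := Metric.isOpen_iff.1 hU 0 h0
  set a : ℂ := ((r / 2 : ℝ) : ℂ)
  have ha : a ∈ U := hball (by
    rw [mem_ball_zero_iff, norm_real, Real.norm_of_nonneg (by positivity)]; linarith)
  have ha0 : a ≠ 0 := by simp [a, hr.ne']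
  -- The extremal functional is evaluation at a, in place of the derivative at 0, so that
  -- compactness of K is Tychonoff's theorem for a product of closed disks. The lower bound at a
  -- keeps limits nonconstant, as Hurwitz's theorem requires.
  set K : Set (ℂ → ℂ) := {ψ | DifferentiableOn ℂ ψ U ∧ (∀ z, ‖ψ z‖ ≤ 1) ∧ InjOn ψ U ∧ ψ 0 = 0 ∧
    ‖a‖ ≤ ‖ψ a‖}
  have hKclosed : IsClosed K := by
    refine isClosed_of_closure_subset fun ψ hψ => ?_
    rw [mem_closure_iff_clusterPt] at hψ
    set l : Filter (ℂ → ℂ) := 𝓝 ψ ⊓ 𝓟 K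
    have : l.NeBot := hψ
    have hl : Tendsto id l (𝓝 ψ) := inf_le_left
    have hK : ∀ᶠ F in l, F ∈ K := mem_inf_of_right (mem_principal_self K)
    have hpt : ∀ z, Tendsto (fun F : ℂ → ℂ => F z) l (𝓝 (ψ z)) := fun z => tendsto_pi_nhds.1 hl z
    have hloc := tendstoLocallyUniformlyOn_of_bounded hU hl (hK.mono fun F h => ⟨h.1, h.2.1⟩)
    have hψ0 : ψ 0 = 0 := tendsto_nhds_unique (hpt 0)
      (tendsto_const_nhds.congr' (hK.mono fun F h => h.2.2.2.1.symm))
    have hψa : ‖a‖ ≤ ‖ψ a‖ := ge_of_tendsto (hpt a).norm (hK.mono fun F h => h.2.2.2.2)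
    refine ⟨hloc.differentiableOn (hK.mono fun F h => h.1) hU, fun z =>
      le_of_tendsto (hpt z).norm (hK.mono fun F h => h.2.1 z), ?_, hψ0, hψa⟩
    refine injOn_of_tendstoLocallyUniformlyOn hU hUc hloc (hK.mono fun F h => ⟨h.1, h.2.2.1⟩) ha h0 ?_
    rw [hψ0]
    exact norm_pos_iff.1 (lt_of_lt_of_le (norm_pos_iff.2 ha0) hψa)
  have hKcompact : IsCompact K := by
    refine IsCompact.of_isClosed_subset (isCompact_univ_pi fun _ : ℂ => isCompact_closedBall (0 : ℂ) 1)
      hKclosed fun ψ hψ z _ => by simpa using hψ.2.1 z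
  have hKne : K.Nonempty := by
    refine ⟨fun z => if z ∈ U then z else 0, ?_, ?_, ?_, by simp, by simp [ha]⟩
    · exact differentiableOn_id.congr fun z hz => by simp [hz]
    · intro z
      by_cases hz : z ∈ U
      · simpa [hz] using (mem_ball_zero_iff.1 (hsub hz)).le
      · simp [hz]
    · intro x hx y hy h
      simpa [hx, hy] using h
  obtain ⟨ψ, ⟨hd, hb, hinj, hψ0, hψa⟩, hmax⟩ := hKcompact.exists_isMaxOn hKne
    (f := fun ψ : ℂ → ℂ => ‖ψ a‖) (continuous_apply a).norm.continuousOn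
  have hψa0 : ψ a ≠ 0 := norm_pos_iff.1 (lt_of_lt_of_le (norm_pos_iff.2 ha0) hψa)
  have han : AnalyticOnNhd ℂ ψ U := hd.analyticOnNhd hU
  have hmaps : MapsTo ψ U (ball 0 1) := by
    have hopen : IsOpen (ψ '' U) := by
      rcases han.is_constant_or_isOpen hUc with ⟨w, hw⟩ | h
      · exact absurd ((hw a ha).trans ((hw 0 h0).symm.trans hψ0)) hψa0
      · exact h U subset_rfl hU
    have : ψ '' U ⊆ interior (closedBall 0 1) := interior_maximal
      (by rintro _ ⟨z, -, rfl⟩; simpa using hb z) hopen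
    rw [interior_closedBall _ one_ne_zero] at this
    exact fun z hz => this ⟨z, hz, rfl⟩
  refine ⟨ψ, hd, ⟨hmaps, hinj, fun w hw => ?_⟩, hψ0⟩
  -- An omitted value w makes `mob w` ∘ ψ zero-free, so it has a square root on U. Renormalised at
  -- 0, this root is a competitor χ in K with a larger modulus at a.
  by_contra hwn
  have hw1 : ‖w‖ < 1 := mem_ball_zero_iff.1 hw
  have hw0 : w ≠ 0 := fun h => hwn ⟨0, h0, by rw [hψ0, h]⟩
  have hψ1 : ∀ z ∈ U, ‖ψ z‖ < 1 := fun z hz => mem_ball_zero_iff.1 (hmaps hz)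
  set G : ℂ → ℂ := fun z => mob w (ψ z)
  have hG : DifferentiableOn ℂ G U := (differentiableOn_mob hw1).comp hd hmaps
  have hG0 : ∀ z ∈ U, G z ≠ 0 := by
    intro z hz h
    rcases div_eq_zero_iff.1 h with h | h
    · exact hwn ⟨z, hz, sub_eq_zero.1 h⟩
    · exact mob_denom_ne_zero hw1 (hψ1 z hz).le h
  obtain ⟨s, hs, hsq⟩ := exists_continuousOn_pow_eq hsc hU hG.continuousOn
    (by rintro ⟨z, hz, h⟩; exact hG0 z hz h) two_ne_zero
  have hsd := differentiableOn_of_sq_eq hU hs hG (fun z _ => hsq z) hG0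
  have hs1 : ∀ z ∈ U, ‖s z‖ < 1 := by
    intro z hz
    have h1 : ‖s z‖ ^ 2 < 1 := by
      rw [← norm_pow, hsq]; exact norm_mob_lt_one hw1 (hψ1 z hz)
    exact (pow_lt_one_iff_of_nonneg (norm_nonneg _) two_ne_zero).1 h1
  have hc : ‖s 0‖ < 1 := hs1 0 h0
  have hc2 : s 0 ^ 2 = -w := by
    rw [hsq]; simp only [G, hψ0]; simp [mob]
  set χ : ℂ → ℂ := fun z => if z ∈ U then mob (s 0) (s z) else 0
  have hχ : ∀ z ∈ U, χ z = mob (s 0) (s z) := fun z hz => if_pos hz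
  have hχ1 : ∀ z ∈ U, ‖χ z‖ < 1 := fun z hz => by
    rw [hχ z hz]; exact norm_mob_lt_one hc (hs1 z hz)
  have hback : ∀ z ∈ U, mob (-w) (mob (-(s 0)) (χ z) ^ 2) = ψ z := by
    intro z hz
    rw [hχ z hz, mob_neg_mob hc (hs1 z hz), hsq]
    exact mob_neg_mob hw1 (hψ1 z hz)
  have hχ0 : χ 0 = 0 := by rw [hχ 0 h0]; simp [mob]
  have hχinj : InjOn χ U := fun x hx y hy h => hinj hx hy (by rw [← hback x hx, ← hback y hy, h])
  have hχa0 : χ a ≠ 0 := fun h => ha0 (hχinj ha h0 (by rw [h, hχ0]))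
  have hlt : ‖ψ a‖ < ‖χ a‖ := by
    rw [← hback a ha]
    exact norm_koebe_lt hw1 hc hc2 hw0 (hχ1 a ha) hχa0
  have hχK : χ ∈ K := by
    refine ⟨?_, ?_, hχinj, hχ0, hψa.trans hlt.le⟩
    · exact ((differentiableOn_mob hc).comp hsd fun z hz => mem_ball_zero_iff.2 (hs1 z hz)).congr hχ
    · intro z
      by_cases hz : z ∈ U
      · exact (hχ1 z hz).le
      · simp [χ, hz]
  exact absurd (hmax hχK) (not_le.2 hlt)

end HarmonicMapping


namespace HarmonicMapping
open Complex Set Metric Filter Topology MeasureTheory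

/-! ### The length-area principle -/

lemma det_eq_re_im (A : ℂ →L[ℝ] ℂ) :
    A.det = (A 1).re * (A I).im - (A I).re * (A 1).im := by
  have h : A.det = LinearMap.det (A : ℂ →ₗ[ℝ] ℂ) := rfl
  rw [h, ← LinearMap.det_toMatrix basisOneI, Matrix.det_fin_two]
  simp [LinearMap.toMatrix_apply]

lemma det_fderiv_of_hasDerivAt {Φ : ℂ → ℂ} {c z : ℂ} (h : HasDerivAt Φ c z) :
    (fderiv ℝ Φ z).det = ‖c‖ ^ 2 := by
  have h1 : fderiv ℝ Φ z = (ContinuousLinearMap.toSpanSingleton ℂ c).restrictScalars ℝ :=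
    (h.hasFDerivAt.restrictScalars ℝ).fderiv
  rw [det_eq_re_im, h1, ← normSq_eq_norm_sq, normSq_apply]
  simp

/-- The open strip `0 < im ζ < π`. -/
def strip : Set ℂ := {ζ | 0 < ζ.im ∧ ζ.im < Real.pi}

lemma isOpen_strip : IsOpen strip :=
  (isOpen_lt continuous_const continuous_im).inter (isOpen_lt continuous_im continuous_const)

lemma lintegral_strip (F : ℂ → ENNReal) (hF : Measurable F) :
    ∫⁻ ζ in strip, F ζ = ∫⁻ x : ℝ, ∫⁻ t in Ioo 0 Real.pi, F (x + t * I) := by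
  have hmp := Complex.volume_preserving_equiv_real_prod.symm
  have hpre : measurableEquivRealProd.symm ⁻¹' strip = univ ×ˢ Ioo 0 Real.pi := by
    ext p
    simp [strip, measurableEquivRealProd_symm_apply]
  rw [← hmp.setLIntegral_comp_preimage_emb measurableEquivRealProd.symm.measurableEmbedding, hpre,
    Measure.volume_eq_prod, ← Measure.prod_restrict, lintegral_prod _ (by
      exact (hF.comp measurableEquivRealProd.symm.measurable).aemeasurable), Measure.restrict_univ]
  refine lintegral_congr fun x => lintegral_congr fun t => congrArg F ?_
  apply Complex.ext <;> simp

/-- The total energy is the area of the image, which is finite. Slices of energy at least η over the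
whole half-line x < X would make it infinite. -/
lemma exists_lintegral_lt {Φ : ℂ → ℂ} (hd : DifferentiableOn ℂ Φ strip) (hinj : InjOn Φ strip)
    (hmaps : MapsTo Φ strip (ball 0 1)) {η : ENNReal} (hη : η ≠ 0) (X : ℝ) :
    ∃ x < X, ∫⁻ t in Ioo 0 Real.pi, ENNReal.ofReal (‖deriv Φ (x + t * I)‖ ^ 2) < η := by
  by_contra! hcon
  have harea : ∫⁻ ζ in strip, ENNReal.ofReal (‖deriv Φ ζ‖ ^ 2) = volume (Φ '' strip) := by
    have hder : ∀ ζ ∈ strip, HasDerivAt Φ (deriv Φ ζ) ζ := fun ζ hζ =>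
      (hd.differentiableAt (isOpen_strip.mem_nhds hζ)).hasDerivAt
    rw [← lintegral_abs_det_fderiv_eq_addHaar_image volume isOpen_strip.measurableSet
      (f' := fderiv ℝ Φ) (fun ζ hζ =>
        ((hder ζ hζ).differentiableAt.restrictScalars ℝ).hasFDerivAt.hasFDerivWithinAt) hinj]
    refine setLIntegral_congr_fun isOpen_strip.measurableSet fun ζ hζ => ?_
    rw [det_fderiv_of_hasDerivAt (hder ζ hζ), abs_of_nonneg (by positivity)]
  have hfin : ∫⁻ ζ in strip, ENNReal.ofReal (‖deriv Φ ζ‖ ^ 2) < ⊤ := by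
    rw [harea]
    exact lt_of_le_of_lt (measure_mono hmaps.image_subset) measure_ball_lt_top
  rw [lintegral_strip _ (by fun_prop)] at hfin
  have : ∫⁻ x in Iio X, η ≤
      ∫⁻ x : ℝ, ∫⁻ t in Ioo 0 Real.pi, ENNReal.ofReal (‖deriv Φ (x + t * I)‖ ^ 2) :=
    (setLIntegral_mono' measurableSet_Iio fun x hx => hcon x hx).trans (setLIntegral_le_lintegral _ _)
  rw [setLIntegral_const, Real.volume_Iio, ENNReal.mul_top hη] at this
  exact absurd (lt_of_le_of_lt this hfin) (lt_irrefl _)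

/-- The length of the image of a vertical slice is bounded through its energy by |v| ≤ b/2 +
|v|²/(2b), with b left free in place of the Cauchy–Schwarz inequality. -/
lemma norm_sub_le_of_lintegral_le {Φ : ℂ → ℂ} (hd : DifferentiableOn ℂ Φ strip) {x b η : ℝ}
    (hb : 0 < b) (hη : 0 ≤ η)
    (henergy : ∫⁻ t in Ioo 0 Real.pi, ENNReal.ofReal (‖deriv Φ (x + t * I)‖ ^ 2) ≤ ENNReal.ofReal η)
    {t₁ t₂ : ℝ} (h₁ : t₁ ∈ Ioo 0 Real.pi) (h₂ : t₂ ∈ Ioo 0 Real.pi) (hle : t₁ ≤ t₂) :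
    ‖Φ (x + t₂ * I) - Φ (x + t₁ * I)‖ ≤ b / 2 * Real.pi + η / (2 * b) := by
  have hmem : ∀ t ∈ Icc t₁ t₂, ((x : ℂ) + t * I) ∈ strip := by
    intro t ht
    have := h₁.1.trans_le ht.1
    have := ht.2.trans_lt h₂.2
    simp [strip, *]
  have hder : ∀ t ∈ uIcc t₁ t₂, HasDerivAt (fun t : ℝ => Φ (x + t * I))
      (deriv Φ (x + t * I) * I) t := by
    intro t ht
    rw [uIcc_of_le hle] at ht
    have h1 : HasDerivAt (fun t : ℝ => (x : ℂ) + t * I) I t := by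
      simpa using ((hasDerivAt_id t).ofReal_comp.mul_const I).const_add (x : ℂ)
    exact (hd.differentiableAt (isOpen_strip.mem_nhds (hmem t ht))).hasDerivAt.comp t h1
  have hcont : ContinuousOn (fun t : ℝ => deriv Φ (x + t * I)) (Icc t₁ t₂) :=
    ContinuousOn.comp (t := strip) (hd.deriv isOpen_strip).continuousOn (by fun_prop) hmem
  have hc1 : ContinuousOn (fun t : ℝ => deriv Φ (x + t * I) * I) (uIcc t₁ t₂) := by
    rw [uIcc_of_le hle]; exact hcont.mul continuousOn_const
  have hc2 : ContinuousOn (fun t : ℝ => ‖deriv Φ (x + t * I)‖ ^ 2) (uIcc t₁ t₂) := by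
    rw [uIcc_of_le hle]; exact hcont.norm.pow 2
  have hi2 := hc2.intervalIntegrable (μ := volume)
  rw [← intervalIntegral.integral_eq_sub_of_hasDerivAt hder hc1.intervalIntegrable]
  have hsq : ∫ t in t₁..t₂, ‖deriv Φ (x + t * I)‖ ^ 2 ≤ η := by
    rw [intervalIntegral.integral_of_le hle, ← ENNReal.ofReal_le_ofReal_iff hη,
      ofReal_integral_eq_lintegral_ofReal ((intervalIntegrable_iff_integrableOn_Ioc_of_le hle).1 hi2)
        (ae_of_all _ fun _ => by positivity)]
    refine (lintegral_mono_set fun t ht => ?_).trans henergy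
    exact ⟨h₁.1.trans ht.1, ht.2.trans_lt h₂.2⟩
  calc ‖∫ t in t₁..t₂, deriv Φ (x + t * I) * I‖
      ≤ ∫ t in t₁..t₂, ‖deriv Φ (x + t * I) * I‖ := intervalIntegral.norm_integral_le_integral_norm hle
    _ ≤ ∫ t in t₁..t₂, (b / 2 + (2 * b)⁻¹ * ‖deriv Φ (x + t * I)‖ ^ 2) := by
        refine intervalIntegral.integral_mono_on hle hc1.norm.intervalIntegrable
          (intervalIntegrable_const.add (hi2.const_mul _)) fun t _ => ?_
        rw [norm_mul, norm_I, mul_one, ← sub_nonneg]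
        have : b / 2 + (2 * b)⁻¹ * ‖deriv Φ (x + t * I)‖ ^ 2 - ‖deriv Φ (x + t * I)‖ =
            (2 * b)⁻¹ * (b - ‖deriv Φ (x + t * I)‖) ^ 2 := by field_simp; ring
        rw [this]; positivity
    _ = b / 2 * (t₂ - t₁) + (2 * b)⁻¹ * ∫ t in t₁..t₂, ‖deriv Φ (x + t * I)‖ ^ 2 := by
        rw [intervalIntegral.integral_add intervalIntegrable_const (hi2.const_mul _),
          intervalIntegral.integral_const, intervalIntegral.integral_const_mul, smul_eq_mul, mul_comm]
    _ ≤ b / 2 * Real.pi + η / (2 * b) := by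
        rw [div_eq_inv_mul η]
        have := h₁.1
        have := h₂.2
        gcongr
        linarith

/-- This says that the Cayley transform (1 + iw)/(1 - iw) takes the upper half-plane into the unit
disk. -/
lemma norm_one_add_lt {w : ℂ} (hw : 0 < w.im) : ‖1 + I * w‖ < ‖1 - I * w‖ := by
  have h : normSq (1 + I * w) < normSq (1 - I * w) := by
    simp [normSq_apply]; nlinarith
  rw [normSq_eq_norm_sq, normSq_eq_norm_sq] at h
  exact lt_of_pow_lt_pow_left₀ 2 (norm_nonneg _) h

lemma exp_im_pos {ζ : ℂ} (h : ζ ∈ strip) : 0 < (exp ζ).im := by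
  rw [exp_im]
  exact mul_pos (Real.exp_pos _) (Real.sin_pos_of_pos_of_lt_pi h.1 h.2)

/-- **Length-area principle**: an injective holomorphic self-map of the disk has small oscillation
on suitable circular arcs shrinking to a given boundary point. -/
theorem exists_small_oscillation {φ : ℂ → ℂ} (hφ : DifferentiableOn ℂ φ (ball 0 1))
    (hinj : InjOn φ (ball 0 1)) (hmaps : MapsTo φ (ball 0 1) (ball 0 1)) {θ : ℂ} (hθ : ‖θ‖ = 1)
    {ε δ : ℝ} (hε : 0 < ε) (hδ : 0 < δ) :
    ∃ s, 0 < s ∧ s < δ ∧ ∀ z ∈ ball (0 : ℂ) 1, ∀ z' ∈ ball (0 : ℂ) 1, ‖θ - z‖ = s * ‖θ + z‖ →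
      ‖θ - z'‖ = s * ‖θ + z'‖ → ‖φ z - φ z'‖ ≤ ε := by
  have hθ0 : θ ≠ 0 := norm_ne_zero_iff.1 (by rw [hθ]; exact one_ne_zero)
  -- The segment of abscissa x in the strip becomes the arc ‖θ - z‖ = eˣ‖θ + z‖, so moving left in
  -- the strip shrinks the arc to θ.
  set κ : ℂ → ℂ := fun ζ => θ * ((1 + I * exp ζ) / (1 - I * exp ζ))
  have hden : ∀ ζ ∈ strip, 1 - I * exp ζ ≠ 0 := fun ζ hζ => norm_pos_iff.1
    (lt_of_le_of_lt (norm_nonneg _) (norm_one_add_lt (exp_im_pos hζ)))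
  have hκmaps : MapsTo κ strip (ball 0 1) := by
    intro ζ hζ
    rw [mem_ball_zero_iff, norm_mul, hθ, one_mul, norm_div, div_lt_one (norm_pos_iff.2 (hden ζ hζ))]
    exact norm_one_add_lt (exp_im_pos hζ)
  have hκd : DifferentiableOn ℂ κ strip := by
    intro ζ hζ
    have := hden ζ hζ
    have h1 : DifferentiableAt ℂ κ ζ := by
      refine DifferentiableAt.const_mul (DifferentiableAt.fun_div (d := fun ζ => 1 - I * exp ζ) ?_ ?_ this) θ <;>
        fun_prop
    exact h1.differentiableWithinAt
  have hκinj : InjOn κ strip := by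
    intro x hx y hy h
    have h1 := mul_left_cancel₀ hθ0 h
    rw [div_eq_div_iff (hden x hx) (hden y hy)] at h1
    have h2 : exp x = exp y := by
      have : I * exp x = I * exp y := by linear_combination h1 / 2
      exact mul_left_cancel₀ I_ne_zero this
    rw [← log_exp (by linarith [hx.1, Real.pi_pos]) hx.2.le, h2,
      log_exp (by linarith [hy.1, Real.pi_pos]) hy.2.le]
  set Φ : ℂ → ℂ := φ ∘ κ
  have hΦd : DifferentiableOn ℂ Φ strip := hφ.comp hκd hκmaps
  have hΦi : InjOn Φ strip := hinj.comp hκinj hκmaps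
  -- With this b and energy ε b, each of the two terms of the length estimate equals ε/2.
  set b : ℝ := ε / Real.pi
  have hb : 0 < b := div_pos hε Real.pi_pos
  have hη : 0 < ε * b := by positivity
  obtain ⟨x, hx, hlt⟩ := exists_lintegral_lt hΦd hΦi (hmaps.comp hκmaps)
    (η := ENNReal.ofReal (ε * b)) (by simpa using hη) (Real.log δ)
  refine ⟨Real.exp x, Real.exp_pos x, by rwa [← Real.lt_log_iff_exp_lt hδ], ?_⟩
  have hparam : ∀ z ∈ ball (0 : ℂ) 1, ‖θ - z‖ = Real.exp x * ‖θ + z‖ →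
      ∃ t ∈ Ioo 0 Real.pi, κ (x + t * I) = z := by
    intro z hz hzx
    have hz1 : ‖z‖ < 1 := mem_ball_zero_iff.1 hz
    have hsum : θ + z ≠ 0 := by
      intro h
      rw [add_eq_zero_iff_eq_neg.1 h, norm_neg] at hθ
      linarith
    set w : ℂ := I * ((θ - z) / (θ + z))
    have hwim : 0 < w.im := by
      have e1 : w.im = ((θ - z) / (θ + z)).re := by simp [w]
      rw [e1, div_re, ← add_div]
      apply div_pos _ (normSq_pos.2 hsum)
      have h2 : normSq z < normSq θ := by
        rw [normSq_eq_norm_sq, normSq_eq_norm_sq, hθ]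
        nlinarith [norm_nonneg z]
      rw [normSq_apply, normSq_apply] at h2
      simp only [sub_re, add_re, sub_im, add_im]
      nlinarith
    have hw0 : w ≠ 0 := by rintro h; rw [h] at hwim; simp at hwim
    have hwn : ‖w‖ = Real.exp x := by
      simp only [w]
      rw [norm_mul, norm_I, one_mul, norm_div, hzx, mul_div_assoc,
        div_self (norm_ne_zero_iff.2 hsum), mul_one]
    have hlog : (x : ℂ) + (arg w : ℝ) * I = log w := by
      rw [log, hwn, Real.log_exp]
    refine ⟨arg w, ⟨?_, ?_⟩, ?_⟩
    · rcases (arg_nonneg_iff.2 hwim.le).lt_or_eq with h | h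
      · exact h
      · rw [eq_comm, arg_eq_zero_iff] at h
        exact absurd h.2 hwim.ne'
    · exact arg_lt_pi_iff.2 (Or.inr hwim.ne')
    · simp only [κ]
      rw [hlog, exp_log hw0]
      have e1 : 1 + I * w = 2 * z / (θ + z) := by
        simp only [w]; rw [← mul_assoc, I_mul_I]; field_simp; ring
      have e2 : 1 - I * w = 2 * θ / (θ + z) := by
        simp only [w]; rw [← mul_assoc, I_mul_I]; field_simp; ring
      rw [e1, e2]
      field_simp
  intro z hz z' hz' h h'
  obtain ⟨t, ht, rfl⟩ := hparam z hz h
  obtain ⟨t', ht', rfl⟩ := hparam z' hz' h'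
  have hfin : b / 2 * Real.pi + ε * b / (2 * b) = ε := by
    simp only [b]; field_simp; ring
  rcases le_total t' t with hle | hle
  · have := norm_sub_le_of_lintegral_le hΦd hb hη.le hlt.le ht' ht hle
    rwa [hfin] at this
  · have := norm_sub_le_of_lintegral_le hΦd hb hη.le hlt.le ht ht' hle
    rw [hfin, norm_sub_rev] at this
    exact this

end HarmonicMapping


namespace HarmonicMapping
open Complex Set Metric Filter Topology

/-! ### Homeomorphisms of the disk onto bounded convex domains -/

/-- `G` is a homeomorphism, with inverse `Γ`, of the unit disk onto the bounded convex
domain `Ω`. -/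
structure IsConvexParam (Ω : Set ℂ) (G Γ : ℂ → ℂ) : Prop where
  isOpen : IsOpen Ω
  convex : Convex ℝ Ω
  bounded : Bornology.IsBounded Ω
  mapsTo : MapsTo G disk Ω
  mapsTo_inv : MapsTo Γ Ω disk
  left_inv : ∀ z ∈ disk, Γ (G z) = z
  right_inv : ∀ w ∈ Ω, G (Γ w) = w
  continuousOn : ContinuousOn G disk
  continuousOn_inv : ContinuousOn Γ Ω

/-- `G` oscillates little on suitable circular arcs shrinking to any given boundary point. -/
def HasSmallArcs (G : ℂ → ℂ) : Prop :=
  ∀ θ : ℂ, ‖θ‖ = 1 → ∀ ε > 0, ∀ δ > 0, ∃ s, 0 < s ∧ s < δ ∧ ∀ z ∈ disk, ∀ z' ∈ disk,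
    ‖θ - z‖ = s * ‖θ + z‖ → ‖θ - z'‖ = s * ‖θ + z'‖ → ‖G z - G z'‖ ≤ ε

lemma zero_mem_disk : (0 : ℂ) ∈ disk := mem_ball_self one_pos

/-- The arcs `‖θ - z‖ = s * ‖θ + z‖` reach the boundary of the disk. -/
lemma exists_mem_arc_norm_gt {θ : ℂ} (hθ : ‖θ‖ = 1) {s r : ℝ} (hs : 0 < s) (hr : r < 1) :
    ∃ z ∈ disk, ‖θ - z‖ = s * ‖θ + z‖ ∧ r < ‖z‖ := by
  have hθ0 : θ ≠ 0 := norm_ne_zero_iff.1 (by rw [hθ]; exact one_ne_zero)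
  set w : ℝ → ℂ := fun t => s * exp (t * I)
  set κ : ℝ → ℂ := fun t => θ * ((1 + I * w t) / (1 - I * w t))
  have hden0 : 1 - I * w 0 ≠ 0 := by
    intro h
    have := congrArg re h
    simp [w] at this
  have hcont : ContinuousAt κ 0 := by
    refine continuousAt_const.mul (ContinuousAt.div ?_ ?_ hden0) <;>
    · simp only [w]; fun_prop
  have hκ0 : ‖κ 0‖ = 1 := by
    have h1 : ‖1 + I * w 0‖ = ‖1 - I * w 0‖ := by
      have : (starRingEnd ℂ) (1 - I * w 0) = 1 + I * w 0 := by simp [w]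
      rw [← this, norm_conj]
    simp only [κ]
    rw [norm_mul, norm_div, hθ, h1, div_self (norm_ne_zero_iff.2 hden0), one_mul]
  have hev : ∀ᶠ t in 𝓝[>] (0 : ℝ), r < ‖κ t‖ ∧ t ∈ Ioo 0 Real.pi := by
    refine Eventually.and ?_ (Ioo_mem_nhdsGT Real.pi_pos)
    have := hcont.norm.eventually (lt_mem_nhds (show r < ‖κ 0‖ by rw [hκ0]; exact hr))
    exact this.filter_mono nhdsWithin_le_nhds
  obtain ⟨t, htr, ht⟩ := hev.exists
  have him : 0 < (w t).im := by
    simp only [w]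
    rw [im_ofReal_mul, exp_ofReal_mul_I_im]
    exact mul_pos hs (Real.sin_pos_of_pos_of_lt_pi ht.1 ht.2)
  have hden : 1 - I * w t ≠ 0 := norm_pos_iff.1
    (lt_of_le_of_lt (norm_nonneg _) (norm_one_add_lt him))
  have hwn : ‖w t‖ = s := by
    simp only [w]
    rw [norm_mul, norm_exp_ofReal_mul_I, norm_real, Real.norm_of_nonneg hs.le, mul_one]
  refine ⟨κ t, ?_, ?_, htr⟩
  · rw [mem_ball_zero_iff]
    simp only [κ]
    rw [norm_mul, hθ, one_mul, norm_div, div_lt_one (norm_pos_iff.2 hden)]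
    exact norm_one_add_lt him
  · have e1 : θ - κ t = -(2 * I * θ * w t) / (1 - I * w t) := by
      simp only [κ]; field_simp; ring
    have e2 : θ + κ t = 2 * θ / (1 - I * w t) := by
      simp only [κ]; field_simp; ring
    rw [e1, e2, norm_div, norm_div, norm_neg, norm_mul _ (w t), hwn]
    simp only [norm_mul, hθ, norm_I]
    ring

namespace IsConvexParam

variable {Ω : Set ℂ} {G Γ : ℂ → ℂ}

lemma surj (h : IsConvexParam Ω G Γ) {w : ℂ} (hw : w ∈ Ω) : ∃ z ∈ disk, G z = w :=
  ⟨Γ w, h.mapsTo_inv hw, h.right_inv w hw⟩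

/-- Every arc contains points whose images are close to the complement of the domain. -/
lemma exists_arc_near_compl (h : IsConvexParam Ω G Γ) {θ : ℂ} (hθ : ‖θ‖ = 1) {s ε : ℝ}
    (hs : 0 < s) (hε : 0 < ε) :
    ∃ z ∈ disk, ‖θ - z‖ = s * ‖θ + z‖ ∧ ∃ q, q ∉ Ω ∧ dist q (G z) < ε := by
  by_contra! hcon
  -- Points at distance at least ε from the complement form a compact subset of Ω. Its preimage is
  -- compact in the disk and cannot contain an arc that reaches the boundary.
  set K : Set ℂ := closure Ω ∩ {w | ∀ q, q ∉ Ω → ε ≤ dist q w}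
  have hKclosed : IsClosed K := by
    refine isClosed_closure.inter ?_
    simp only [ofPred_forall]
    exact isClosed_iInter fun q => isClosed_iInter fun _ =>
      isClosed_le continuous_const (continuous_const.dist continuous_id)
  have hKc : IsCompact K := Metric.isCompact_of_isClosed_isBounded hKclosed
    (h.bounded.closure.subset inter_subset_left)
  have hKΩ : K ⊆ Ω := by
    intro w hw
    by_contra hwn
    have := hw.2 w hwn
    rw [dist_self] at this
    linarith
  have hΓK : IsCompact (Γ '' K) := hKc.image_of_continuousOn (h.continuousOn_inv.mono hKΩ)
  have hmemK : ∀ z ∈ disk, ‖θ - z‖ = s * ‖θ + z‖ → z ∈ Γ '' K := by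
    intro z hz hzs
    refine ⟨G z, ⟨subset_closure (h.mapsTo hz), fun q hq => hcon z hz hzs q hq⟩, h.left_inv z hz⟩
  obtain ⟨z₁, hz₁, hz₁s, -⟩ := exists_mem_arc_norm_gt hθ hs (r := 0) one_pos
  obtain ⟨zm, hzm, hmax⟩ := hΓK.exists_isMaxOn ⟨z₁, hmemK z₁ hz₁ hz₁s⟩ continuous_norm.continuousOn
  have hzm1 : ‖zm‖ < 1 := by
    obtain ⟨w, hw, rfl⟩ := hzm
    exact mem_ball_zero_iff.1 (h.mapsTo_inv (hKΩ hw))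
  obtain ⟨z, hz, hzs, hzr⟩ := exists_mem_arc_norm_gt hθ hs hzm1
  exact absurd (hmax (hmemK z hz hzs)) (not_le.2 hzr)

/-- The oscillation of `G` near a boundary point is small. -/
lemma exists_osc_le (h : IsConvexParam Ω G Γ) (hG : HasSmallArcs G) {θ : ℂ} (hθ : ‖θ‖ = 1)
    {ε₀ : ℝ} (hε₀ : 0 < ε₀) :
    ∃ s > 0, ∃ p, ∀ z ∈ disk, ‖θ - z‖ < s * ‖θ + z‖ → dist (G z) p ≤ ε₀ := by
  have hw₀ : G 0 ∈ Ω := h.mapsTo zero_mem_disk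
  obtain ⟨ρ, hρ, hball⟩ := Metric.isOpen_iff.1 h.isOpen (G 0) hw₀
  obtain ⟨R, hR, hRb⟩ : ∃ R > 0, ∀ w ∈ Ω, dist w (G 0) ≤ R := by
    obtain ⟨R, hR⟩ := h.bounded.subset_closedBall (G 0)
    exact ⟨max R 1, by positivity, fun w hw => (mem_closedBall.1 (hR hw)).trans (le_max_left _ _)⟩
  -- Chosen so that (C - 1)ρ = 2R + ρ exceeds 2R, which produces the contradiction at the end.
  set C : ℝ := 2 * R / ρ + 2
  have hC : 0 < C := by positivity
  set ε : ℝ := ε₀ / C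
  have hε : 0 < ε := by positivity
  obtain ⟨s, hs, hs1, hosc⟩ := hG θ hθ ε hε 1 one_pos
  obtain ⟨z', hz', hz's, q, hq, hqd⟩ := h.exists_arc_near_compl hθ hs hε
  refine ⟨s, hs, G z', fun z hz hzs => ?_⟩
  by_contra! hfar
  have hCε : C * ε = ε₀ := by simp only [ε]; field_simp
  -- The preimage of the segment from G z to G 0 starts inside the region cut off by the arc and
  -- ends outside it, since s < 1. It crosses the arc, and there c t is within ε of G z'.
  set c : ℝ → ℂ := fun t => (1 - t : ℝ) • G z + t • G 0
  have hcΩ : ∀ t ∈ Icc (0 : ℝ) 1, c t ∈ Ω := fun t ht =>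
    h.convex (h.mapsTo hz) hw₀ (by linarith [ht.2]) ht.1 (by ring)
  have hccont : Continuous c := by fun_prop
  have hΓc : ContinuousOn (fun t => Γ (c t)) (Icc 0 1) :=
    h.continuousOn_inv.comp hccont.continuousOn hcΩ
  have hN : ContinuousOn (fun t => ‖θ - Γ (c t)‖ - s * ‖θ + Γ (c t)‖) (Icc 0 1) :=
    (continuousOn_const.sub hΓc).norm.sub (continuousOn_const.mul (continuousOn_const.add hΓc).norm)
  have hivt := intermediate_value_Icc (zero_le_one' ℝ) hN
  have hN0 : ‖θ - Γ (c 0)‖ - s * ‖θ + Γ (c 0)‖ ≤ 0 := by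
    have : c 0 = G z := by simp [c]
    rw [this, h.left_inv z hz]; linarith
  have hN1 : 0 ≤ ‖θ - Γ (c 1)‖ - s * ‖θ + Γ (c 1)‖ := by
    have : c 1 = G 0 := by simp [c]
    rw [this, h.left_inv 0 zero_mem_disk, sub_zero, add_zero, hθ]; linarith
  obtain ⟨t, ht, hNt⟩ := hivt ⟨hN0, hN1⟩
  have hnear : ‖c t - G z'‖ ≤ ε := by
    have := hosc (Γ (c t)) (h.mapsTo_inv (hcΩ t ht)) z' hz' (by simpa [sub_eq_zero] using hNt) hz's
    rwa [h.right_inv _ (hcΩ t ht)] at this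
  -- the point `c t` is far from the complement of `Ω`
  have hd1 : dist (c t) (G z) ≤ t * R := by
    have : c t - G z = t • (G 0 - G z) := by simp only [c]; module
    rw [dist_eq_norm, this, norm_smul, Real.norm_of_nonneg ht.1, ← dist_eq_norm, dist_comm]
    exact mul_le_mul_of_nonneg_left (hRb _ (h.mapsTo hz)) ht.1
  have ht1 : (C - 1) * ε < t * R := by
    have := dist_triangle (G z) (c t) (G z')
    rw [dist_comm (G z) (c t), dist_eq_norm (c t) (G z')] at this
    nlinarith
  have htpos : 0 < t := by
    rcases ht.1.lt_or_eq with h' | h'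
    · exact h'
    · rw [← h'] at ht1
      have : 1 < C := by simp only [C]; have : 0 < 2 * R / ρ := by positivity
                         linarith
      nlinarith
  -- By convexity Ω contains the cone with apex G z over the ball of radius ρ about G 0; homothety
  -- of ratio t gives a ball about c t.
  have hin : ∀ v, dist v (c t) < t * ρ → v ∈ Ω := by
    intro v hv
    have hv' : G 0 + t⁻¹ • (v - c t) ∈ Ω := by
      apply hball
      rw [mem_ball, dist_eq_norm, add_sub_cancel_left, norm_smul, norm_inv,
        Real.norm_of_nonneg ht.1, ← dist_eq_norm]
      rw [inv_mul_lt_iff₀ htpos]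
      exact hv
    have := h.convex (h.mapsTo hz) hv' (a := 1 - t) (b := t) (by linarith [ht.2]) ht.1 (by ring)
    convert this using 1
    rw [smul_add, smul_smul, mul_inv_cancel₀ htpos.ne', one_smul]
    simp only [c]
    abel
  have hqc : dist q (c t) < 2 * ε := by
    have := dist_triangle q (G z') (c t)
    rw [dist_comm (G z') (c t), dist_eq_norm (c t)] at this
    linarith
  have htρ : t * ρ ≤ 2 * ε := by
    by_contra! hlt
    exact hq (hin q (hqc.trans hlt))
  have hCR : (C - 1) * ρ = 2 * R + ρ := by simp only [C]; field_simp; ring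
  have : (2 * R + ρ) * ε < 2 * ε * R := by
    calc (2 * R + ρ) * ε = (C - 1) * ε * ρ := by rw [← hCR]; ring
      _ < t * R * ρ := by gcongr
      _ = t * ρ * R := by ring
      _ ≤ 2 * ε * R := by gcongr
  nlinarith

/-- Small oscillation at every scale makes the image filter at θ Cauchy. -/
lemma exists_boundary_limit (h : IsConvexParam Ω G Γ) (hG : HasSmallArcs G) {θ : ℂ}
    (hθ : ‖θ‖ = 1) : ∃ y, Tendsto G (𝓝[disk] θ) (𝓝 y) := by
  have hcl : θ ∈ closure disk := by
    rw [closure_ball _ one_ne_zero]; simp [hθ]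
  have hne : (𝓝[disk] θ).NeBot := mem_closure_iff_nhdsWithin_neBot.1 hcl
  have hcauchy : Cauchy (map G (𝓝[disk] θ)) := by
    rw [Metric.cauchy_iff]
    refine ⟨inferInstance, fun ε hε => ?_⟩
    obtain ⟨s, hs, p, hp⟩ := h.exists_osc_le hG hθ (ε₀ := ε / 3) (by positivity)
    refine ⟨G '' {z ∈ disk | ‖θ - z‖ < s * ‖θ + z‖}, image_mem_map ?_, ?_⟩
    · have hnh : {z : ℂ | ‖θ - z‖ < s * ‖θ + z‖} ∈ 𝓝 θ := by
        refine (isOpen_lt (by fun_prop) (by fun_prop)).mem_nhds ?_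
        have : θ ≠ 0 := norm_ne_zero_iff.1 (by rw [hθ]; exact one_ne_zero)
        have h2 : 0 < ‖θ + θ‖ := by
          rw [← two_mul]; exact norm_pos_iff.2 (mul_ne_zero two_ne_zero this)
        simp only [mem_ofPred_eq, sub_self, norm_zero]
        positivity
      exact inter_mem self_mem_nhdsWithin (mem_nhdsWithin_of_mem_nhds hnh)
    · rintro _ ⟨z, hz, rfl⟩ _ ⟨z', hz', rfl⟩
      have h1 := hp z hz.1 hz.2
      have h2 := hp z' hz'.1 hz'.2
      have := dist_triangle_right (G z) (G z') p
      linarith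
  exact CompleteSpace.complete hcauchy

/-- `G` extends continuously to the closed disk, mapping the circle into the frontier of `Ω`. -/
theorem exists_extension (h : IsConvexParam Ω G Γ) (hG : HasSmallArcs G) :
    ∃ E : ℂ → ℂ, ContinuousOn E (closedBall 0 1) ∧ EqOn E G disk ∧
      (∀ z ∈ closedBall (0 : ℂ) 1, E z ∈ closure Ω) ∧ ∀ θ : ℂ, ‖θ‖ = 1 → E θ ∉ Ω := by
  have hcl : closure disk = closedBall (0 : ℂ) 1 := closure_ball _ one_ne_zero
  have hlim : ∀ z ∈ closedBall (0 : ℂ) 1, ∃ y, Tendsto G (𝓝[disk] z) (𝓝 y) := by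
    intro z hz
    rcases (mem_closedBall_zero_iff.1 hz).lt_or_eq with h1 | h1
    · exact ⟨G z, h.continuousOn z (mem_ball_zero_iff.2 h1)⟩
    · exact h.exists_boundary_limit hG h1
  have hE : ∀ z ∈ closedBall (0 : ℂ) 1, Tendsto G (𝓝[disk] z) (𝓝 (extendFrom disk G z)) :=
    fun z hz => tendsto_extendFrom (hlim z hz)
  have hne : ∀ z ∈ closedBall (0 : ℂ) 1, (𝓝[disk] z).NeBot := fun z hz =>
    mem_closure_iff_nhdsWithin_neBot.1 (hcl ▸ hz)
  refine ⟨extendFrom disk G, continuousOn_extendFrom hcl.ge hlim, ?_, ?_, ?_⟩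
  · intro z hz
    exact extendFrom_eq (subset_closure hz) (h.continuousOn z hz)
  · intro z hz
    have := hne z hz
    refine mem_closure_of_tendsto (hE z hz) ?_
    filter_upwards [self_mem_nhdsWithin] with w hw using h.mapsTo hw
  -- A boundary value inside Ω would be sent by Γ to θ itself, which is not in the open disk.
  · intro θ hθ hmem
    have hθc : θ ∈ closedBall (0 : ℂ) 1 := by simp [hθ]
    have := hne θ hθc
    have h1 : Tendsto (fun z => Γ (G z)) (𝓝[disk] θ) (𝓝 (Γ (extendFrom disk G θ))) :=
      (h.continuousOn_inv.continuousAt (h.isOpen.mem_nhds hmem)).tendsto.comp (hE θ hθc)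
    have h2 : Tendsto (fun z => Γ (G z)) (𝓝[disk] θ) (𝓝 θ) := by
      refine Tendsto.congr' ?_ (tendsto_id.mono_left nhdsWithin_le_nhds)
      filter_upwards [self_mem_nhdsWithin] with z hz using (h.left_inv z hz).symm
    have h3 := tendsto_nhds_unique h1 h2
    have h4 := h.mapsTo_inv hmem
    rw [h3, mem_ball_zero_iff, hθ] at h4
    exact lt_irrefl _ h4

/-- The superlevel sets of a linear functional are joined inside the closed disk. -/
lemma joinedIn_superlevel (h : IsConvexParam Ω G Γ) {E : ℂ → ℂ}
    (hE : ContinuousOn E (closedBall 0 1)) (hEG : EqOn E G disk) (L : ℂ →L[ℝ] ℝ) {c : ℝ} {θ θ' : ℂ}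
    (hθ : ‖θ‖ = 1) (hθ' : ‖θ'‖ = 1) (hc : c < L (E θ)) (hc' : c < L (E θ')) :
    JoinedIn {z ∈ closedBall (0 : ℂ) 1 | c < L (E z)} θ θ' := by
  set S := {z ∈ closedBall (0 : ℂ) 1 | c < L (E z)}
  -- By continuity a short radial segment leads into the open disk above level c. Interior points
  -- are then joined by the preimage of a segment, Ω cut by a half-plane being convex.
  have hrad : ∀ ξ : ℂ, ‖ξ‖ = 1 → c < L (E ξ) → ∃ z ∈ disk, c < L (E z) ∧ JoinedIn S ξ z := by
    intro ξ hξ hcξ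
    have hcont : ContinuousOn (fun t : ℝ => L (E (t • ξ))) (Icc 0 1) := by
      refine L.continuous.comp_continuousOn (hE.comp (by fun_prop) fun t ht => ?_)
      rw [mem_closedBall_zero_iff, norm_smul, hξ, Real.norm_of_nonneg ht.1, mul_one]
      exact ht.2
    have hev : ∀ᶠ t in 𝓝[Icc 0 1] (1 : ℝ), c < L (E (t • ξ)) := by
      have := hcont 1 (by simp)
      refine this.eventually (lt_mem_nhds ?_)
      simpa using hcξ
    obtain ⟨δ, hδ, hball⟩ := Metric.mem_nhdsWithin_iff.1 hev
    set r : ℝ := max (1 - δ / 2) (1 / 2)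
    have hr1 : r < 1 := max_lt (by linarith) (by norm_num)
    have hr0 : 0 < r := lt_of_lt_of_le (by norm_num) (le_max_right _ _)
    have hrange : ∀ t ∈ Icc r 1, c < L (E (t • ξ)) := by
      intro t ht
      refine hball ⟨?_, hr0.le.trans ht.1, ht.2⟩
      have : 1 - δ / 2 ≤ t := (le_max_left _ _).trans ht.1
      rw [mem_ball, Real.dist_eq, abs_sub_comm, abs_of_nonneg (by linarith [ht.2])]
      linarith
    refine ⟨r • ξ, ?_, hrange r ⟨le_rfl, hr1.le⟩, ?_⟩
    · rw [mem_ball_zero_iff, norm_smul, hξ, Real.norm_of_nonneg hr0.le, mul_one]; exact hr1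
    · refine JoinedIn.ofLine (f := fun t : ℝ => ((1 - t) + t * r) • ξ) (by fun_prop) (by simp) (by simp) ?_
      rintro _ ⟨t, ht, rfl⟩
      have hmem : (1 - t) + t * r ∈ Icc r 1 := by constructor <;> nlinarith [ht.1, ht.2]
      refine ⟨?_, hrange _ hmem⟩
      rw [mem_closedBall_zero_iff, norm_smul, hξ, Real.norm_of_nonneg (hr0.le.trans hmem.1), mul_one]
      exact hmem.2
  obtain ⟨z, hz, hcz, hj⟩ := hrad θ hθ hc
  obtain ⟨z', hz', hcz', hj'⟩ := hrad θ' hθ' hc'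
  refine hj.trans (JoinedIn.trans ?_ hj'.symm)
  have hcv : Convex ℝ (Ω ∩ {w | c < L w}) := h.convex.inter (convex_halfSpace_gt L.isLinear c)
  have hseg := hcv.segment_subset (x := G z) (y := G z') ⟨h.mapsTo hz, by rw [← hEG hz]; exact hcz⟩
    ⟨h.mapsTo hz', by rw [← hEG hz']; exact hcz'⟩
  have hmem : ∀ t ∈ Icc (0 : ℝ) 1, (1 - t) • G z + t • G z' ∈ Ω ∩ {w | c < L w} := fun t ht =>
    hseg ⟨1 - t, t, by linarith [ht.2], ht.1, by ring, rfl⟩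
  refine JoinedIn.ofLine (f := fun t : ℝ => Γ ((1 - t) • G z + t • G z')) ?_ ?_ ?_ ?_
  · exact h.continuousOn_inv.comp (by fun_prop) fun t ht => (hmem t ht).1
  · simp [h.left_inv z hz]
  · simp [h.left_inv z' hz']
  · rintro _ ⟨t, ht, rfl⟩
    have h1 := h.mapsTo_inv (hmem t ht).1
    refine ⟨ball_subset_closedBall h1, ?_⟩
    rw [hEG h1, h.right_inv _ (hmem t ht).1]
    exact (hmem t ht).2

/-- The boundary values of a linear functional do not interlace about any level. -/
theorem not_interlaced (h : IsConvexParam Ω G Γ) {E : ℂ → ℂ}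
    (hE : ContinuousOn E (closedBall 0 1)) (hEG : EqOn E G disk) (L : ℂ →L[ℝ] ℝ) {c : ℝ}
    {α β γ δ : ℝ} (hαβ : α < β) (hβγ : β < γ) (hγδ : γ < δ) (hδα : δ < α + 2 * Real.pi)
    (h1 : c < L (E (exp (α * I)))) (h2 : L (E (exp (β * I))) < c)
    (h3 : c < L (E (exp (γ * I)))) (h4 : L (E (exp (δ * I))) < c) : False := by
  have hu : ∀ x : ℝ, ‖exp (x * I)‖ = 1 := fun x => norm_exp_ofReal_mul_I x
  have j1 := h.joinedIn_superlevel hE hEG L (hu α) (hu γ) h1 h3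
  have j2 := h.joinedIn_superlevel hE hEG (-L) (c := -c) (hu β) (hu δ) (by simpa using h2)
    (by simpa using h4)
  refine not_joinedIn_of_interlaced (fun z hz => hz.1) (fun z hz => hz.1) ?_ hαβ hβγ hγδ hδα j1 j2
  rw [disjoint_left]
  rintro z ⟨-, hz⟩ ⟨-, hz'⟩
  simp only [neg_apply] at hz'
  linarith

end IsConvexParam

end HarmonicMapping


namespace HarmonicMapping
open Complex Set Metric Filter Topology

/-! ### Boundary uniqueness and antipodal extremal points -/

/-- Rotations by multiples of 2π/n advance by less than the length of the arc, so one of them must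
land in it. -/
lemma exists_rotation_mem_Ioo {α β : ℝ} {n : ℕ} (hn : n ≠ 0)
    (hlt : 2 * Real.pi / n < β - α) (t : ℝ) :
    ∃ k ∈ Finset.range n, ∃ x ∈ Ioo α β,
      exp (t * I) * exp ((2 * Real.pi * k / n : ℝ) * I) = exp (x * I) := by
  have hn' : (0 : ℝ) < n := by exact_mod_cast Nat.pos_of_ne_zero hn
  have hπ := Real.pi_pos
  -- Exactly y steps, possibly fractional or negative, lead from t to α; K is the next integer,
  -- later reduced modulo n.
  set y : ℝ := (α - t) * n / (2 * Real.pi)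
  set K : ℤ := ⌊y⌋ + 1
  have hK1 : y < K := by simp only [K]; push_cast; exact Int.lt_floor_add_one y
  have hK2 : (K : ℝ) ≤ y + 1 := by simp only [K]; push_cast; linarith [Int.floor_le y]
  have hy : t + 2 * Real.pi / n * y = α := by simp only [y]; field_simp; ring
  have hc : 0 < 2 * Real.pi / n := by positivity
  have hnZ : (0 : ℤ) < n := by exact_mod_cast Nat.pos_of_ne_zero hn
  refine ⟨(K % n).toNat, ?_, t + 2 * Real.pi / n * K, ⟨?_, ?_⟩, ?_⟩
  · rw [Finset.mem_range, ← Int.ofNat_lt, Int.toNat_of_nonneg (Int.emod_nonneg _ hnZ.ne')]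
    exact Int.emod_lt_of_pos _ hnZ
  · rw [← hy]; gcongr
  · nlinarith
  · have hcast : (((K % n).toNat : ℕ) : ℝ) = K - n * ((K / n : ℤ) : ℝ) := by
      have h1 : (((K % n).toNat : ℕ) : ℤ) = K - n * (K / n) := by
        rw [Int.toNat_of_nonneg (Int.emod_nonneg _ hnZ.ne'), Int.emod_def]
      exact_mod_cast h1
    rw [← exp_add, exp_eq_exp_iff_exists_int]
    refine ⟨-(K / n), ?_⟩
    rw [hcast]
    have hnC : (n : ℂ) ≠ 0 := by exact_mod_cast hn
    push_cast
    field_simp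
    ring

/-- A holomorphic function on the disk that vanishes on a boundary arc vanishes identically. -/
theorem eqOn_zero_of_zero_on_arc {Φ : ℂ → ℂ} (hΦ : DiffContOnCl ℂ Φ (ball 0 1)) {α β : ℝ}
    (hαβ : α < β) (hz : ∀ t ∈ Ioo α β, Φ (exp (t * I)) = 0) : ∀ z ∈ ball (0 : ℂ) 1, Φ z = 0 := by
  obtain ⟨n, hn⟩ := exists_nat_gt (2 * Real.pi / (β - α))
  have hβα : 0 < β - α := sub_pos.2 hαβ
  have hnpos : (0 : ℝ) < n := lt_trans (by have := Real.pi_pos; positivity) hn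
  have hn0 : n ≠ 0 := by rintro rfl; simp at hnpos
  have hlt : 2 * Real.pi / n < β - α := by
    rw [div_lt_iff₀ hβα] at hn
    rw [div_lt_iff₀ hnpos]; linarith
  set ω : ℕ → ℂ := fun k => exp ((2 * Real.pi * k / n : ℝ) * I)
  have hω : ∀ k, ‖ω k‖ = 1 := fun k => norm_exp_ofReal_mul_I _
  have hrot : ∀ k, DiffContOnCl ℂ (fun z => Φ (z * ω k)) (ball 0 1) := by
    intro k
    refine hΦ.comp (g := fun z => z * ω k) (Differentiable.diffContOnCl (by fun_prop)) fun z hz => ?_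
    rw [mem_ball_zero_iff] at hz ⊢
    rwa [norm_mul, hω, mul_one]
  -- At each point of the circle some factor is evaluated on the given arc, so P vanishes on the
  -- whole circle and, by the maximum principle, in the disk.
  set P : ℂ → ℂ := fun z => ∏ k ∈ Finset.range n, Φ (z * ω k)
  have hP : DiffContOnCl ℂ P (ball 0 1) := by
    refine ⟨?_, ?_⟩
    · exact DifferentiableOn.fun_finsetProd fun k _ => (hrot k).differentiableOn
    · exact continuousOn_finsetProd _ fun k _ => (hrot k).continuousOn
  have hPs : ∀ z ∈ frontier (ball (0 : ℂ) 1), ‖P z‖ ≤ 0 := by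
    intro z hz'
    rw [frontier_ball _ one_ne_zero, mem_sphere_zero_iff_norm] at hz'
    have hz1 : z = exp (arg z * I) := by
      have := norm_mul_exp_arg_mul_I z
      rw [hz'] at this; simpa using this.symm
    obtain ⟨k, hk, x, hx, hkx⟩ := exists_rotation_mem_Ioo hn0 hlt (arg z)
    rw [norm_le_zero_iff]
    refine Finset.prod_eq_zero hk ?_
    rw [hz1, hkx, hz x hx]
  have hP0 : ∀ z ∈ ball (0 : ℂ) 1, P z = 0 := fun z hz' => norm_le_zero_iff.1
    (norm_le_of_forall_mem_frontier_norm_le isBounded_ball hP hPs (subset_closure hz'))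
  have han : AnalyticOnNhd ℂ Φ (ball 0 1) := hΦ.differentiableOn.analyticOnNhd isOpen_ball
  have h0 : (0 : ℂ) ∈ ball (0 : ℂ) 1 := mem_ball_self one_pos
  rcases (han 0 h0).eventually_eq_zero_or_eventually_ne_zero with h | h
  · exact fun z hz' => han.eqOn_zero_of_preconnected_of_eventuallyEq_zero
      (convex_ball 0 1).isPreconnected h0 h hz'
  · exfalso
    have hev : ∀ k, ∀ᶠ z in 𝓝[≠] (0 : ℂ), Φ (z * ω k) ≠ 0 := by
      intro k
      have ht : Tendsto (fun z : ℂ => z * ω k) (𝓝[≠] 0) (𝓝[≠] 0) := by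
        refine tendsto_nhdsWithin_iff.2 ⟨?_, ?_⟩
        · have : Continuous (fun z : ℂ => z * ω k) := by fun_prop
          simpa using (this.tendsto 0).mono_left nhdsWithin_le_nhds
        · filter_upwards [self_mem_nhdsWithin] with z hz'
          exact mul_ne_zero hz' (exp_ne_zero _)
      exact ht.eventually h
    have hall : ∀ᶠ z in 𝓝[≠] (0 : ℂ), ∀ k ∈ Finset.range n, Φ (z * ω k) ≠ 0 :=
      (Filter.eventually_all_finset _).2 fun k _ => hev k
    obtain ⟨z, hz1, hz2⟩ := (hall.and
      (mem_nhdsWithin_of_mem_nhds (isOpen_ball.mem_nhds h0))).exists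
    exact Finset.prod_ne_zero_iff.2 hz1 (hP0 z hz2)

lemma exists_angle_of_ne {θ θ' : ℂ} (hθ : ‖θ‖ = 1) (hθ' : ‖θ'‖ = 1) (hne : θ ≠ θ') :
    ∃ α β : ℝ, α < β ∧ β < α + 2 * Real.pi ∧
      ((exp (α * I) = θ ∧ exp (β * I) = θ') ∨ (exp (α * I) = θ' ∧ exp (β * I) = θ)) := by
  have h1 : ∀ z : ℂ, ‖z‖ = 1 → exp (arg z * I) = z := by
    intro z hz
    have := norm_mul_exp_arg_mul_I z
    rw [hz] at this; simpa using this
  have hargne : arg θ ≠ arg θ' := fun h => hne (by rw [← h1 θ hθ, ← h1 θ' hθ', h])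
  have b1 := arg_mem_Ioc θ
  have b2 := arg_mem_Ioc θ'
  rcases lt_or_gt_of_ne hargne with h | h
  · exact ⟨arg θ, arg θ', h, by linarith [b1.1, b2.2], Or.inl ⟨h1 _ hθ, h1 _ hθ'⟩⟩
  · exact ⟨arg θ', arg θ, h, by linarith [b2.1, b1.2], Or.inr ⟨h1 _ hθ', h1 _ hθ⟩⟩

/-- Midpoints of distinct points of the closure lie in the domain. -/
def IsRotund (Ω : Set ℂ) : Prop :=
  ∀ x ∈ closure Ω, ∀ y ∈ closure Ω, x ≠ y → (1 / 2 : ℝ) • x + (1 / 2 : ℝ) • y ∈ Ω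

namespace IsConvexParam

variable {Ω : Set ℂ} {G Γ : ℂ → ℂ}

/-- The extension to a strictly convex domain is injective on the circle. -/
lemma injective_on_circle (h : IsConvexParam Ω G Γ) (hrot : IsRotund Ω) {E : ℂ → ℂ}
    (hE : ContinuousOn E (closedBall 0 1)) (hEG : EqOn E G disk)
    (hcl : ∀ z ∈ closedBall (0 : ℂ) 1, E z ∈ closure Ω) (hfr : ∀ θ : ℂ, ‖θ‖ = 1 → E θ ∉ Ω)
    (harc : ∀ (p : ℂ) (α β : ℝ), α < β → ∃ t ∈ Ioo α β, E (exp (t * I)) ≠ p)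
    {θ θ' : ℂ} (hθ : ‖θ‖ = 1) (hθ' : ‖θ'‖ = 1) (heq : E θ = E θ') : θ = θ' := by
  by_contra hne
  obtain ⟨α, β, hαβ, hβα, hab⟩ := exists_angle_of_ne hθ hθ' hne
  have hu : ∀ x : ℝ, ‖exp (x * I)‖ = 1 := fun x => norm_exp_ofReal_mul_I x
  have hαp : E (exp (α * I)) = E θ := by
    rcases hab with h' | h' <;> rw [h'.1]; exact heq.symm
  have hβp : E (exp (β * I)) = E θ := by
    rcases hab with h' | h' <;> rw [h'.2]; exact heq.symm
  -- Rotundity makes E θ the only maximum point of a supporting functional on the closure. If two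
  -- circle points took this value, lower values on both arcs between them would interlace.
  obtain ⟨L, hL⟩ := geometric_hahn_banach_open_point h.convex h.isOpen (hfr θ hθ)
  have hcb : ∀ ξ : ℂ, ‖ξ‖ = 1 → E ξ ∈ closure Ω := fun ξ hξ => hcl ξ (by simp [hξ])
  have hstrict : ∀ x ∈ closure Ω, x ≠ E θ → L x < L (E θ) := by
    intro x hx hxp
    have := hL _ (hrot x hx _ (hcb θ hθ) hxp)
    rw [map_add, map_smul, map_smul, smul_eq_mul, smul_eq_mul] at this
    linarith
  obtain ⟨t, ht, htp⟩ := harc (E θ) α β hαβ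
  obtain ⟨t', ht', htp'⟩ := harc (E θ) β (α + 2 * Real.pi) hβα
  have l1 := hstrict _ (hcb _ (hu t)) htp
  have l2 := hstrict _ (hcb _ (hu t')) htp'
  obtain ⟨c, hc1, hc2⟩ := exists_between (max_lt l1 l2)
  rw [max_lt_iff] at hc1
  exact h.not_interlaced hE hEG L ht.1 ht.2 ht'.1 ht'.2 (by rw [hαp]; exact hc2) hc1.1
    (by rw [hβp]; exact hc2) hc1.2

/-- A linear functional that is maximal at a point of the circle is dominated on `Ω`. -/
lemma le_of_isMaxOn_circle (h : IsConvexParam Ω G Γ) {E : ℂ → ℂ}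
    (hE : ContinuousOn E (closedBall 0 1)) (hEG : EqOn E G disk) {L : ℂ →L[ℝ] ℝ} {v : ℂ}
    (hv : 0 < L v) {θ : ℂ} (hmax : ∀ ξ : ℂ, ‖ξ‖ = 1 → L (E ξ) ≤ L (E θ)) {w : ℂ} (hw : w ∈ Ω) :
    L w < L (E θ) := by
  have hpush : ∀ w ∈ Ω, ∃ w' ∈ Ω, L w < L w' := by
    intro w hw
    have hcont : Continuous (fun t : ℝ => w + t • v) := by fun_prop
    have hev : ∀ᶠ t in 𝓝[>] (0 : ℝ), w + t • v ∈ Ω := by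
      refine Eventually.filter_mono nhdsWithin_le_nhds ?_
      exact hcont.continuousAt.eventually (h.isOpen.mem_nhds (by simpa using hw))
    obtain ⟨t, ht, ht0⟩ := (hev.and self_mem_nhdsWithin).exists
    refine ⟨_, ht, ?_⟩
    rw [map_add, map_smul, smul_eq_mul]
    have : 0 < t * L v := mul_pos ht0 hv
    linarith
  obtain ⟨z, hz, hzmax⟩ := (isCompact_closedBall (0 : ℂ) 1).exists_isMaxOn ⟨0, by simp⟩
    (L.continuous.comp_continuousOn hE)
  have hle : ∀ w ∈ Ω, L w ≤ L (E z) := by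
    intro w hw
    obtain ⟨x, hx, rfl⟩ := h.surj hw
    have := hzmax (ball_subset_closedBall hx)
    rwa [mem_ofPred_eq, Function.comp_apply, Function.comp_apply, hEG hx] at this
  have hz1 : ‖z‖ = 1 := by
    rcases (mem_closedBall_zero_iff.1 hz).lt_or_eq with h' | h'
    · have hzd : z ∈ disk := mem_ball_zero_iff.2 h'
      obtain ⟨w', hw', hlt⟩ := hpush (G z) (h.mapsTo hzd)
      have := hle w' hw'
      rw [hEG hzd] at this
      linarith
    · exact h'
  obtain ⟨w', hw', hlt⟩ := hpush w hw
  linarith [hle w' hw', hmax z hz1]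

end IsConvexParam

/-- The functional `w ↦ re (exp (-α i) w)`. -/
noncomputable def dirFun (α : ℝ) : ℂ →L[ℝ] ℝ :=
  reCLM ∘L (((ContinuousLinearMap.mul ℝ ℂ) (exp (-α * I))))

lemma dirFun_apply (α : ℝ) (w : ℂ) : dirFun α w = (exp (-α * I) * w).re := rfl

lemma dirFun_add_pi (α : ℝ) (w : ℂ) : dirFun (α + Real.pi) w = -dirFun α w := by
  rw [dirFun_apply, dirFun_apply]
  have : exp (-((α + Real.pi : ℝ) : ℂ) * I) = -exp (-α * I) := by
    push_cast
    rw [show -((α : ℂ) + Real.pi) * I = -α * I - Real.pi * I by ring, exp_sub, exp_pi_mul_I, div_neg, div_one]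
  rw [this, neg_mul, neg_re]

lemma dirFun_pos (α : ℝ) : 0 < dirFun α (exp (α * I)) := by
  rw [dirFun_apply, ← exp_add]; simp

lemma abs_dirFun_sub_le (α α' : ℝ) (w : ℂ) :
    |dirFun α w - dirFun α' w| ≤ ‖exp (-α * I) - exp (-α' * I)‖ * ‖w‖ := by
  rw [dirFun_apply, dirFun_apply, ← sub_re, ← sub_mul, ← norm_mul]
  exact abs_re_le_norm _

/-- If every direction has a unique maximum point on the circle, then some direction has antipodal
maximum and minimum points. -/
theorem exists_antipodal {E : ℂ → ℂ} (hE : ContinuousOn E (sphere (0 : ℂ) 1))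
    (huniq : ∀ (α : ℝ) (θ θ' : ℂ), ‖θ‖ = 1 → ‖θ'‖ = 1 →
      (∀ ξ : ℂ, ‖ξ‖ = 1 → dirFun α (E ξ) ≤ dirFun α (E θ)) →
      (∀ ξ : ℂ, ‖ξ‖ = 1 → dirFun α (E ξ) ≤ dirFun α (E θ')) → θ = θ') :
    ∃ (α : ℝ) (τ : ℂ), ‖τ‖ = 1 ∧ ∀ ξ : ℂ, ‖ξ‖ = 1 →
      dirFun α (E ξ) ≤ dirFun α (E τ) ∧ dirFun α (E (-τ)) ≤ dirFun α (E ξ) := by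
  have hS : IsCompact (sphere (0 : ℂ) 1) := isCompact_sphere 0 1
  have hSne : (sphere (0 : ℂ) 1).Nonempty := NormedSpace.sphere_nonempty.2 zero_le_one
  have hLc : ∀ α, ContinuousOn (fun ξ => dirFun α (E ξ)) (sphere (0 : ℂ) 1) := fun α =>
    (dirFun α).continuous.comp_continuousOn hE
  have hex : ∀ α : ℝ, ∃ θ : ℂ, ‖θ‖ = 1 ∧ ∀ ξ : ℂ, ‖ξ‖ = 1 → dirFun α (E ξ) ≤ dirFun α (E θ) := by
    intro α
    obtain ⟨θ, hθ, hmax⟩ := hS.exists_isMaxOn hSne (hLc α)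
    exact ⟨θ, by simpa using hθ, fun ξ hξ => hmax (by simpa using hξ)⟩
  choose τ hτ1 hτ using hex
  obtain ⟨M, hM⟩ : ∃ M, ∀ ξ : ℂ, ‖ξ‖ = 1 → ‖E ξ‖ ≤ M := by
    obtain ⟨M, hM⟩ := hS.exists_bound_of_continuousOn hE
    exact ⟨M, fun ξ hξ => hM ξ (by simpa using hξ)⟩
  -- Uniqueness and compactness leave a gap g between the maximum and the values off a neighbourhood
  -- of the maximum point. A small change of direction moves all values by less than g/2.
  have hτc : Continuous τ := by
    rw [continuous_iff_continuousAt]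
    intro α
    rw [ContinuousAt, _root_.tendsto_nhds]
    intro V hV hαV
    by_cases hempty : (sphere (0 : ℂ) 1 \ V).Nonempty
    · obtain ⟨ξ, hξ, hξmax⟩ := (hS.diff hV).exists_isMaxOn hempty ((hLc α).mono sdiff_subset)
      have hξ1 : ‖ξ‖ = 1 := by simpa using hξ.1
      have hgap : dirFun α (E ξ) < dirFun α (E (τ α)) := by
        refine lt_of_le_of_ne (hτ α ξ hξ1) fun heq => hξ.2 ?_
        have : ξ = τ α := huniq α ξ (τ α) hξ1 (hτ1 α) (by rw [heq]; exact hτ α) (hτ α)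
        rwa [this]
      set g := dirFun α (E (τ α)) - dirFun α (E ξ)
      have hg : 0 < g := sub_pos.2 hgap
      have hcont : Continuous (fun α' : ℝ => ‖exp (-α' * I) - exp (-α * I)‖ * M) := by fun_prop
      have hev : ∀ᶠ α' : ℝ in 𝓝 α, ‖exp (-α' * I) - exp (-α * I)‖ * M < g / 2 := by
        refine (hcont.tendsto α).eventually (gt_mem_nhds ?_)
        simp only [sub_self, norm_zero, zero_mul]; positivity
      filter_upwards [hev] with α' hα'
      by_contra hnV
      have h1 : dirFun α (E (τ α')) ≤ dirFun α (E ξ) := hξmax ⟨by simpa using hτ1 α', hnV⟩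
      have h2 := hτ α' (τ α) (hτ1 α)
      have h3 : ∀ ζ : ℂ, ‖ζ‖ = 1 → |dirFun α' (E ζ) - dirFun α (E ζ)| < g / 2 := fun ζ hζ =>
        lt_of_le_of_lt ((abs_dirFun_sub_le α' α _).trans
          (mul_le_mul_of_nonneg_left (hM ζ hζ) (norm_nonneg _))) hα'
      have h4 := abs_lt.1 (h3 (τ α) (hτ1 α))
      have h5 := abs_lt.1 (h3 (τ α') (hτ1 α'))
      simp only [g] at h4 h5
      linarith [h4.1, h5.2]
    · rw [not_nonempty_iff_eq_empty, sdiff_eq_empty] at hempty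
      exact univ_mem' fun α' => hempty (by simpa using hτ1 α')
  have hmin : ∀ α (ξ : ℂ), ‖ξ‖ = 1 → dirFun α (E (τ (α + Real.pi))) ≤ dirFun α (E ξ) := by
    intro α ξ hξ
    have := hτ (α + Real.pi) ξ hξ
    rw [dirFun_add_pi, dirFun_add_pi] at this
    linarith
  have hper : τ (0 + Real.pi + Real.pi) = τ 0 := by
    refine huniq 0 _ _ (hτ1 _) (hτ1 _) ?_ (hτ 0)
    intro ξ hξ
    have := hmin (0 + Real.pi) ξ hξ
    rw [dirFun_add_pi, dirFun_add_pi] at this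
    linarith
  -- D vanishes exactly when the maximum and minimum points are equal or opposite; exchanging them
  -- reverses its sign.
  set D : ℝ → ℝ := fun α => (τ α * (starRingEnd ℂ) (τ (α + Real.pi))).im
  have hD : Continuous D := by
    refine continuous_im.comp (hτc.mul (continuous_conj.comp (hτc.comp (by fun_prop))))
  have hDπ : D (0 + Real.pi) = -D 0 := by
    simp only [D]
    rw [hper]
    simp only [mul_im, conj_re, conj_im]
    ring
  obtain ⟨α, hα⟩ : ∃ α, D α = 0 := by
    have hpre := isPreconnected_univ.image D hD.continuousOn
    rcases le_total 0 (D 0) with h | h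
    · obtain ⟨α, -, hα⟩ := hpre.ordConnected.out ⟨0 + Real.pi, trivial, rfl⟩ ⟨0, trivial, rfl⟩
        (show (0 : ℝ) ∈ Icc _ _ from ⟨by rw [hDπ]; linarith, h⟩)
      exact ⟨α, hα⟩
    · obtain ⟨α, -, hα⟩ := hpre.ordConnected.out ⟨0, trivial, rfl⟩ ⟨0 + Real.pi, trivial, rfl⟩
        (show (0 : ℝ) ∈ Icc _ _ from ⟨h, by rw [hDπ]; linarith⟩)
      exact ⟨α, hα⟩
  have hsq : τ (α + Real.pi) ^ 2 = τ α ^ 2 := by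
    have hr : (starRingEnd ℂ) (τ α * (starRingEnd ℂ) (τ (α + Real.pi))) =
        τ α * (starRingEnd ℂ) (τ (α + Real.pi)) := conj_eq_iff_im.2 hα
    rw [map_mul, conj_conj] at hr
    have c1 : τ α * (starRingEnd ℂ) (τ α) = 1 := by rw [mul_conj, normSq_eq_norm_sq, hτ1]; simp
    have c2 : τ (α + Real.pi) * (starRingEnd ℂ) (τ (α + Real.pi)) = 1 := by
      rw [mul_conj, normSq_eq_norm_sq, hτ1]; simp
    linear_combination (τ α * τ (α + Real.pi)) * hr - τ (α + Real.pi) ^ 2 * c1 + τ α ^ 2 * c2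
  refine ⟨α, τ α, hτ1 α, fun ξ hξ => ⟨hτ α ξ hξ, ?_⟩⟩
  rcases sq_eq_sq_iff_eq_or_eq_neg.1 hsq with h | h
  -- Coinciding extremal points would make the functional constant on the circle, against
  -- uniqueness.
  · exfalso
    have hconst : ∀ ξ : ℂ, ‖ξ‖ = 1 → dirFun α (E ξ) = dirFun α (E (τ α)) := fun ξ hξ =>
      le_antisymm (hτ α ξ hξ) (by rw [← h]; exact hmin α ξ hξ)
    have := huniq α 1 (-1) (by simp) (by simp)
      (fun ξ hξ => by rw [hconst ξ hξ, hconst 1 (by simp)])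
      (fun ξ hξ => by rw [hconst ξ hξ, hconst (-1) (by simp)])
    norm_num [Complex.ext_iff] at this
  · rw [← h]; exact hmin α ξ hξ

end HarmonicMapping


namespace HarmonicMapping
open Complex Set Metric Filter Topology

/-! ### Monotonicity along hyperbolic flows -/

/-- Minimum principle for harmonic functions on the disk. -/
lemma nonneg_of_nonneg_on_circle {u : ℂ → ℝ}
    (hu : InnerProductSpace.HarmonicContOnCl u (ball 0 1)) (h0 : ∀ ξ : ℂ, ‖ξ‖ = 1 → 0 ≤ u ξ)
    {z : ℂ} (hz : z ∈ ball (0 : ℂ) 1) : 0 ≤ u z := by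
  rw [← hu.circleAverage_poissonKernel_smul hz, Real.circleAverage_def, smul_eq_mul]
  refine mul_nonneg (by have := Real.pi_pos; positivity)
    (intervalIntegral.integral_nonneg (by have := Real.pi_pos; positivity) fun t _ => ?_)
  have h1 : ‖circleMap 0 1 t‖ = 1 := by simp
  refine mul_nonneg ?_ (h0 _ h1)
  rw [poissonKernel_def]
  simp only [sub_zero, h1]
  have := mem_ball_zero_iff.1 hz
  exact div_nonneg (by nlinarith [norm_nonneg z]) (by positivity)

/-- Carathéodory's coefficient bound for functions with nonnegative real part. -/
lemma norm_deriv_le_two_mul_re {p : ℂ → ℂ} (hp : DifferentiableOn ℂ p (ball 0 1))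
    (hre : ∀ z ∈ ball (0 : ℂ) 1, 0 ≤ (p z).re) : ‖deriv p 0‖ ≤ 2 * (p 0).re := by
  refine le_of_forall_pos_le_add fun δ hδ => ?_
  have h0 : (0 : ℂ) ∈ ball (0 : ℂ) 1 := mem_ball_self one_pos
  -- The shift makes the real part strictly positive, so that the Cayley-type quotient M is defined
  -- and the Schwarz lemma applies to it.
  set q : ℂ → ℂ := fun z => p z + (δ / 2 : ℝ)
  have hq : ∀ z ∈ ball (0 : ℂ) 1, 0 < (q z).re := fun z hz => by
    simp only [q, add_re, ofReal_re]; linarith [hre z hz]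
  have hqd : DifferentiableOn ℂ q (ball 0 1) := hp.add_const _
  set M : ℂ → ℂ := fun z => (q z - q 0) / (q z + (starRingEnd ℂ) (q 0))
  have hden : ∀ z ∈ ball (0 : ℂ) 1, q z + (starRingEnd ℂ) (q 0) ≠ 0 := by
    intro z hz h
    have := congrArg re h
    simp only [add_re, conj_re, zero_re] at this
    linarith [hq z hz, hq 0 h0]
  have hMd : DifferentiableOn ℂ M (ball 0 1) :=
    (hqd.sub_const _).div (hqd.add_const _) hden
  have hM0 : M 0 = 0 := by simp [M]
  have hMb : MapsTo M (ball 0 1) (closedBall (M 0) 1) := by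
    intro z hz
    rw [hM0, mem_closedBall_zero_iff, norm_div, div_le_one (norm_pos_iff.2 (hden z hz))]
    have : normSq (q z - q 0) ≤ normSq (q z + (starRingEnd ℂ) (q 0)) := by
      simp only [normSq_apply, sub_re, sub_im, add_re, add_im, conj_re, conj_im]
      nlinarith [hq z hz, hq 0 h0]
    rw [normSq_eq_norm_sq, normSq_eq_norm_sq] at this
    exact le_of_sq_le_sq this (norm_nonneg _)
  have hMder := norm_deriv_le_div_of_mapsTo_ball hMd hMb one_pos
  have hq' : HasDerivAt q (deriv p 0) 0 :=
    (hp.differentiableAt (isOpen_ball.mem_nhds h0)).hasDerivAt.add_const _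
  have hder : deriv M 0 = deriv p 0 / (q 0 + (starRingEnd ℂ) (q 0)) := by
    have := ((hq'.sub_const (q 0)).fun_div (hq'.add_const ((starRingEnd ℂ) (q 0))) (hden 0 h0)).deriv
    rw [this]
    have := hden 0 h0
    field_simp
    ring
  rw [hder, norm_div, add_conj, norm_real, Real.norm_of_nonneg (by linarith [hq 0 h0]), div_one,
    div_le_one (by linarith [hq 0 h0])] at hMder
  simp only [q, add_re, ofReal_re] at hMder
  linarith

/-- The hyperbolic translation moves points of the circle towards `1`. -/
lemma mob_neg_re_im {z : ℂ} (hz : ‖z‖ = 1) {s : ℝ} (hs0 : 0 < s) (hs1 : s < 1) (him : z.im ≠ 0) :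
    z.re < (mob (-s) z).re ∧ 0 < (mob (-s) z).im * z.im := by
  have hN0 : 1 + (s : ℂ) * z ≠ 0 := by
    have := mob_denom_ne_zero (c := -(s : ℂ)) (z := z) (by
      rw [norm_neg, norm_real, Real.norm_of_nonneg hs0.le]; exact hs1) hz.le
    simpa using this
  have hmob : mob (-s) z = (z + s) / (1 + s * z) := by simp [mob]
  have hN : 0 < normSq (1 + (s : ℂ) * z) := normSq_pos.2 hN0
  have hxy : z.re * z.re + z.im * z.im = 1 := by
    rw [← normSq_apply, normSq_eq_norm_sq, hz, one_pow]
  have hNv : normSq (1 + (s : ℂ) * z) = 1 + 2 * s * z.re + s ^ 2 := by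
    simp only [normSq_apply, add_re, one_re, add_im, one_im, re_ofReal_mul, im_ofReal_mul]
    linear_combination s ^ 2 * hxy
  have hre : (mob (-s) z).re = (z.re * (1 + s ^ 2) + 2 * s) / normSq (1 + (s : ℂ) * z) := by
    rw [hmob, div_re, ← add_div]
    congr 1
    simp only [add_re, one_re, add_im, one_im, re_ofReal_mul, im_ofReal_mul, ofReal_re, ofReal_im]
    linear_combination s * hxy
  have himv : (mob (-s) z).im = z.im * (1 - s ^ 2) / normSq (1 + (s : ℂ) * z) := by
    rw [hmob, div_im, ← sub_div]
    congr 1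
    simp only [add_re, one_re, add_im, one_im, re_ofReal_mul, im_ofReal_mul, ofReal_re, ofReal_im]
    ring
  have himsq : 0 < z.im * z.im := mul_self_pos.2 him
  constructor
  · rw [hre, lt_div_iff₀ hN, hNv]
    nlinarith
  · rw [himv, div_mul_eq_mul_div]
    apply div_pos _ hN
    have : 0 < 1 - s ^ 2 := by nlinarith
    nlinarith

lemma exp_arg_mul_I {z : ℂ} (hz : ‖z‖ = 1) : exp (arg z * I) = z := by
  have := norm_mul_exp_arg_mul_I z
  rw [hz] at this; simpa using this

lemma arccos_re_lt {z z' : ℂ} (hz : ‖z‖ = 1) (hz' : ‖z'‖ = 1) (h : z.re < z'.re) :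
    Real.arccos (z'.re / ‖z'‖) < Real.arccos (z.re / ‖z‖) := by
  rw [hz, hz', div_one, div_one]
  have b1 := abs_le.1 ((abs_re_le_norm z).trans hz.le)
  have b2 := abs_le.1 ((abs_re_le_norm z').trans hz'.le)
  exact Real.strictAntiOn_arccos b1 b2 h

/-- A function on the circle with extrema at `±1` and no interlacing increases along the
hyperbolic translations towards `1`. -/
lemma circle_le_mob {u : ℂ → ℝ}
    (hNI : ∀ c α β γ δ : ℝ, α < β → β < γ → γ < δ → δ < α + 2 * Real.pi → c < u (exp (α * I)) →
      u (exp (β * I)) < c → c < u (exp (γ * I)) → u (exp (δ * I)) < c → False)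
    (hmax : ∀ ξ : ℂ, ‖ξ‖ = 1 → u ξ ≤ u 1) (hmin : ∀ ξ : ℂ, ‖ξ‖ = 1 → u (-1) ≤ u ξ)
    {s : ℝ} (hs0 : 0 < s) (hs1 : s < 1) {z : ℂ} (hz : ‖z‖ = 1) : u z ≤ u (mob (-s) z) := by
  have hs : ‖(-s : ℂ)‖ < 1 := by rw [norm_neg, norm_real, Real.norm_of_nonneg hs0.le]; exact hs1
  have hz' : ‖mob (-s) z‖ = 1 := norm_mob_eq_one hs hz
  by_cases him : z.im = 0
  · have hre : z.re ^ 2 = 1 := by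
      have := normSq_apply z
      rw [normSq_eq_norm_sq, hz, him] at this
      nlinarith
    rcases sq_eq_sq_iff_eq_or_eq_neg.1 (hre.trans (one_pow 2).symm) with h | h
    · have hz1 : z = 1 := Complex.ext (by simpa using h) (by simpa using him)
      have : mob (-s) z = 1 := by
        rw [hz1, mob]
        have : (1 : ℂ) + s ≠ 0 := by
          have : (1 + s : ℝ) ≠ 0 := by linarith
          exact_mod_cast this
        simp [this]
      rw [this, hz1]
    · have hz1 : z = -1 := Complex.ext (by simpa using h) (by simpa using him)
      rw [hz1]
      rw [hz1] at hz'
      exact hmin _ hz'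
  obtain ⟨h1, h2⟩ := mob_neg_re_im hz hs0 hs1 him
  set z' := mob (-s) z
  by_contra! hlt
  -- On the open semicircle containing z, the point z' lies between z and 1. A drop from z to z'
  -- gives values high, low, high, low at z, z', 1, -1.
  obtain ⟨c, hc1, hc2⟩ := exists_between hlt
  have u1 : c < u 1 := hc2.trans_le (hmax z hz)
  have u2 : u (-1) < c := (hmin z' hz').trans_lt hc1
  have e0 : u (exp ((0 : ℝ) * I)) = u 1 := by simp
  have eπ : u (exp (Real.pi * I)) = u (-1) := by rw [exp_pi_mul_I]
  have ez : u (exp (arg z * I)) = u z := by rw [exp_arg_mul_I hz]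
  have ez' : u (exp (arg z' * I)) = u z' := by rw [exp_arg_mul_I hz']
  have hz0 : z ≠ 0 := by rintro rfl; simp at him
  have hz0' : z' ≠ 0 := by intro h; rw [h] at h2; simp at h2
  have hacos := arccos_re_lt hz hz' h1
  have hne : ∀ ζ : ℂ, ζ.im ≠ 0 → arg ζ ≠ 0 := fun ζ hζ h => hζ (arg_eq_zero_iff.1 h).2
  rcases lt_or_gt_of_ne him with hneg | hpos
  · have hneg' : z'.im < 0 := by nlinarith
    have a1 : arg z < arg z' := by
      rw [arg_of_im_neg hneg, arg_of_im_neg hneg']; linarith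
    have a2 : arg z' < 0 := arg_neg_iff.2 hneg'
    exact hNI c (arg z) (arg z') 0 Real.pi a1 a2 Real.pi_pos (by linarith [neg_pi_lt_arg z])
      (by rw [ez]; exact hc2) (by rw [ez']; exact hc1) (by rw [e0]; exact u1) (by rw [eπ]; exact u2)
  · have hpos' : 0 < z'.im := by nlinarith
    have a1 : arg z' < arg z := by
      rw [arg_of_im_nonneg_of_ne_zero hpos.le hz0, arg_of_im_nonneg_of_ne_zero hpos'.le hz0']
      exact hacos
    have a2 : 0 < arg z' := lt_of_le_of_ne (arg_nonneg_iff.2 hpos'.le) (hne z' hpos'.ne').symm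
    have a3 : arg z < Real.pi := arg_lt_pi_iff.2 (Or.inr him)
    exact hNI c 0 (arg z') (arg z) Real.pi a2 a1 a3 (by linarith [Real.pi_pos])
      (by rw [e0]; exact u1) (by rw [ez']; exact hc1) (by rw [ez]; exact hc2) (by rw [eπ]; exact u2)

/-- If the real part of `F` has boundary values with extrema at `±1` and no interlacing, then
`(1 - z ^ 2) F'(z)` has nonnegative real part. -/
lemma re_deriv_mul_nonneg {u : ℂ → ℝ} {F : ℂ → ℂ} (hu : ContinuousOn u (closedBall 0 1))
    (hF : DifferentiableOn ℂ F disk) (huF : ∀ z ∈ disk, u z = (F z).re)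
    (hNI : ∀ c α β γ δ : ℝ, α < β → β < γ → γ < δ → δ < α + 2 * Real.pi → c < u (exp (α * I)) →
      u (exp (β * I)) < c → c < u (exp (γ * I)) → u (exp (δ * I)) < c → False)
    (hmax : ∀ ξ : ℂ, ‖ξ‖ = 1 → u ξ ≤ u 1) (hmin : ∀ ξ : ℂ, ‖ξ‖ = 1 → u (-1) ≤ u ξ)
    {z : ℂ} (hz : z ∈ disk) : 0 ≤ (deriv F z * (1 - z ^ 2)).re := by
  have hcl : closure (ball (0 : ℂ) 1) = closedBall 0 1 := closure_ball _ one_ne_zero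
  have hharm : ∀ {F : ℂ → ℂ} {u : ℂ → ℝ}, DifferentiableOn ℂ F disk →
      (∀ z ∈ disk, u z = (F z).re) → InnerProductSpace.HarmonicOnNhd u disk := by
    intro F u hF huF x hx
    have h1 : InnerProductSpace.HarmonicAt (fun z => (F z).re) x :=
      (hF.analyticAt (isOpen_ball.mem_nhds hx)).harmonicAt_re
    refine (InnerProductSpace.harmonicAt_congr_nhds ?_).2 h1
    filter_upwards [isOpen_ball.mem_nhds hx] with y hy using huF y hy
  have hmono : ∀ s : ℝ, 0 < s → s < 1 → (F z).re ≤ (F (mob (-s) z)).re := by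
    intro s hs0 hs1
    have hs : ‖(-s : ℂ)‖ < 1 := by rw [norm_neg, norm_real, Real.norm_of_nonneg hs0.le]; exact hs1
    have hmaps := mapsTo_mob hs
    have hmapsc : MapsTo (mob (-s)) (closedBall 0 1) (closedBall 0 1) := by
      intro x hx
      rcases (mem_closedBall_zero_iff.1 hx).lt_or_eq with h | h
      · exact ball_subset_closedBall (hmaps (mem_ball_zero_iff.2 h))
      · rw [mem_closedBall_zero_iff]; exact (norm_mob_eq_one hs h).le
    have hmobc : ContinuousOn (mob (-s)) (closedBall 0 1) := fun x hx =>
      (hasDerivAt_mob hs (mem_closedBall_zero_iff.1 hx)).continuousAt.continuousWithinAt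
    have hdiff : InnerProductSpace.HarmonicContOnCl (fun x => u (mob (-s) x) - u x) (ball 0 1) := by
      refine ⟨?_, ?_⟩
      · refine hharm (F := fun x => F (mob (-s) x) - F x)
          ((hF.comp (differentiableOn_mob hs) hmaps).sub hF) fun x hx => ?_
        rw [huF x hx, huF _ (hmaps hx), sub_re]
      · rw [hcl]
        exact (hu.comp hmobc hmapsc).sub hu
    have := nonneg_of_nonneg_on_circle hdiff
      (fun ξ hξ => sub_nonneg.2 (circle_le_mob hNI hmax hmin hs0 hs1 hξ)) hz
    rw [huF z hz, huF _ (hmaps hz)] at this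
    linarith
  have hmob0 : mob (-(0 : ℝ)) z = z := by simp [mob]
  -- The flow has initial velocity 1 - z²; the claim is the derivative of the monotonicity at s = 0.
  have hd1 : HasDerivAt (fun s : ℝ => mob (-s) z) (1 - z ^ 2) 0 := by
    have hid : HasDerivAt (fun s : ℝ => (s : ℂ)) 1 0 := (hasDerivAt_id (0 : ℝ)).ofReal_comp
    have := (hid.const_add z).fun_div ((hid.mul_const z).const_add 1) (by simp)
    have h2 : (fun s : ℝ => mob (-s) z) = fun s : ℝ => (z + s) / (1 + s * z) := by
      ext s; simp [mob]
    rw [h2]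
    refine this.congr_deriv ?_
    simp; ring
  have hd2 : HasDerivAt (fun s : ℝ => (F (mob (-s) z)).re) (deriv F z * (1 - z ^ 2)).re 0 := by
    have h3 : HasDerivAt F (deriv F z) (mob (-(0 : ℝ)) z) := by
      rw [hmob0]; exact (hF.differentiableAt (isOpen_ball.mem_nhds hz)).hasDerivAt
    have h4 := h3.comp (0 : ℝ) hd1
    exact reCLM.hasFDerivAt.comp_hasDerivAt (0 : ℝ) h4
  refine ge_of_tendsto hd2.tendsto_slope_zero_right ?_
  filter_upwards [Ioo_mem_nhdsGT (one_pos (α := ℝ))] with s hs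
  have := hmono s hs.1 hs.2
  rw [zero_add, hmob0, smul_eq_mul]
  exact mul_nonneg (inv_nonneg.2 hs.1.le) (by linarith)

/-- The second coefficient bound obtained from the positivity of `(1 - z ^ 2) F'(z)`. -/
lemma norm_deriv_deriv_le {u : ℂ → ℝ} {F : ℂ → ℂ} (hu : ContinuousOn u (closedBall 0 1))
    (hF : DifferentiableOn ℂ F disk) (huF : ∀ z ∈ disk, u z = (F z).re)
    (hNI : ∀ c α β γ δ : ℝ, α < β → β < γ → γ < δ → δ < α + 2 * Real.pi → c < u (exp (α * I)) →
      u (exp (β * I)) < c → c < u (exp (γ * I)) → u (exp (δ * I)) < c → False)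
    (hmax : ∀ ξ : ℂ, ‖ξ‖ = 1 → u ξ ≤ u 1) (hmin : ∀ ξ : ℂ, ‖ξ‖ = 1 → u (-1) ≤ u ξ) :
    ‖deriv (deriv F) 0‖ ≤ 2 * ‖deriv F 0‖ := by
  have hF' : DifferentiableOn ℂ (deriv F) disk := hF.deriv isOpen_ball
  have h := norm_deriv_le_two_mul_re (p := fun z => deriv F z * (1 - z ^ 2))
    (hF'.mul (by fun_prop)) fun z hz => re_deriv_mul_nonneg hu hF huF hNI hmax hmin hz
  have hd : deriv (fun z => deriv F z * (1 - z ^ 2)) 0 = deriv (deriv F) 0 := by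
    have h1 := (hF'.differentiableAt (isOpen_ball.mem_nhds zero_mem_disk)).hasDerivAt.fun_mul
      (((hasDerivAt_id' (0 : ℂ)).fun_pow 2).const_sub 1)
    rw [h1.deriv]; simp
  rw [hd] at h
  refine h.trans ?_
  simpa using re_le_norm (deriv F 0)

/-- For a harmonic homeomorphism of the disk onto a bounded strictly convex domain, some direction
satisfies the coefficient bound of functions convex in one direction with antipodal extrema. -/
theorem exists_direction {Ω : Set ℂ} {G Γ Ψ H K : ℂ → ℂ} (h : IsConvexParam Ω G Γ)
    (hG : HasSmallArcs G) (hrot : IsRotund Ω) (hΨ : ContinuousOn Ψ (closure Ω))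
    (hΨd : DifferentiableOn ℂ (fun z => Ψ (G z)) disk) (hΨi : InjOn (fun z => Ψ (G z)) disk)
    (hH : DifferentiableOn ℂ H disk) (hK : DifferentiableOn ℂ K disk)
    (hGHK : ∀ z ∈ disk, G z = H z + (starRingEnd ℂ) (K z)) :
    ∃ l : ℂ, ‖l‖ = 1 ∧ ‖l * deriv (deriv H) 0 + (starRingEnd ℂ) l * deriv (deriv K) 0‖ ≤
      2 * ‖l * deriv H 0 + (starRingEnd ℂ) l * deriv K 0‖ := by
  obtain ⟨E, hE, hEG, hcl, hfr⟩ := h.exists_extension hG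
  have hclb : closure (ball (0 : ℂ) 1) = closedBall 0 1 := closure_ball _ one_ne_zero
  have hsph : ∀ {ξ : ℂ}, ‖ξ‖ = 1 → ξ ∈ closedBall (0 : ℂ) 1 := fun hξ => by simp [hξ]
  -- G is not holomorphic, but Ψ ∘ G is. If E were constant on an arc, boundary uniqueness would
  -- make Ψ ∘ G constant, against injectivity.
  have harc : ∀ (p : ℂ) (α β : ℝ), α < β → ∃ t ∈ Ioo α β, E (exp (t * I)) ≠ p := by
    intro p α β hαβ
    by_contra! hcon
    have hΦ : DiffContOnCl ℂ (fun z => Ψ (E z) - Ψ p) (ball 0 1) := by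
      refine ⟨?_, ?_⟩
      · exact (hΨd.sub_const (Ψ p)).congr fun z hz => by simp only [hEG hz]
      · rw [hclb]
        exact (hΨ.comp hE hcl).sub continuousOn_const
    have h0 := eqOn_zero_of_zero_on_arc hΦ hαβ fun t ht => by simp only [hcon t ht, sub_self]
    have hhalf : (1 / 2 : ℂ) ∈ disk := by rw [mem_ball_zero_iff]; norm_num
    have h1 := h0 0 zero_mem_disk
    have h2 := h0 (1 / 2) hhalf
    rw [hEG zero_mem_disk] at h1
    rw [hEG hhalf] at h2
    have := hΨi zero_mem_disk hhalf ((sub_eq_zero.1 h1).trans (sub_eq_zero.1 h2).symm)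
    norm_num at this
  have hinj : ∀ {θ θ' : ℂ}, ‖θ‖ = 1 → ‖θ'‖ = 1 → E θ = E θ' → θ = θ' := fun hθ hθ' heq =>
    h.injective_on_circle hrot hE hEG hcl hfr harc hθ hθ' heq
  obtain ⟨α, τ, hτ, hext⟩ := exists_antipodal (E := E)
    (hE.mono sphere_subset_closedBall) (by
      intro α θ θ' hθ hθ' hm hm'
      by_contra hne
      have hmid := hrot _ (hcl θ (hsph hθ)) _ (hcl θ' (hsph hθ')) fun heq => hne (hinj hθ hθ' heq)
      have h1 := h.le_of_isMaxOn_circle hE hEG (dirFun_pos α) hm hmid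
      rw [map_add, map_smul, map_smul, smul_eq_mul, smul_eq_mul] at h1
      have h2 := hm' θ hθ
      linarith)
  set l : ℂ := exp (-α * I)
  have hl : ‖l‖ = 1 := by
    have := norm_exp_ofReal_mul_I (-α); push_cast at this; exact this
  have hτ0 : τ ≠ 0 := norm_ne_zero_iff.1 (by rw [hτ]; exact one_ne_zero)
  have hrotn : ∀ z : ℂ, ‖τ * z‖ = ‖z‖ := fun z => by rw [norm_mul, hτ, one_mul]
  have hmul : MapsTo (fun z => τ * z) disk disk := fun z hz => by
    rw [mem_ball_zero_iff] at hz ⊢; rwa [hrotn]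
  -- The real part of F₀ is `dirFun α` ∘ G; rotating by τ then places its extremal boundary points
  -- at 1 and -1.
  set F₀ : ℂ → ℂ := fun z => l * H z + (starRingEnd ℂ) l * K z
  have hF₀ : DifferentiableOn ℂ F₀ disk := (hH.const_mul l).add (hK.const_mul _)
  set F : ℂ → ℂ := fun z => F₀ (τ * z)
  have hF : DifferentiableOn ℂ F disk := hF₀.comp (by fun_prop) hmul
  set u : ℂ → ℝ := fun z => dirFun α (E (τ * z))
  have hexpτ : ∀ x : ℝ, τ * exp (x * I) = exp ((arg τ + x : ℝ) * I) := by
    intro x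
    push_cast
    rw [add_mul, exp_add, exp_arg_mul_I hτ]
  have key := norm_deriv_deriv_le (u := u) (F := F) ?_ hF ?_ ?_ ?_ ?_
  · have hd1 : ∀ z ∈ disk, deriv F z = τ * deriv F₀ (τ * z) := by
      intro z hz
      have h1 := (hF₀.differentiableAt (isOpen_ball.mem_nhds (hmul hz))).hasDerivAt.comp z
        ((hasDerivAt_id' z).const_mul τ)
      rw [show F = F₀ ∘ (fun z => τ * z) from rfl, h1.deriv]; ring
    have hd2 : deriv (deriv F) 0 = τ * (τ * deriv (deriv F₀) 0) := by
      have hev : deriv F =ᶠ[𝓝 0] fun z => τ * deriv F₀ (τ * z) := by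
        filter_upwards [isOpen_ball.mem_nhds zero_mem_disk] with z hz using hd1 z hz
      rw [hev.deriv_eq]
      have h2 : HasDerivAt (deriv F₀) (deriv (deriv F₀) 0) (τ * 0) := by
        rw [mul_zero]
        exact ((hF₀.deriv isOpen_ball).differentiableAt
          (isOpen_ball.mem_nhds zero_mem_disk)).hasDerivAt
      have h1 := (h2.comp (0 : ℂ) ((hasDerivAt_id' (0 : ℂ)).const_mul τ)).const_mul τ
      simp only [Function.comp_def] at h1
      rw [h1.deriv]; ring
    have hdF₀ : ∀ z ∈ disk, deriv F₀ z = l * deriv H z + (starRingEnd ℂ) l * deriv K z := by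
      intro z hz
      exact (((hH.differentiableAt (isOpen_ball.mem_nhds hz)).hasDerivAt.const_mul l).add
        ((hK.differentiableAt (isOpen_ball.mem_nhds hz)).hasDerivAt.const_mul _)).deriv
    have hddF₀ : deriv (deriv F₀) 0 =
        l * deriv (deriv H) 0 + (starRingEnd ℂ) l * deriv (deriv K) 0 := by
      have hev : deriv F₀ =ᶠ[𝓝 0] fun z => l * deriv H z + (starRingEnd ℂ) l * deriv K z := by
        filter_upwards [isOpen_ball.mem_nhds zero_mem_disk] with z hz using hdF₀ z hz
      rw [hev.deriv_eq]
      exact ((((hH.deriv isOpen_ball).differentiableAt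
        (isOpen_ball.mem_nhds zero_mem_disk)).hasDerivAt.const_mul l).add
        (((hK.deriv isOpen_ball).differentiableAt
        (isOpen_ball.mem_nhds zero_mem_disk)).hasDerivAt.const_mul _)).deriv
    refine ⟨l, hl, ?_⟩
    rw [hd2, hd1 0 zero_mem_disk, hrotn, hrotn, hrotn, mul_zero, hddF₀, hdF₀ 0 zero_mem_disk] at key
    exact key
  · refine (dirFun α).continuous.comp_continuousOn (hE.comp (by fun_prop) fun z hz => ?_)
    rw [mem_closedBall_zero_iff] at hz ⊢; rwa [hrotn]
  · intro z hz
    simp only [u, F, F₀]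
    rw [hEG (hmul hz), dirFun_apply, hGHK _ (hmul hz)]
    simp only [l, mul_re, add_re, add_im, conj_re, conj_im]
    ring
  · intro c a b g d h1 h2 h3 h4 u1 u2 u3 u4
    simp only [u, hexpτ] at u1 u2 u3 u4
    exact h.not_interlaced hE hEG (dirFun α) (by linarith) (by linarith) (by linarith)
      (by linarith) u1 u2 u3 u4
  · intro ξ hξ
    simp only [u, mul_one]
    exact (hext _ (by rw [hrotn, hξ])).1
  · intro ξ hξ
    simp only [u, mul_neg, mul_one]
    exact (hext _ (by rw [hrotn, hξ])).2

end HarmonicMapping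


namespace HarmonicMapping
open Complex Set Metric Filter Topology

/-! ### Exhaustion by strictly convex domains -/

lemma norm_sq_convex_comb {a b : ℝ} (hab : a + b = 1) (x y : ℂ) :
    ‖a • x + b • y‖ ^ 2 = a * ‖x‖ ^ 2 + b * ‖y‖ ^ 2 - a * b * ‖x - y‖ ^ 2 := by
  obtain rfl : b = 1 - a := by linarith
  simp only [← normSq_eq_norm_sq, normSq_apply, add_re, add_im, sub_re, sub_im, real_smul,
    re_ofReal_mul, im_ofReal_mul]
  ring

/-- Each point is interior to a polygon in Ω. Finitely many interiors cover K, and the hull of all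
the vertices stays in the convex set Ω. -/
lemma exists_finset_convexHull {Ω K : Set ℂ} (hΩ : IsOpen Ω) (hc : Convex ℝ Ω) (hK : IsCompact K)
    (hKΩ : K ⊆ Ω) : ∃ F : Finset ℂ, K ⊆ convexHull ℝ (F : Set ℂ) ∧ convexHull ℝ (F : Set ℂ) ⊆ Ω := by
  classical
  have key : ∀ x ∈ Ω, ∃ u : Finset ℂ, x ∈ interior (convexHull ℝ (u : Set ℂ)) ∧
      convexHull ℝ (u : Set ℂ) ⊆ Ω := by
    intro x hx
    obtain ⟨u, hu, hu'⟩ := (convex_singleton x).exists_subset_interior_convexHull_finset_of_isCompact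
      isCompact_singleton (hΩ.mem_nhdsSet.2 (singleton_subset_iff.2 hx))
    exact ⟨u, hu rfl, hu'⟩
  choose! u hu hu' using key
  obtain ⟨t, ht, hcov⟩ := hK.elim_nhds_subcover (fun x => interior (convexHull ℝ (u x : Set ℂ)))
    fun x hx => isOpen_interior.mem_nhds (hu x (hKΩ hx))
  refine ⟨t.biUnion u, fun y hy => ?_, convexHull_min (fun y hy => ?_) hc⟩
  · obtain ⟨x, hx, hyx⟩ := mem_iUnion₂.1 (hcov hy)
    refine convexHull_mono ?_ (interior_subset hyx)
    exact_mod_cast Finset.subset_biUnion_of_mem u hx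
  · obtain ⟨x, hx, hyx⟩ := Finset.mem_biUnion.1 (Finset.mem_coe.1 hy)
    exact hu' x (hKΩ (ht x hx)) (subset_convexHull ℝ _ hyx)

/-- A compact subset of a convex open set lies in a bounded strictly convex open subset with
closure in the given set. -/
theorem exists_isRotund {Ω K : Set ℂ} (hΩ : IsOpen Ω) (hc : Convex ℝ Ω) (hK : IsCompact K)
    (hKne : K.Nonempty) (hKΩ : K ⊆ Ω) :
    ∃ Ω' : Set ℂ, IsOpen Ω' ∧ Convex ℝ Ω' ∧ Bornology.IsBounded Ω' ∧ IsRotund Ω' ∧ K ⊆ Ω' ∧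
      closure Ω' ⊆ Ω := by
  obtain ⟨F, hKC, hFΩ⟩ := exists_finset_convexHull hΩ hc hK hKΩ
  set C : Set ℂ := convexHull ℝ (F : Set ℂ)
  have hCc : IsCompact C := F.finite_toSet.isCompact_convexHull ℝ
  have hCv : Convex ℝ C := convex_convexHull ℝ _
  have hCne : C.Nonempty := hKne.mono hKC
  obtain ⟨ε, hε, hthick⟩ := hCc.exists_cthickening_subset_open hΩ hFΩ
  obtain ⟨M, hM⟩ := hCc.exists_bound_of_continuousOn (f := fun z : ℂ => z) continuousOn_id
  -- The quadratic term makes ψ strictly convex, which the distance to C alone is not; η is small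
  -- enough to keep C inside the sublevel set.
  set η : ℝ := ε / (M ^ 2 + 1)
  have hη : 0 < η := by positivity
  have hηM : η * M ^ 2 < ε := by
    simp only [η]
    rw [div_mul_eq_mul_div, div_lt_iff₀ (by positivity)]
    nlinarith
  set ψ : ℂ → ℝ := fun w => infDist w C + η * ‖w‖ ^ 2
  have hψc : Continuous ψ := by
    have := continuous_infDist_pt C
    fun_prop
  have hnear : ∀ w, ∃ p ∈ C, infDist w C = dist w p := fun w => hCc.exists_infDist_eq_dist hCne w
  have hψ : ∀ a b : ℝ, 0 ≤ a → 0 ≤ b → a + b = 1 → ∀ x y,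
      ψ (a • x + b • y) ≤ a * ψ x + b * ψ y - η * (a * b * ‖x - y‖ ^ 2) := by
    intro a b ha hb hab x y
    obtain ⟨p, hp, hxp⟩ := hnear x
    obtain ⟨q, hq, hyq⟩ := hnear y
    have h1 : infDist (a • x + b • y) C ≤ a * infDist x C + b * infDist y C := by
      refine (infDist_le_dist_of_mem (hCv hp hq ha hb hab)).trans ?_
      rw [hxp, hyq, dist_eq_norm, dist_eq_norm, dist_eq_norm,
        show a • x + b • y - (a • p + b • q) = a • (x - p) + b • (y - q) by module]
      refine (norm_add_le _ _).trans ?_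
      rw [norm_smul, norm_smul, Real.norm_of_nonneg ha, Real.norm_of_nonneg hb]
    simp only [ψ]
    rw [norm_sq_convex_comb hab]
    nlinarith
  have hcl : closure {w | ψ w < ε} ⊆ {w | ψ w ≤ ε} :=
    closure_minimal (fun w (hw : ψ w < ε) => show ψ w ≤ ε from hw.le) (isClosed_le hψc continuous_const)
  have hle : {w | ψ w ≤ ε} ⊆ cthickening ε C := by
    intro w hw
    obtain ⟨p, hp, hwp⟩ := hnear w
    refine mem_cthickening_of_dist_le w p ε C hp ?_
    rw [← hwp]
    have h1 : infDist w C + η * ‖w‖ ^ 2 ≤ ε := hw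
    have : 0 ≤ η * ‖w‖ ^ 2 := by positivity
    linarith
  refine ⟨{w | ψ w < ε}, isOpen_lt hψc continuous_const, ?_, ?_, ?_, ?_, hcl.trans (hle.trans hthick)⟩
  · intro x hx y hy a b ha hb hab
    have h1 := hψ a b ha hb hab x y
    have h2 : 0 ≤ η * (a * b * ‖x - y‖ ^ 2) := by positivity
    have hx' : ψ x < ε := hx
    have hy' : ψ y < ε := hy
    have h3 : a * ψ x + b * ψ y < ε := by
      rcases ha.lt_or_eq with h | h
      · nlinarith
      · have : b = 1 := by linarith
        rw [← h, this]; linarith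
    exact lt_of_le_of_lt h1 (by linarith)
  · exact hCc.isBounded.cthickening.subset (subset_closure.trans (hcl.trans hle))
  · intro x hx y hy hne
    have h1 := hψ (1 / 2) (1 / 2) (by norm_num) (by norm_num) (by norm_num) x y
    have h2 : 0 < η * (1 / 2 * (1 / 2) * ‖x - y‖ ^ 2) := by
      have := norm_pos_iff.2 (sub_ne_zero.2 hne)
      positivity
    have hx' : ψ x ≤ ε := hcl hx
    have hy' : ψ y ≤ ε := hcl hy
    exact lt_of_le_of_lt h1 (by linarith)
  · intro w hw
    have h1 : infDist w C = 0 := infDist_zero_of_mem (hKC hw)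
    have h2 : ‖w‖ ≤ M := hM w (hKC hw)
    change infDist w C + η * ‖w‖ ^ 2 < ε
    rw [h1, zero_add]
    refine lt_of_le_of_lt ?_ hηM
    gcongr

/-! ### Inverses -/

lemma continuousAt_invFunOn {f : ℂ → ℂ} {U : Set ℂ} (hU : IsOpen U) (hinj : InjOn f U) {z : ℂ}
    (hz : z ∈ U) (hmap : 𝓝 (f z) ≤ map f (𝓝 z)) :
    ContinuousAt (Function.invFunOn f U) (f z) := by
  have hinv := hinj.leftInvOn_invFunOn
  rw [ContinuousAt, hinv hz]
  refine Tendsto.mono_left ?_ hmap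
  rw [tendsto_map'_iff]
  refine tendsto_id.congr' ?_
  filter_upwards [hU.mem_nhds hz] with x hx using (hinv hx).symm

/-- The holomorphic case g = 0 of Lewy's theorem. -/
lemma deriv_ne_zero_of_injOn {ψ : ℂ → ℂ} {U : Set ℂ} (hU : IsOpen U) (hd : DifferentiableOn ℂ ψ U)
    (hinj : InjOn ψ U) {z : ℂ} (hz : z ∈ U) : deriv ψ z ≠ 0 := by
  have := norm_deriv_ne_of_injOn (g := fun _ => 0) (hU.mem_nhds hz)
    (hd.analyticAt (hU.mem_nhds hz)) analyticAt_const (by simpa using hinj)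
  simpa using this

lemma hasDerivAt_invFunOn {ψ : ℂ → ℂ} {U : Set ℂ} (hU : IsOpen U) (hd : DifferentiableOn ℂ ψ U)
    (hinj : InjOn ψ U) {z : ℂ} (hz : z ∈ U) :
    HasDerivAt (Function.invFunOn ψ U) (deriv ψ z)⁻¹ (ψ z) := by
  have hne := deriv_ne_zero_of_injOn hU hd hinj hz
  have hstrict := (hd.analyticAt (hU.mem_nhds hz)).hasStrictDerivAt
  have hmap := hstrict.map_nhds_eq hne
  have hinv := hinj.leftInvOn_invFunOn
  have hcont := continuousAt_invFunOn hU hinj hz hmap.ge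
  refine HasDerivAt.of_local_left_inverse (f := ψ) hcont ?_ hne ?_
  · rw [hinv hz]; exact hstrict.hasDerivAt
  · rw [← hmap, eventually_map]
    filter_upwards [hU.mem_nhds hz] with x hx
    rw [hinv hx]

/-! ### Harmonic mappings `h + conj g` -/

/-- The harmonic mapping `h + conj g`. -/
noncomputable def harm (h g : ℂ → ℂ) (z : ℂ) : ℂ := h z + (starRingEnd ℂ) (g z)

/-- The real-linear map `v ↦ a v + conj (b v)`. -/
noncomputable def harmLin (a b : ℂ) : ℂ →L[ℝ] ℂ :=
  (ContinuousLinearMap.toSpanSingleton ℂ a).restrictScalars ℝ +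
    (conjCLE : ℂ →L[ℝ] ℂ) ∘L ((ContinuousLinearMap.toSpanSingleton ℂ b).restrictScalars ℝ)

lemma harmLin_apply (a b v : ℂ) : harmLin a b v = v * a + (starRingEnd ℂ) (v * b) := by
  simp [harmLin]

lemma det_harmLin (a b : ℂ) : (harmLin a b).det = ‖a‖ ^ 2 - ‖b‖ ^ 2 := by
  rw [det_eq_re_im, harmLin_apply, harmLin_apply, ← normSq_eq_norm_sq, ← normSq_eq_norm_sq,
    normSq_apply, normSq_apply]
  simp
  ring

lemma hasStrictFDerivAt_harm {h g : ℂ → ℂ} {z : ℂ} (hh : AnalyticAt ℂ h z) (hg : AnalyticAt ℂ g z) :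
    HasStrictFDerivAt (harm h g) (harmLin (deriv h z) (deriv g z)) z := by
  have h1 : HasStrictFDerivAt h ((ContinuousLinearMap.toSpanSingleton ℂ (deriv h z)).restrictScalars ℝ)
    z := hh.hasStrictDerivAt.hasStrictFDerivAt.restrictScalars ℝ
  have h2 : HasStrictFDerivAt g ((ContinuousLinearMap.toSpanSingleton ℂ (deriv g z)).restrictScalars ℝ)
    z := hg.hasStrictDerivAt.hasStrictFDerivAt.restrictScalars ℝ
  exact h1.add ((conjCLE : ℂ →L[ℝ] ℂ).hasStrictFDerivAt.comp z h2)

/-- The real differential is invertible, so the inverse function theorem gives openness, and later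
continuity of the inverse of an injective harmonic map. -/
lemma nhds_le_map_harm {h g : ℂ → ℂ} {z : ℂ} (hh : AnalyticAt ℂ h z) (hg : AnalyticAt ℂ g z)
    (hne : ‖deriv h z‖ ≠ ‖deriv g z‖) : 𝓝 (harm h g z) ≤ map (harm h g) (𝓝 z) := by
  have hdet : (harmLin (deriv h z) (deriv g z)).det ≠ 0 := by
    rw [det_harmLin, sub_ne_zero]
    exact fun h' => hne ((pow_left_inj₀ (norm_nonneg _) (norm_nonneg _) two_ne_zero).1 h')
  have hs := hasStrictFDerivAt_harm hh hg
  rw [← ContinuousLinearMap.coe_toContinuousLinearEquivOfDetNeZero _ hdet] at hs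
  exact hs.map_nhds_eq_of_equiv.ge

/-- A self-map of the disk with derivative close to `1` at the fixed point `0` has small second
derivative there. -/
lemma norm_deriv_deriv_le_of_mapsTo {φ : ℂ → ℂ} (hd : DifferentiableOn ℂ φ disk)
    (hmaps : MapsTo φ disk disk) (h0 : φ 0 = 0) :
    ‖deriv (deriv φ) 0‖ ≤ 4 * (1 - ‖deriv φ 0‖) := by
  set k : ℂ → ℂ := dslope φ 0
  have hk : DifferentiableOn ℂ k disk :=
    (differentiableOn_dslope (isOpen_ball.mem_nhds zero_mem_disk)).2 hd
  have hk1 : ∀ z ∈ disk, ‖k z‖ ≤ 1 := by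
    intro z hz
    have := norm_dslope_le_div_of_mapsTo_ball hd (R₂ := 1) (by
      intro x hx; rw [h0]; exact ball_subset_closedBall (hmaps hx)) hz
    simpa using this
  have hk0 : k 0 = deriv φ 0 := dslope_same _ _
  have hφk : ∀ z, φ z = z * k z := by
    intro z
    have := sub_smul_dslope φ 0 z
    rw [h0, sub_zero, sub_zero, smul_eq_mul] at this
    exact this.symm
  have hkd : ∀ z ∈ disk, HasDerivAt k (deriv k z) z := fun z hz =>
    (hk.differentiableAt (isOpen_ball.mem_nhds hz)).hasDerivAt
  have hd1 : ∀ z ∈ disk, deriv φ z = k z + z * deriv k z := by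
    intro z hz
    have := (hasDerivAt_id' z).fun_mul (hkd z hz)
    rw [show φ = fun z => z * k z from funext hφk, this.deriv]; ring
  have hd2 : deriv (deriv φ) 0 = 2 * deriv k 0 := by
    have hev : deriv φ =ᶠ[𝓝 0] fun z => k z + z * deriv k z := by
      filter_upwards [isOpen_ball.mem_nhds zero_mem_disk] with z hz using hd1 z hz
    rw [hev.deriv_eq]
    have hk' := ((hk.deriv isOpen_ball).differentiableAt
      (isOpen_ball.mem_nhds zero_mem_disk)).hasDerivAt
    have := (hkd 0 zero_mem_disk).fun_add ((hasDerivAt_id' (0 : ℂ)).fun_mul hk')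
    rw [this.deriv]; ring
  -- Rotating k(0) to |k(0)| makes 1 - c k a function of nonnegative real part with value 1 - |k(0)|
  -- at 0, and Carathéodory's inequality bounds k'(0) = φ''(0)/2.
  obtain ⟨c, hc, hck⟩ : ∃ c : ℂ, ‖c‖ = 1 ∧ c * k 0 = ‖k 0‖ := by
    refine ⟨exp (-arg (k 0) * I), ?_, ?_⟩
    · have := norm_exp_ofReal_mul_I (-arg (k 0)); push_cast at this; exact this
    · conv_lhs => rw [← norm_mul_exp_arg_mul_I (k 0)]
      rw [mul_left_comm, norm_mul_exp_arg_mul_I, ← exp_add]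
      simp
  have hp := norm_deriv_le_two_mul_re (p := fun z => 1 - c * k z) ((hk.const_mul c).const_sub 1) (by
    intro z hz
    have h1 : (c * k z).re ≤ 1 := (re_le_norm _).trans (by rw [norm_mul, hc, one_mul]; exact hk1 z hz)
    simp only [sub_re, one_re]; linarith)
  have hpd : deriv (fun z => 1 - c * k z) 0 = -(c * deriv k 0) :=
    (((hkd 0 zero_mem_disk).const_mul c).const_sub 1).deriv
  rw [hpd, norm_neg, norm_mul, hc, one_mul, hck] at hp
  simp only [sub_re, one_re, ofReal_re] at hp
  rw [hd2, norm_mul, ← hk0]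
  simp only [Complex.norm_ofNat]
  linarith

end HarmonicMapping


namespace HarmonicMapping
open Complex Set Metric Filter Topology

/-! ### The second coefficient of a convex harmonic mapping -/

section
variable {h g : ℂ → ℂ}

lemma continuousOn_harm (hh : DifferentiableOn ℂ h disk) (hg : DifferentiableOn ℂ g disk) :
    ContinuousOn (harm h g) disk :=
  hh.continuousOn.add (continuous_conj.comp_continuousOn hg.continuousOn)

lemma nhds_le_map_harm_of_injOn (hh : DifferentiableOn ℂ h disk) (hg : DifferentiableOn ℂ g disk)
    (hinj : InjOn (harm h g) disk) {z : ℂ} (hz : z ∈ disk) :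
    𝓝 (harm h g z) ≤ map (harm h g) (𝓝 z) := by
  have hn := isOpen_ball.mem_nhds hz
  exact nhds_le_map_harm (hh.analyticAt hn) (hg.analyticAt hn)
    (norm_deriv_ne_of_injOn hn (hh.analyticAt hn) (hg.analyticAt hn) hinj)

lemma isOpen_image_harm (hh : DifferentiableOn ℂ h disk) (hg : DifferentiableOn ℂ g disk)
    (hinj : InjOn (harm h g) disk) : IsOpen (harm h g '' disk) := by
  rw [isOpen_iff_mem_nhds]
  rintro _ ⟨z, hz, rfl⟩
  exact nhds_le_map_harm_of_injOn hh hg hinj hz (image_mem_map (isOpen_ball.mem_nhds hz))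

lemma continuousOn_invFunOn_harm (hh : DifferentiableOn ℂ h disk) (hg : DifferentiableOn ℂ g disk)
    (hinj : InjOn (harm h g) disk) :
    ContinuousOn (Function.invFunOn (harm h g) disk) (harm h g '' disk) := by
  rintro _ ⟨z, hz, rfl⟩
  exact (continuousAt_invFunOn isOpen_ball hinj hz
    (nhds_le_map_harm_of_injOn hh hg hinj hz)).continuousWithinAt

lemma deriv_deriv_comp {φ : ℂ → ℂ} (hh : DifferentiableOn ℂ h disk)
    (hφ : DifferentiableOn ℂ φ disk) (hmaps : MapsTo φ disk disk) {z : ℂ} (hz : z ∈ disk) :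
    deriv (h ∘ φ) z = deriv h (φ z) * deriv φ z ∧
    deriv (deriv (h ∘ φ)) z =
      deriv (deriv h) (φ z) * deriv φ z ^ 2 + deriv h (φ z) * deriv (deriv φ) z := by
  have hd : ∀ {k : ℂ → ℂ}, DifferentiableOn ℂ k disk → ∀ w ∈ disk, HasDerivAt k (deriv k w) w :=
    fun hk w hw => (hk.differentiableAt (isOpen_ball.mem_nhds hw)).hasDerivAt
  have h1 : ∀ w ∈ disk, deriv (h ∘ φ) w = deriv h (φ w) * deriv φ w := fun w hw =>
    ((hd hh _ (hmaps hw)).comp w (hd hφ w hw)).deriv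
  refine ⟨h1 z hz, ?_⟩
  have hev : deriv (h ∘ φ) =ᶠ[𝓝 z] fun w => deriv h (φ w) * deriv φ w := by
    filter_upwards [isOpen_ball.mem_nhds hz] with w hw using h1 w hw
  rw [hev.deriv_eq]
  have h2 := ((hd (hh.deriv isOpen_ball) _ (hmaps hz)).comp z (hd hφ z hz)).fun_mul
    (hd (hφ.deriv isOpen_ball) z hz)
  simp only [Function.comp_apply] at h2
  rw [h2.deriv]; ring

/-- An approximate form of |h''(0)| - |g''(0)| ≤ 2|h'(0)|, obtained from `exists_direction` for f ∘
φ, with φ a Riemann map onto the preimage of a strictly convex Ω. Here ρ = |φ'(0)|, and the last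
term pays for φ''(0). -/
lemma exists_coeff_bound (hh : DifferentiableOn ℂ h disk) (hg : DifferentiableOn ℂ g disk)
    (hinj : InjOn (harm h g) disk) (hconv : Convex ℝ (harm h g '' disk)) (hg0 : deriv g 0 = 0)
    {r : ℝ} (hr0 : 0 < r) (hr1 : r < 1) :
    ∃ ρ, r ≤ ρ ∧ ρ ≤ 1 ∧ ρ ^ 2 * (‖deriv (deriv h) 0‖ - ‖deriv (deriv g) 0‖) ≤
      2 * (ρ * ‖deriv h 0‖) + 4 * (1 - ρ) * ‖deriv h 0‖ := by
  set f := harm h g with hf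
  set Ψ := Function.invFunOn f disk
  have hfc : ContinuousOn f disk := continuousOn_harm hh hg
  have hΨf : ∀ z ∈ disk, Ψ (f z) = z := fun z hz => hinj.leftInvOn_invFunOn hz
  have hfΨ : ∀ w ∈ f '' disk, f (Ψ w) = w := fun w hw => Function.invFunOn_eq hw
  have hΨm : ∀ w ∈ f '' disk, Ψ w ∈ disk := fun w hw => Function.invFunOn_mem hw
  have hΨc : ContinuousOn Ψ (f '' disk) := continuousOn_invFunOn_harm hh hg hinj
  have hrd : closedBall (0 : ℂ) r ⊆ disk := closedBall_subset_ball hr1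
  obtain ⟨Ω, hΩo, hΩc, hΩb, hΩr, hKΩ, hclΩ⟩ := exists_isRotund (isOpen_image_harm hh hg hinj) hconv
    ((isCompact_closedBall (0 : ℂ) r).image_of_continuousOn (hfc.mono hrd))
    ⟨f 0, mem_image_of_mem f (mem_closedBall_self hr0.le)⟩ (image_mono hrd)
  have hΩf : Ω ⊆ f '' disk := subset_closure.trans hclΩ
  set U := disk ∩ f ⁻¹' Ω
  have hUo : IsOpen U := hfc.isOpen_inter_preimage isOpen_ball hΩo
  have hrU : closedBall (0 : ℂ) r ⊆ U := fun z hz => ⟨hrd hz, hKΩ (mem_image_of_mem f hz)⟩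
  have h0U : (0 : ℂ) ∈ U := hrU (mem_closedBall_self hr0.le)
  have hΨU : ∀ w ∈ Ω, Ψ w ∈ U := fun w hw => ⟨hΨm w (hΩf hw), by
    change f (Ψ w) ∈ Ω
    rwa [hfΨ w (hΩf hw)]⟩
  have hUsc : IsSimplyConnected U := by
    let e : U ≃ₜ Ω :=
      { toFun := fun z => ⟨f z, z.2.2⟩
        invFun := fun w => ⟨Ψ w, hΨU w w.2⟩
        left_inv := fun z => Subtype.ext (hΨf z z.2.1)
        right_inv := fun w => Subtype.ext (hfΨ w (hΩf w.2))
        continuous_toFun := ((hfc.mono inter_subset_left).domRestrict).subtype_mk _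
        continuous_invFun := ((hΨc.mono hΩf).domRestrict).subtype_mk _ }
    have : ContractibleSpace Ω := hΩc.contractibleSpace ⟨f 0, h0U.2⟩
    have : ContractibleSpace U := e.contractibleSpace
    exact (inferInstance : SimplyConnectedSpace U)
  obtain ⟨ψ, hψd, hψb, hψ0⟩ := exists_bijOn_ball hUo hUsc inter_subset_left h0U
  set φ := Function.invFunOn ψ U
  have hψφ : ∀ z ∈ disk, ψ (φ z) = z := fun z hz => Function.invFunOn_eq (hψb.surjOn hz)
  have hφU : ∀ z ∈ disk, φ z ∈ U := fun z hz => Function.invFunOn_mem (hψb.surjOn hz)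
  have hφψ : ∀ z ∈ U, φ (ψ z) = z := fun z hz => hψb.injOn.leftInvOn_invFunOn hz
  have hφ' : ∀ z ∈ U, HasDerivAt φ (deriv ψ z)⁻¹ (ψ z) := fun z hz =>
    hasDerivAt_invFunOn hUo hψd hψb.injOn hz
  have hφd : DifferentiableOn ℂ φ disk := fun z hz => by
    have := hφ' _ (hφU z hz)
    rw [hψφ z hz] at this
    exact this.differentiableAt.differentiableWithinAt
  have hφi : InjOn φ disk := fun x hx y hy hxy => by rw [← hψφ x hx, hxy, hψφ y hy]
  have hφm : MapsTo φ disk disk := fun z hz => (hφU z hz).1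
  have hφ0 : φ 0 = 0 := by rw [← hψ0, hφψ 0 h0U, hψ0]
  have hφ'0 : deriv φ 0 = (deriv ψ 0)⁻¹ := by
    have := (hφ' 0 h0U).deriv
    rwa [hψ0] at this
  have hψ'0 : ‖deriv ψ 0‖ ≤ 1 / r := by
    refine norm_deriv_le_div_of_mapsTo_ball (hψd.mono (ball_subset_closedBall.trans hrU)) ?_ hr0
    intro z hz
    rw [hψ0]
    exact ball_subset_closedBall (hψb.mapsTo (hrU (ball_subset_closedBall hz)))
  have hρr : r ≤ ‖deriv φ 0‖ := by
    have hne := deriv_ne_zero_of_injOn hUo hψd hψb.injOn h0U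
    rw [hφ'0, norm_inv, le_inv_comm₀ hr0 (norm_pos_iff.2 hne), ← one_div]
    exact hψ'0
  have hρ1 : ‖deriv φ 0‖ ≤ 1 := by
    have := norm_deriv_le_div_of_mapsTo_ball (R₁ := 1) (R₂ := 1) hφd
      (by rw [hφ0]; exact hφm.mono_right ball_subset_closedBall) one_pos
    simpa using this
  have hφ'' := norm_deriv_deriv_le_of_mapsTo hφd hφm hφ0
  have hparam : IsConvexParam Ω (f ∘ φ) (ψ ∘ Ψ) :=
    { isOpen := hΩo
      convex := hΩc
      bounded := hΩb
      mapsTo := fun z hz => (hφU z hz).2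
      mapsTo_inv := fun w hw => hψb.mapsTo (hΨU w hw)
      left_inv := fun z hz => by
        simp only [Function.comp_apply]
        rw [hΨf _ (hφm hz), hψφ z hz]
      right_inv := fun w hw => by
        simp only [Function.comp_apply]
        rw [hφψ _ (hΨU w hw), hfΨ w (hΩf hw)]
      continuousOn := hfc.comp hφd.continuousOn hφm
      continuousOn_inv := hψd.continuousOn.comp (hΨc.mono hΩf) hΨU }
  have hclc : IsCompact (closure Ω) := hΩb.isCompact_closure
  -- The values of φ lie in the preimage of the closure of Ω, a compact subset of the disk on which
  -- f is uniformly continuous, so small oscillation passes from φ to f ∘ φ.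
  have harcs : HasSmallArcs (f ∘ φ) := by
    intro θ hθ ε hε δ hδ
    have hC : IsCompact (Ψ '' closure Ω) := hclc.image_of_continuousOn (hΨc.mono hclΩ)
    have hCd : Ψ '' closure Ω ⊆ disk := by
      rintro _ ⟨w, hw, rfl⟩
      exact hΨm w (hclΩ hw)
    have hUC : ∀ z ∈ U, z ∈ Ψ '' closure Ω := fun z hz => ⟨f z, subset_closure hz.2, hΨf z hz.1⟩
    have huc := hC.uniformContinuousOn_of_continuous (hfc.mono hCd)
    obtain ⟨η, hη, hηf⟩ := Metric.uniformContinuousOn_iff.1 huc ε hε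
    obtain ⟨s, hs0, hsδ, hs⟩ := exists_small_oscillation hφd hφi hφm hθ (half_pos hη) hδ
    refine ⟨s, hs0, hsδ, fun z hz z' hz' h1 h2 => ?_⟩
    have := hηf _ (hUC _ (hφU z hz)) _ (hUC _ (hφU z' hz')) (by
      rw [dist_eq_norm]
      exact (hs z hz z' hz' h1 h2).trans_lt (half_lt_self hη))
    rw [dist_eq_norm] at this
    exact this.le
  have hΨG : EqOn (fun z => Ψ ((f ∘ φ) z)) φ disk := fun z hz => hΨf _ (hφm hz)
  obtain ⟨l, hl, hbd⟩ := exists_direction hparam harcs hΩr (hΨc.mono hclΩ) (hφd.congr hΨG)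
    (hφi.congr hΨG.symm) (hh.comp hφd hφm) (hg.comp hφd hφm) (fun z _ => rfl)
  obtain ⟨e1, e2⟩ := deriv_deriv_comp hh hφd hφm zero_mem_disk
  obtain ⟨e3, e4⟩ := deriv_deriv_comp hg hφd hφm zero_mem_disk
  rw [e1, e2, e3, e4, hφ0, hg0] at hbd
  refine ⟨‖deriv φ 0‖, hρr, hρ1, ?_⟩
  set ρ := ‖deriv φ 0‖
  have hlc : ‖(starRingEnd ℂ) l‖ = 1 := by rw [RCLike.norm_conj, hl]
  simp only [zero_mul, mul_zero, add_zero] at hbd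
  rw [norm_mul, norm_mul, hl, one_mul] at hbd
  have t1 := norm_sub_le
    (l * (deriv (deriv h) 0 * deriv φ 0 ^ 2 + deriv h 0 * deriv (deriv φ) 0) +
      (starRingEnd ℂ) l * (deriv (deriv g) 0 * deriv φ 0 ^ 2))
    ((starRingEnd ℂ) l * (deriv (deriv g) 0 * deriv φ 0 ^ 2) + l * (deriv h 0 * deriv (deriv φ) 0))
  have t2 := norm_add_le ((starRingEnd ℂ) l * (deriv (deriv g) 0 * deriv φ 0 ^ 2))
    (l * (deriv h 0 * deriv (deriv φ) 0))
  rw [show l * (deriv (deriv h) 0 * deriv φ 0 ^ 2 + deriv h 0 * deriv (deriv φ) 0) +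
      (starRingEnd ℂ) l * (deriv (deriv g) 0 * deriv φ 0 ^ 2) -
      ((starRingEnd ℂ) l * (deriv (deriv g) 0 * deriv φ 0 ^ 2) +
        l * (deriv h 0 * deriv (deriv φ) 0)) = l * (deriv (deriv h) 0 * deriv φ 0 ^ 2) by ring] at t1
  simp only [norm_mul, norm_pow, hl, hlc, one_mul] at t1 t2
  have t3 := mul_le_mul_of_nonneg_left hφ'' (norm_nonneg (deriv h 0))
  nlinarith

/-- By Lewy's theorem the two moduli never meet, and the disk is connected. -/
lemma norm_deriv_lt_of_injOn (hh : DifferentiableOn ℂ h disk) (hg : DifferentiableOn ℂ g disk)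
    (hinj : InjOn (harm h g) disk) {z₀ : ℂ} (hz₀ : z₀ ∈ disk) (h0 : ‖deriv g z₀‖ < ‖deriv h z₀‖)
    {z : ℂ} (hz : z ∈ disk) : ‖deriv g z‖ < ‖deriv h z‖ := by
  by_contra! hle
  have hcg := (hg.deriv isOpen_ball).continuousOn.norm
  have hch := (hh.deriv isOpen_ball).continuousOn.norm
  obtain ⟨w, hw, hw'⟩ := (convex_ball (0 : ℂ) 1).isPreconnected.intermediate_value₂ hz₀ hz hcg hch
    h0.le hle
  have hn := isOpen_ball.mem_nhds hw
  exact norm_deriv_ne_of_injOn hn (hh.analyticAt hn) (hg.analyticAt hn) hinj hw'.symm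

/-- The second coefficient of a convex harmonic mapping whose co-analytic part is stationary at
the origin. -/
theorem norm_deriv_deriv_le_three_mul (hh : DifferentiableOn ℂ h disk)
    (hg : DifferentiableOn ℂ g disk) (hinj : InjOn (harm h g) disk)
    (hconv : Convex ℝ (harm h g '' disk)) (hg0 : deriv g 0 = 0) :
    ‖deriv (deriv h) 0‖ ≤ 3 * ‖deriv h 0‖ := by
  have h1 : ‖deriv (deriv h) 0‖ - ‖deriv (deriv g) 0‖ ≤ 2 * ‖deriv h 0‖ := by
    set A := ‖deriv (deriv h) 0‖ - ‖deriv (deriv g) 0‖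
    set B := ‖deriv h 0‖
    have hB : 0 ≤ B := norm_nonneg _
    -- When A > 0, the unknown ρ ≥ r can be replaced by r on the left and estimated away on the
    -- right; then r → 1.
    by_cases hA : A ≤ 0
    · linarith
    have key : ∀ r ∈ Ioo (0 : ℝ) 1, r ^ 2 * A ≤ 2 * B + 4 * (1 - r) * B := by
      rintro r ⟨hr0, hr1⟩
      obtain ⟨ρ, hρ, hρ1, hb⟩ := exists_coeff_bound hh hg hinj hconv hg0 hr0 hr1
      have e1 : r ^ 2 * A ≤ ρ ^ 2 * A := by gcongr; exact (not_le.1 hA).le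
      have e2 : ρ * B ≤ 1 * B := by gcongr
      have e3 : (1 - ρ) * B ≤ (1 - r) * B := by gcongr
      calc _ ≤ _ := e1
        _ ≤ _ := hb
        _ ≤ _ := by linarith
    have hl : Tendsto (fun r : ℝ => r ^ 2 * A) (𝓝[<] 1) (𝓝 (1 ^ 2 * A)) :=
      (Continuous.tendsto (by fun_prop) 1).mono_left nhdsWithin_le_nhds
    have hr : Tendsto (fun r : ℝ => 2 * B + 4 * (1 - r) * B) (𝓝[<] 1)
        (𝓝 (2 * B + 4 * (1 - 1) * B)) :=
      (Continuous.tendsto (f := fun r : ℝ => 2 * B + 4 * (1 - r) * B) (by fun_prop) 1).mono_left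
        nhdsWithin_le_nhds
    have := le_of_tendsto_of_tendsto hl hr (by
      filter_upwards [Ioo_mem_nhdsLT (zero_lt_one' ℝ)] with r hr using key r hr)
    linarith
  have hn0 := isOpen_ball.mem_nhds zero_mem_disk
  have hne := norm_deriv_ne_of_injOn hn0 (hh.analyticAt hn0) (hg.analyticAt hn0) hinj
  rw [hg0, norm_zero] at hne
  have hlt : ∀ z ∈ disk, ‖deriv g z‖ < ‖deriv h z‖ := fun z hz =>
    norm_deriv_lt_of_injOn hh hg hinj zero_mem_disk (by
      rw [hg0, norm_zero]; exact lt_of_le_of_ne (norm_nonneg _) hne.symm) hz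
  have hh0 : ∀ z ∈ disk, deriv h z ≠ 0 := fun z hz =>
    norm_pos_iff.1 ((norm_nonneg _).trans_lt (hlt z hz))
  have h2 : ‖deriv (deriv g) 0‖ ≤ ‖deriv h 0‖ := by
    -- The dilatation fixes 0, so the Schwarz lemma gives |ω'(0)| = |g''(0)|/|h'(0)| ≤ 1.
    set ω : ℂ → ℂ := fun z => deriv g z / deriv h z
    have hω : DifferentiableOn ℂ ω disk :=
      (hg.deriv isOpen_ball).div (hh.deriv isOpen_ball) hh0
    have hω0 : ω 0 = 0 := by simp [ω, hg0]
    have hωm : MapsTo ω (ball 0 1) (ball (ω 0) 1) := by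
      intro z hz
      rw [hω0, mem_ball_zero_iff, norm_div, div_lt_one (norm_pos_iff.2 (hh0 z hz))]
      exact hlt z hz
    have hs := norm_deriv_le_div_of_mapsTo_ball hω (hωm.mono_right ball_subset_closedBall) one_pos
    have hd := (((hg.deriv isOpen_ball).differentiableAt hn0).hasDerivAt.fun_div
      ((hh.deriv isOpen_ball).differentiableAt hn0).hasDerivAt (hh0 0 zero_mem_disk)).deriv
    have hpos := norm_pos_iff.2 (hh0 0 zero_mem_disk)
    rw [hd, hg0, zero_mul, sub_zero, norm_div, norm_mul, norm_pow, div_one,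
      div_le_iff₀ (by positivity), one_mul, pow_two] at hs
    exact le_of_mul_le_mul_right hs hpos
  linarith

end

end HarmonicMapping


namespace HarmonicMapping
open Complex Set Metric Filter Topology

/-! ### The pre-Schwarzian derivative of `h + conj g` -/

/-- Real and imaginary parts of f are real parts of analytic F and K on the disk; then h = (F +
iK)/2 and g = (F - iK)/2. -/
lemma exists_eqOn_harm {f : ℂ → ℂ} (hf : InnerProductSpace.HarmonicOnNhd f disk) :
    ∃ h g : ℂ → ℂ, DifferentiableOn ℂ h disk ∧ DifferentiableOn ℂ g disk ∧
      EqOn f (harm h g) disk := by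
  obtain ⟨F, hF, hFr⟩ := (hf.comp_CLM reCLM).exists_analyticOnNhd_ball_re_eq
  obtain ⟨K, hK, hKi⟩ := (hf.comp_CLM imCLM).exists_analyticOnNhd_ball_re_eq
  have hF' := hF.differentiableOn
  have hK' := hK.differentiableOn
  refine ⟨fun z => (F z + I * K z) / 2, fun z => (F z - I * K z) / 2,
    (hF'.add (hK'.const_mul I)).div_const 2, (hF'.sub (hK'.const_mul I)).div_const 2,
    fun z hz => ?_⟩
  have h1 : (F z).re = (f z).re := hFr hz
  have h2 : (K z).re = (f z).im := hKi hz
  have h3 : (starRingEnd ℂ) (2 : ℂ) = 2 := conj_ofNat 2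
  simp only [harm, map_div₀, map_sub, map_mul, conj_I, h3]
  apply Complex.ext
  · simp [← h1]; ring
  · simp [← h2]; ring

section
variable {f h g : ℂ → ℂ}

lemma jacobian_eq (hh : DifferentiableOn ℂ h disk) (hg : DifferentiableOn ℂ g disk)
    (hf : EqOn f (harm h g) disk) {z : ℂ} (hz : z ∈ disk) :
    jacobian f z = ‖deriv h z‖ ^ 2 - ‖deriv g z‖ ^ 2 := by
  have hn := isOpen_ball.mem_nhds hz
  have hev : f =ᶠ[𝓝 z] harm h g := hf.eventuallyEq_of_mem hn
  rw [jacobian, hev.fderiv_eq,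
    (hasStrictFDerivAt_harm (hh.analyticAt hn) (hg.analyticAt hn)).hasFDerivAt.fderiv, det_harmLin]

lemma preSchwarzian_eq (hh : DifferentiableOn ℂ h disk) (hg : DifferentiableOn ℂ g disk)
    (hf : EqOn f (harm h g) disk) {z : ℂ} (hz : z ∈ disk) (hne : ‖deriv h z‖ ≠ ‖deriv g z‖) :
    preSchwarzian f z = (deriv (deriv h) z * (starRingEnd ℂ) (deriv h z) -
      deriv (deriv g) z * (starRingEnd ℂ) (deriv g z)) /
        ((‖deriv h z‖ ^ 2 - ‖deriv g z‖ ^ 2 : ℝ) : ℂ) := by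
  have hn := isOpen_ball.mem_nhds hz
  have hJ0 : ‖deriv h z‖ ^ 2 - ‖deriv g z‖ ^ 2 ≠ 0 := by
    rw [sub_ne_zero]
    exact fun h' => hne ((pow_left_inj₀ (norm_nonneg _) (norm_nonneg _) two_ne_zero).1 h')
  have hd : ∀ {k : ℂ → ℂ}, DifferentiableOn ℂ k disk → HasFDerivAt (deriv k)
      ((ContinuousLinearMap.toSpanSingleton ℂ (deriv (deriv k) z)).restrictScalars ℝ) z :=
    fun hk => ((hk.deriv isOpen_ball).differentiableAt hn).hasDerivAt.hasFDerivAt.restrictScalars ℝ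
  have hJ := (((hd hh).norm_sq.sub (hd hg).norm_sq).log hJ0)
  have hJc := ofRealCLM.hasFDerivAt.comp z hJ
  have hev : (fun w => ((Real.log |jacobian f w| : ℝ) : ℂ)) =ᶠ[𝓝 z]
      ofRealCLM ∘ fun w => Real.log (‖deriv h w‖ ^ 2 - ‖deriv g w‖ ^ 2) := by
    filter_upwards [hn] with w hw
    rw [jacobian_eq hh hg hf hw, Real.log_abs]
    rfl
  rw [preSchwarzian, wirtinger, hev.fderiv_eq]
  have hfd : ∀ v, fderiv ℝ (ofRealCLM ∘ fun w => Real.log (‖deriv h w‖ ^ 2 - ‖deriv g w‖ ^ 2)) z v =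
      (((‖deriv h z‖ ^ 2 - ‖deriv g z‖ ^ 2)⁻¹ * (2 * inner ℝ (deriv h z) (v * deriv (deriv h) z) -
        2 * inner ℝ (deriv g z) (v * deriv (deriv g) z)) : ℝ) : ℂ) := by
    intro v
    refine (DFunLike.congr_fun hJc.fderiv v).trans ?_
    simp
    left; ring
  rw [hfd, hfd]
  have hJ0' : ((‖deriv h z‖ ^ 2 - ‖deriv g z‖ ^ 2 : ℝ) : ℂ) ≠ 0 := by exact_mod_cast hJ0
  rw [eq_div_iff hJ0', ofReal_mul, ofReal_mul, ofReal_inv,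
    show ∀ x y w : ℂ, w ≠ 0 → 1 / 2 * (w⁻¹ * x - I * (w⁻¹ * y)) * w = 1 / 2 * (x - I * y) by
      intro x y w hw; field_simp]
  · apply Complex.ext
    · simp; ring
    · simp; ring
  · exact hJ0'

/-- The growth estimate for the pre-Schwarzian derivative of a sense-preserving convex mapping. -/
lemma norm_preSchwarzian_le (hh : DifferentiableOn ℂ h disk) (hg : DifferentiableOn ℂ g disk)
    (hinj : InjOn (harm h g) disk) (hconv : Convex ℝ (harm h g '' disk)) {z₀ : ℂ} (hz₀ : z₀ ∈ disk)
    (hlt : ‖deriv g z₀‖ < ‖deriv h z₀‖) :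
    ‖(deriv (deriv h) z₀ * (starRingEnd ℂ) (deriv h z₀) -
      deriv (deriv g) z₀ * (starRingEnd ℂ) (deriv g z₀)) /
        ((‖deriv h z₀‖ ^ 2 - ‖deriv g z₀‖ ^ 2 : ℝ) : ℂ)‖ * (1 - ‖z₀‖ ^ 2) ≤ 5 := by
  have hz1 : ‖-z₀‖ < 1 := by rw [norm_neg]; exact mem_ball_zero_iff.1 hz₀
  -- T takes 0 to z₀; its second derivative at 0 is the source of the term 2 conj z₀.
  set T := mob (-z₀)
  have hTd : DifferentiableOn ℂ T disk := differentiableOn_mob hz1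
  have hTm : MapsTo T disk disk := mapsTo_mob hz1
  have hTi : InjOn T disk := fun x hx y hy hxy => by
    rw [← mob_neg_mob hz1 (mem_ball_zero_iff.1 hx), ← mob_neg_mob hz1 (mem_ball_zero_iff.1 hy)]
    exact congrArg _ hxy
  have hTs : T '' disk = disk := by
    refine hTm.image_subset.antisymm fun w hw => ⟨mob (- -z₀) w, ?_, ?_⟩
    · exact mapsTo_mob (by rwa [norm_neg]) hw
    · exact mob_mob_neg hz1 (mem_ball_zero_iff.1 hw)
  have hT0 : T 0 = z₀ := by simp [T, mob]
  set t : ℝ := 1 - ‖z₀‖ ^ 2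
  have hz2 : ‖z₀‖ < 1 := mem_ball_zero_iff.1 hz₀
  have ht : 0 < t := by
    have := norm_nonneg z₀
    simp only [t]; nlinarith
  have htc : 1 - (starRingEnd ℂ) (-z₀) * -z₀ = (t : ℂ) := by
    simp only [map_neg, neg_mul_neg, t]
    rw [mul_comm, mul_conj, normSq_eq_norm_sq]; push_cast; ring
  have hT' : ∀ z ∈ disk, deriv T z = t / (1 + (starRingEnd ℂ) z₀ * z) ^ 2 := by
    intro z hz
    rw [(hasDerivAt_mob hz1 (mem_ball_zero_iff.1 hz).le).deriv, htc]
    simp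
  have hT'0 : deriv T 0 = t := by rw [hT' 0 zero_mem_disk]; simp
  have hT''0 : deriv (deriv T) 0 = -2 * (starRingEnd ℂ) z₀ * t := by
    have hev : deriv T =ᶠ[𝓝 0] fun z => t / (1 + (starRingEnd ℂ) z₀ * z) ^ 2 := by
      filter_upwards [isOpen_ball.mem_nhds zero_mem_disk] with w hw using hT' w hw
    rw [hev.deriv_eq]
    have h1 : HasDerivAt (fun z : ℂ => (1 + (starRingEnd ℂ) z₀ * z) ^ 2)
        (2 * (1 + (starRingEnd ℂ) z₀ * 0) ^ 1 * ((starRingEnd ℂ) z₀ * 1)) 0 :=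
      (((hasDerivAt_id' (0 : ℂ)).const_mul ((starRingEnd ℂ) z₀)).const_add 1).fun_pow 2
    have h2 := (hasDerivAt_const (0 : ℂ) (t : ℂ)).fun_div h1 (by simp)
    rw [h2.deriv]; simp; ring
  have hHd : DifferentiableOn ℂ (h ∘ T) disk := hh.comp hTd hTm
  have hGd : DifferentiableOn ℂ (g ∘ T) disk := hg.comp hTd hTm
  obtain ⟨H1, H2⟩ := deriv_deriv_comp hh hTd hTm zero_mem_disk
  obtain ⟨G1, G2⟩ := deriv_deriv_comp hg hTd hTm zero_mem_disk
  rw [hT0, hT'0] at H1 G1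
  rw [hT0, hT'0, hT''0] at H2 G2
  set a := deriv h z₀
  set b := deriv g z₀
  set a₂ := deriv (deriv h) z₀
  set b₂ := deriv (deriv g) z₀
  have ha : a ≠ 0 := norm_pos_iff.1 ((norm_nonneg _).trans_lt hlt)
  have hac : (starRingEnd ℂ) a ≠ 0 := (map_ne_zero _).2 ha
  -- This c cancels the derivative at 0 of the new co-analytic part, and |c| < 1 keeps A injective.
  set c := (starRingEnd ℂ) (b / a)
  have hc : ‖c‖ < 1 := by
    rw [RCLike.norm_conj, norm_div, div_lt_one (norm_pos_iff.2 ha)]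
    exact hlt
  set A := harmLin 1 (-(starRingEnd ℂ) c)
  have hA : ∀ v, A v = v - c * (starRingEnd ℂ) v := fun v => by
    simp only [A, harmLin_apply]; simp; ring
  have hAi : Function.Injective A := by
    rw [injective_iff_map_eq_zero]
    intro v hv
    rw [hA, sub_eq_zero] at hv
    by_contra hv0
    have h1 := congrArg norm hv
    rw [norm_mul, RCLike.norm_conj v] at h1
    have := norm_pos_iff.2 hv0
    nlinarith
  have heq : ∀ z, harm (fun z => (h ∘ T) z - c * (g ∘ T) z)
      (fun z => (g ∘ T) z - (starRingEnd ℂ) c * (h ∘ T) z) z = A (harm h g (T z)) := by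
    intro z
    rw [hA]
    simp only [harm, Function.comp_apply, map_sub, map_add, map_mul, conj_conj]
    ring
  have himg : harm (fun z => (h ∘ T) z - c * (g ∘ T) z)
      (fun z => (g ∘ T) z - (starRingEnd ℂ) c * (h ∘ T) z) '' disk = A '' (harm h g '' disk) := by
    conv_rhs => rw [← hTs, image_image, image_image]
    exact image_congr fun z _ => heq z
  have hnd : ∀ {k : ℂ → ℂ}, DifferentiableOn ℂ k disk → ∀ w ∈ disk, HasDerivAt k (deriv k w) w :=
    fun hk w hw => (hk.differentiableAt (isOpen_ball.mem_nhds hw)).hasDerivAt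
  have hcomb : ∀ (u v : ℂ → ℂ) (e : ℂ), DifferentiableOn ℂ u disk → DifferentiableOn ℂ v disk →
      EqOn (deriv fun z => u z - e * v z) (fun z => deriv u z - e * deriv v z) disk := by
    intro u v e hu hv z hz
    exact ((hnd hu z hz).sub ((hnd hv z hz).const_mul e)).deriv
  have key := norm_deriv_deriv_le_three_mul (hHd.sub (hGd.const_mul c))
    (hGd.sub (hHd.const_mul ((starRingEnd ℂ) c)))
    (by
      intro x hx y hy hxy
      have hxy' := (heq x).symm.trans (hxy.trans (heq y))
      exact hTi hx hy (hinj (hTm hx) (hTm hy) (hAi hxy')))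
    (by
      have := hconv.linear_image (A : ℂ →ₗ[ℝ] ℂ)
      exact himg.symm ▸ this)
    (by
      refine (hcomb _ _ _ hGd hHd zero_mem_disk).trans ?_
      simp only [G1, H1, c, conj_conj]
      field_simp
      ring)
  have k1 : deriv (fun z => (h ∘ T) z - c * (g ∘ T) z) 0 = t * (a - c * b) := by
    refine (hcomb _ _ _ hHd hGd zero_mem_disk).trans ?_
    simp only [G1, H1]; ring
  have k2 : deriv (deriv fun z => (h ∘ T) z - c * (g ∘ T) z) 0 =
      t * (t * (a₂ - c * b₂) - 2 * (starRingEnd ℂ) z₀ * (a - c * b)) := by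
    have hev := (hcomb _ _ c hHd hGd).eventuallyEq_of_mem (isOpen_ball.mem_nhds zero_mem_disk)
    rw [hev.deriv_eq]
    refine (hcomb _ _ _ (hHd.deriv isOpen_ball) (hGd.deriv isOpen_ball) zero_mem_disk).trans ?_
    simp only [G2, H2]; ring
  have key' : ‖deriv (deriv fun z => (h ∘ T) z - c * (g ∘ T) z) 0‖ ≤
    3 * ‖deriv (fun z => (h ∘ T) z - c * (g ∘ T) z) 0‖ := key
  rw [k1, k2, norm_mul, norm_mul, norm_real, Real.norm_of_nonneg ht.le] at key'
  set J : ℝ := ‖a‖ ^ 2 - ‖b‖ ^ 2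
  have hJ : 0 < J := by
    have := norm_nonneg b
    simp only [J]; nlinarith
  have hJc : (J : ℂ) = a * (starRingEnd ℂ) a - b * (starRingEnd ℂ) b := by
    rw [mul_conj, mul_conj, normSq_eq_norm_sq, normSq_eq_norm_sq]; push_cast [J]; rfl
  have hJ0 : (J : ℂ) ≠ 0 := by exact_mod_cast hJ.ne'
  set X := a₂ * (starRingEnd ℂ) a - b₂ * (starRingEnd ℂ) b
  have e1 : a - c * b = J / (starRingEnd ℂ) a := by
    rw [hJc]; simp only [c, map_div₀]; field_simp
  have e2 : a₂ - c * b₂ = X / (starRingEnd ℂ) a := by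
    simp only [c, X, map_div₀]; field_simp
  rw [e1, e2, show t * (X / (starRingEnd ℂ) a) - 2 * (starRingEnd ℂ) z₀ * (J / (starRingEnd ℂ) a) =
    (t * (X / J) - 2 * (starRingEnd ℂ) z₀) * (J / (starRingEnd ℂ) a) by field_simp, norm_mul] at key'
  have hpos : 0 < ‖(J : ℂ) / (starRingEnd ℂ) a‖ := norm_pos_iff.2 (div_ne_zero hJ0 hac)
  have key2 : ‖(t : ℂ) * (X / J) - 2 * (starRingEnd ℂ) z₀‖ ≤ 3 := by
    refine le_of_mul_le_mul_right ?_ (mul_pos ht hpos)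
    linarith
  have key3 := norm_le_norm_add_norm_sub' ((t : ℂ) * (X / J)) (2 * (starRingEnd ℂ) z₀)
  rw [norm_mul, norm_mul, norm_real, Real.norm_of_nonneg ht.le, RCLike.norm_conj,
    Complex.norm_ofNat] at key3
  linarith

theorem IsConvexHarmonic.jacobian_ne_zero (hf : IsConvexHarmonic f) {z : ℂ} (hz : z ∈ disk) :
    jacobian f z ≠ 0 := by
  obtain ⟨h, g, hh, hg, hfe⟩ := exists_eqOn_harm hf.harmonic
  have hn := isOpen_ball.mem_nhds hz
  rw [jacobian_eq hh hg hfe hz, sub_ne_zero]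
  refine fun h' => norm_deriv_ne_of_injOn hn (hh.analyticAt hn) (hg.analyticAt hn)
    (hf.univalent.congr hfe) ((pow_left_inj₀ (norm_nonneg _) (norm_nonneg _) two_ne_zero).1 h')

theorem IsConvexHarmonic.preSchwarzianNorm_le (hf : IsConvexHarmonic f) :
    preSchwarzianNorm f ≤ 5 := by
  obtain ⟨h, g, hh, hg, hfe⟩ := exists_eqOn_harm hf.harmonic
  have hinj : InjOn (harm h g) disk := hf.univalent.congr hfe
  have hconv : Convex ℝ (harm h g '' disk) := hfe.image_eq ▸ hf.convex_image
  refine iSup₂_le fun z hz => ?_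
  have hn := isOpen_ball.mem_nhds hz
  have hne := norm_deriv_ne_of_injOn hn (hh.analyticAt hn) (hg.analyticAt hn) hinj
  rw [← ENNReal.ofReal_ofNat 5]
  refine ENNReal.ofReal_le_ofReal ?_
  rw [preSchwarzian_eq hh hg hfe hz hne]
  rcases hne.lt_or_gt with hlt | hlt
  -- Conjugating f exchanges h and g and reverses the signs of both numerator and denominator.
  · have hswap : ∀ z, harm g h z = conjCLE (harm h g z) := fun z => by
      simp [harm, add_comm]
    have himg : harm g h '' disk = conjCLE '' (harm h g '' disk) := by
      rw [image_image]; exact image_congr fun z _ => hswap z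
    have := norm_preSchwarzian_le hg hh
      (fun x hx y hy hxy => hinj hx hy (conjCLE.injective (by rw [← hswap, ← hswap, hxy])))
      (himg ▸ hconv.linear_image (conjCLE : ℂ →L[ℝ] ℂ).toLinearMap) hz hlt
    rw [← neg_div_neg_eq, neg_sub, ← ofReal_neg, neg_sub]
    exact this
  · exact norm_preSchwarzian_le hh hg hinj hconv hz hlt

end

end HarmonicMapping


namespace HarmonicMapping
open Complex Set Metric Filter Topology

/-! ### The half-plane mapping -/

lemma one_sub_ne_zero {z : ℂ} (hz : z ∈ disk) : 1 - z ≠ 0 := by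
  intro h
  rw [mem_ball_zero_iff, ← sub_eq_zero.1 h, norm_one] at hz
  exact lt_irrefl _ hz

/-- With w = 1/(1 - z) the two parts are (w² - 1)/2 and -(w - 1)²/2, and the disk becomes Re w >
1/2. There the map translates Re w and stretches each vertical line by 2 Re w - 1 > 0, so
injectivity and the image can be read off. -/
lemma halfPlaneMap_eq {z : ℂ} (hz : z ∈ disk) :
    halfPlaneMap z = ⟨((1 - z)⁻¹).re - 1, ((1 - z)⁻¹).im * (2 * ((1 - z)⁻¹).re - 1)⟩ := by
  have h0 := one_sub_ne_zero hz
  set w := (1 - z)⁻¹ with hw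
  have hw0 : w ≠ 0 := inv_ne_zero h0
  have h1 : (2 * z - z ^ 2) / (2 * (1 - z) ^ 2) = (w ^ 2 - 1) / 2 := by
    rw [hw]; field_simp; ring
  have h2 : -z ^ 2 / (2 * (1 - z) ^ 2) = -(w - 1) ^ 2 / 2 := by
    rw [hw]; field_simp; ring
  have h3 : (starRingEnd ℂ) (2 : ℂ) = 2 := conj_ofNat 2
  rw [halfPlaneMap, h1, h2]
  simp only [map_div₀, map_neg, map_pow, map_sub, map_one, h3]
  apply Complex.ext
  · simp [pow_two]; ring
  · simp [pow_two]; ring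

lemma mem_disk_iff_inv {w : ℂ} (hw : w ≠ 0) : 1 - w⁻¹ ∈ disk ↔ 1 / 2 < w.re := by
  have h1 : 1 - w⁻¹ = (w - 1) / w := by field_simp
  have h2 : ‖w - 1‖ ^ 2 = ‖w‖ ^ 2 - 2 * w.re + 1 := by
    rw [← normSq_eq_norm_sq, ← normSq_eq_norm_sq, normSq_apply, normSq_apply]
    simp; ring
  rw [mem_ball_zero_iff, h1, norm_div, div_lt_one (norm_pos_iff.2 hw),
    ← pow_lt_pow_iff_left₀ (norm_nonneg _) (norm_nonneg _) two_ne_zero, h2]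
  constructor <;> intro h <;> linarith

lemma half_lt_re_inv {z : ℂ} (hz : z ∈ disk) : 1 / 2 < ((1 - z)⁻¹).re := by
  rw [← mem_disk_iff_inv (inv_ne_zero (one_sub_ne_zero hz))]
  simpa using hz

lemma injOn_halfPlaneMap : InjOn halfPlaneMap disk := by
  intro x hx y hy hxy
  rw [halfPlaneMap_eq hx, halfPlaneMap_eq hy, Complex.mk.injEq] at hxy
  obtain ⟨h1, h2⟩ := hxy
  have h3 := half_lt_re_inv hx
  have hre : ((1 - x)⁻¹).re = ((1 - y)⁻¹).re := by linarith
  rw [← hre] at h2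
  have him := mul_right_cancel₀ (by linarith) h2
  have := inv_injective (Complex.ext hre him)
  exact sub_right_injective this

lemma image_halfPlaneMap : halfPlaneMap '' disk = {w : ℂ | -1 / 2 < w.re} := by
  apply Subset.antisymm
  · rintro _ ⟨z, hz, rfl⟩
    have := half_lt_re_inv hz
    rw [halfPlaneMap_eq hz]
    change -1 / 2 < ((1 - z)⁻¹).re - 1
    linarith
  · intro v hv
    have hv' : -1 / 2 < v.re := hv
    have hx : 2 * v.re + 1 ≠ 0 := by linarith
    set w : ℂ := ⟨v.re + 1, v.im / (2 * v.re + 1)⟩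
    have hw0 : w ≠ 0 := by
      intro h
      have : v.re + 1 = 0 := congrArg re h
      linarith
    have hd : 1 - w⁻¹ ∈ disk := (mem_disk_iff_inv hw0).2 (by simp only [w]; linarith)
    refine ⟨1 - w⁻¹, hd, ?_⟩
    rw [halfPlaneMap_eq hd, sub_sub_cancel, inv_inv]
    apply Complex.ext
    · simp [w]
    · simp only [w]
      rw [show 2 * (v.re + 1) - 1 = 2 * v.re + 1 by ring, div_mul_cancel₀ _ hx]

/-- The analytic part of the half-plane mapping. -/
noncomputable def halfPlaneAnalytic (z : ℂ) : ℂ := (2 * z - z ^ 2) / (2 * (1 - z) ^ 2)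

/-- The conjugate of the co-analytic part of the half-plane mapping. -/
noncomputable def halfPlaneCoanalytic (z : ℂ) : ℂ := -z ^ 2 / (2 * (1 - z) ^ 2)

lemma hasDerivAt_halfPlaneAnalytic {z : ℂ} (hz : z ∈ disk) :
    HasDerivAt halfPlaneAnalytic (1 / (1 - z) ^ 3) z := by
  have h0 := one_sub_ne_zero hz
  have hn : HasDerivAt (fun z : ℂ => 2 * z - z ^ 2) (2 * 1 - 2 * z ^ 1 * 1) z :=
    ((hasDerivAt_id' z).const_mul 2).fun_sub ((hasDerivAt_id' z).fun_pow 2)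
  have hd : HasDerivAt (fun z : ℂ => 2 * (1 - z) ^ 2) (2 * (2 * (1 - z) ^ 1 * -1)) z :=
    (((hasDerivAt_id' z).const_sub 1).fun_pow 2).const_mul 2
  convert! hn.fun_div hd (mul_ne_zero two_ne_zero (pow_ne_zero 2 h0)) using 1
  field_simp
  ring

lemma hasDerivAt_halfPlaneCoanalytic {z : ℂ} (hz : z ∈ disk) :
    HasDerivAt halfPlaneCoanalytic (-z / (1 - z) ^ 3) z := by
  have h0 := one_sub_ne_zero hz
  have hn : HasDerivAt (fun z : ℂ => -z ^ 2) (-(2 * z ^ 1 * 1)) z :=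
    ((hasDerivAt_id' z).fun_pow 2).fun_neg
  have hd : HasDerivAt (fun z : ℂ => 2 * (1 - z) ^ 2) (2 * (2 * (1 - z) ^ 1 * -1)) z :=
    (((hasDerivAt_id' z).const_sub 1).fun_pow 2).const_mul 2
  convert! hn.fun_div hd (mul_ne_zero two_ne_zero (pow_ne_zero 2 h0)) using 1
  field_simp
  ring

lemma deriv_deriv_halfPlaneAnalytic {z : ℂ} (hz : z ∈ disk) :
    deriv (deriv halfPlaneAnalytic) z = 3 / (1 - z) ^ 4 := by
  have h0 := one_sub_ne_zero hz
  have hev : deriv halfPlaneAnalytic =ᶠ[𝓝 z] fun z => 1 / (1 - z) ^ 3 := by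
    filter_upwards [isOpen_ball.mem_nhds hz] with w hw using (hasDerivAt_halfPlaneAnalytic hw).deriv
  have hd : HasDerivAt (fun z : ℂ => (1 - z) ^ 3) (3 * (1 - z) ^ 2 * -1) z :=
    ((hasDerivAt_id' z).const_sub 1).fun_pow 3
  rw [hev.deriv_eq, ((hasDerivAt_const z (1 : ℂ)).fun_div hd (pow_ne_zero 3 h0)).deriv]
  field_simp
  ring

lemma deriv_deriv_halfPlaneCoanalytic {z : ℂ} (hz : z ∈ disk) :
    deriv (deriv halfPlaneCoanalytic) z = -(1 + 2 * z) / (1 - z) ^ 4 := by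
  have h0 := one_sub_ne_zero hz
  have hev : deriv halfPlaneCoanalytic =ᶠ[𝓝 z] fun z => -z / (1 - z) ^ 3 := by
    filter_upwards [isOpen_ball.mem_nhds hz] with w hw using
      (hasDerivAt_halfPlaneCoanalytic hw).deriv
  have hd : HasDerivAt (fun z : ℂ => (1 - z) ^ 3) (3 * (1 - z) ^ 2 * -1) z :=
    ((hasDerivAt_id' z).const_sub 1).fun_pow 3
  rw [hev.deriv_eq, ((hasDerivAt_id' z).fun_neg.fun_div hd (pow_ne_zero 3 h0)).deriv]
  field_simp
  ring

lemma differentiableOn_halfPlaneAnalytic : DifferentiableOn ℂ halfPlaneAnalytic disk := fun _ hz =>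
  (hasDerivAt_halfPlaneAnalytic hz).differentiableAt.differentiableWithinAt

lemma differentiableOn_halfPlaneCoanalytic : DifferentiableOn ℂ halfPlaneCoanalytic disk :=
  fun _ hz => (hasDerivAt_halfPlaneCoanalytic hz).differentiableAt.differentiableWithinAt

theorem isConvexHarmonic_halfPlaneMap : IsConvexHarmonic halfPlaneMap where
  harmonic := fun z hz => by
    have hn := isOpen_ball.mem_nhds hz
    exact (differentiableOn_halfPlaneAnalytic.analyticAt hn).harmonicAt.add
      ((differentiableOn_halfPlaneCoanalytic.analyticAt hn).harmonicAt.comp_CLM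
        (conjCLE : ℂ →L[ℝ] ℂ))
  univalent := injOn_halfPlaneMap
  convex_image := by
    rw [image_halfPlaneMap]
    exact convex_halfSpace_re_gt _

/-- Equality in the pointwise bound 3 + 2|z| along the positive radius; r → 1 gives sharpness. -/
lemma norm_preSchwarzian_halfPlaneMap {r : ℝ} (hr0 : 0 < r) (hr1 : r < 1) :
    ‖preSchwarzian halfPlaneMap r‖ * (1 - ‖(r : ℂ)‖ ^ 2) = 3 + 2 * r := by
  have hz : (r : ℂ) ∈ disk := by
    rw [mem_ball_zero_iff, norm_real, Real.norm_of_nonneg hr0.le]; exact hr1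
  have hs : 0 < 1 - r := by linarith
  have hs' : (1 - r : ℂ) ≠ 0 := one_sub_ne_zero hz
  have d1 : deriv halfPlaneAnalytic r = ((1 / (1 - r) ^ 3 : ℝ) : ℂ) := by
    rw [(hasDerivAt_halfPlaneAnalytic hz).deriv]; push_cast; rfl
  have d2 : deriv halfPlaneCoanalytic r = ((-r / (1 - r) ^ 3 : ℝ) : ℂ) := by
    rw [(hasDerivAt_halfPlaneCoanalytic hz).deriv]; push_cast; rfl
  have n1 : ‖deriv halfPlaneAnalytic r‖ = 1 / (1 - r) ^ 3 := by
    rw [d1, norm_real, Real.norm_of_nonneg (by positivity)]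
  have n2 : ‖deriv halfPlaneCoanalytic r‖ = r / (1 - r) ^ 3 := by
    rw [d2, norm_real, neg_div, norm_neg, Real.norm_of_nonneg (by positivity)]
  have hne : ‖deriv halfPlaneAnalytic r‖ ≠ ‖deriv halfPlaneCoanalytic r‖ := by
    rw [n1, n2]
    refine (div_lt_div_of_pos_right hr1 (by positivity)).ne'
  rw [preSchwarzian_eq (f := halfPlaneMap) differentiableOn_halfPlaneAnalytic differentiableOn_halfPlaneCoanalytic
    (fun _ _ => rfl) hz hne, deriv_deriv_halfPlaneAnalytic hz, deriv_deriv_halfPlaneCoanalytic hz,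
    n1, n2, d1, d2, conj_ofReal, conj_ofReal]
  have hJ : 0 < 1 - r ^ 2 := by nlinarith
  have e : (3 / (1 - (r : ℂ)) ^ 4 * ((1 / (1 - r) ^ 3 : ℝ) : ℂ) -
      -(1 + 2 * (r : ℂ)) / (1 - (r : ℂ)) ^ 4 * ((-r / (1 - r) ^ 3 : ℝ) : ℂ)) /
      (((1 / (1 - r) ^ 3) ^ 2 - (r / (1 - r) ^ 3) ^ 2 : ℝ) : ℂ) =
      (((3 + 2 * r) / (1 - r ^ 2) : ℝ) : ℂ) := by
    have e' : (3 / (1 - r) ^ 4 * (1 / (1 - r) ^ 3) -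
        -(1 + 2 * r) / (1 - r) ^ 4 * (-r / (1 - r) ^ 3)) /
        ((1 / (1 - r) ^ 3) ^ 2 - (r / (1 - r) ^ 3) ^ 2) = (3 + 2 * r) / (1 - r ^ 2) := by
      rw [show (1 / (1 - r) ^ 3) ^ 2 - (r / (1 - r) ^ 3) ^ 2 = (1 - r ^ 2) / (1 - r) ^ 6 by
        field_simp]
      field_simp
      ring
    rw [← e']
    push_cast
    rfl
  rw [e, norm_real, norm_real, Real.norm_of_nonneg (by positivity), Real.norm_of_nonneg hr0.le,
    div_mul_cancel₀ _ hJ.ne']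

theorem preSchwarzianNorm_halfPlaneMap : preSchwarzianNorm halfPlaneMap = 5 := by
  refine le_antisymm isConvexHarmonic_halfPlaneMap.preSchwarzianNorm_le ?_
  have hlim : Tendsto (fun r : ℝ => ENNReal.ofReal (3 + 2 * r)) (𝓝[<] 1)
      (𝓝 (ENNReal.ofReal (3 + 2 * 1))) :=
    ENNReal.tendsto_ofReal ((Continuous.tendsto (f := fun r : ℝ => 3 + 2 * r)
      (by fun_prop) 1).mono_left nhdsWithin_le_nhds)
  rw [show (3 + 2 * 1 : ℝ) = 5 by norm_num, ENNReal.ofReal_ofNat] at hlim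
  refine le_of_tendsto hlim ?_
  filter_upwards [Ioo_mem_nhdsLT (zero_lt_one' ℝ)] with r hr
  rw [← norm_preSchwarzian_halfPlaneMap hr.1 hr.2]
  refine le_iSup₂_of_le (r : ℂ) ?_ le_rfl
  rw [mem_ball_zero_iff, norm_real, Real.norm_of_nonneg hr.1.le]
  exact hr.2

end HarmonicMapping

theorem mainTheorem7 :
    (∀ f : ℂ → ℂ, HarmonicMapping.IsConvexHarmonic f →
      (∀ z ∈ HarmonicMapping.disk, HarmonicMapping.jacobian f z ≠ 0) ∧
        HarmonicMapping.preSchwarzianNorm f ≤ 5) ∧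
    HarmonicMapping.IsConvexHarmonic HarmonicMapping.halfPlaneMap ∧
    HarmonicMapping.preSchwarzianNorm HarmonicMapping.halfPlaneMap = 5 :=
  ⟨fun _ hf => ⟨fun _ hz => hf.jacobian_ne_zero hz, hf.preSchwarzianNorm_le⟩,
    HarmonicMapping.isConvexHarmonic_halfPlaneMap, HarmonicMapping.preSchwarzianNorm_halfPlaneMap⟩
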